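/- Let $\alpha,\beta,c>0$. For $n\ge 2$ vertices, the dynamic Erdős–Rényi graph is the process $\{G(t),\ t\ge 0\}$ on $n$ labelled vertices in which, independently for each pair of vertices, an absent edge is added after an $\mathrm{Exp}(\beta/(n-1))$-distributed time and a present edge is removed after an $\mathrm{Exp}(\alpha)$-distributed time. Let $\eta(t)$ be the number of edges of $G(t)$, let $[x]$ denote the integer closest to $x$, and let $\tau_j(i)=\inf\{t>0:\eta(t)=i\}$ when $G(0)$ is a given graph with $j$ edges. Put $i=[cn]$. Then, as $n\to\infty$: (a) If $c<\frac{\beta}{2\alpha}$, then $\tau_0(i)\to \frac{-\log\left(1-\frac{2\alpha}{\beta}c\right)}{\alpha}$ in probability and $\mathbb E(\tau_0(i))\to \frac{-\log\left(1-\frac{2\alpha}{\beta}c\right)}{\alpha}$. (b) If $c=\frac{\beta}{2\alpha}$, then $\mathbb E(\tau_j(i))=O(\log n)$ for every starting number of edges $j$, uniformly in $0\le j\le\binom n2$; that is, there is a constant $M$ depending only on $\alpha,\beta$ such that for all large enough $n$ and all such $j$, $\mathbb E(\tau_j(i))\le M\log n$. (c) If $c>\frac{\beta}{2\alpha}$,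 then $K:=c\log\left(\frac{2\alpha}{\beta}c\right)-c+\frac{\beta}{2\alpha}>0$, and there are constants $C_1,C_2>0$ depending only on $\alpha,\beta,c$ such that for all large enough $n$ $$C_1\,n^{-1}e^{nK}\le \mathbb E(\tau_0(i))\le C_2\,n^{-1/2}e^{nK}.$$ Furthermore, $\tau_0(i)/\mathbb E(\tau_0(i))$ converges in distribution to an exponential random variable with expectation $1$. -/

import Mathlib

open MeasureTheory ProbabilityTheory Filter Topology
open scoped NNReal ENNReal

universe u

noncomputable section

/-- `X` is a continuous-time Markov chain (with right-continuous paths) on the finite state space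
`S`, with generator `Q` and initial state `x₀`, under the probability measure `P`: its
finite-dimensional distributions are those given by the transition semigroup `t ↦ exp (t Q)`. -/
structure IsMarkovJumpProcess {Ω S : Type*} [MeasurableSpace Ω] [Fintype S] [DecidableEq S]
    (P : Measure Ω) (Q : Matrix S S ℝ) (x₀ : S) (X : ℝ≥0 → Ω → S) : Prop where
  measurableSet_eq : ∀ t x, MeasurableSet {ω | X t ω = x}
  right_continuous : ∀ᵐ ω ∂P, ∀ t, ∀ᶠ s in 𝓝[>] t, X s ω = X t ω
  fin_dim_dist : ∀ (k : ℕ) (t : ℕ → ℝ≥0) (x : ℕ → S), Monotone t → t 0 = 0 → x 0 = x₀ →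
    P.real {ω | ∀ l ≤ k, X (t l) ω = x l} =
      ∏ l ∈ Finset.range k,
        NormedSpace.exp (((t (l + 1) : ℝ) - (t l : ℝ)) • Q) (x l) (x (l + 1))

/-- Generator of the birth-death (on-off) process on `{0, 1} = {false, true}` with birth rate `lam`
and death rate `mu`. -/
def onOffGenerator (lam mu : ℝ) : Matrix Bool Bool ℝ :=
  Matrix.of fun a b => match a, b with
    | false, false => -lam
    | false, true => lam
    | true, false => mu
    | true, true => -mu

/-- The unordered pairs of distinct vertices. -/
abbrev VertexPair (n : ℕ) : Type := {e : Sym2 (Fin n) // ¬ e.IsDiag}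

open Classical in
/-- Indicator of the presence of the edge `e` in the graph `H`. -/
def edgeIndicator {n : ℕ} (H : SimpleGraph (Fin n)) (e : VertexPair n) : Bool :=
  decide ((e : Sym2 (Fin n)) ∈ H.edgeSet)

/-- The number of edges of a graph. -/
def numEdges {n : ℕ} (H : SimpleGraph (Fin n)) : ℕ := H.edgeSet.ncard

/-- `G` is a dynamic Erdős-Rényi graph on `n` vertices with parameters `α`, `β`, started in the
graph `G₀`: the indicator processes of the vertex pairs are independent (as processes), and each
of them is an on-off process with birth rate `β / (n - 1)` and death rate `α`. -/
structure IsDynamicERGraph (α β : ℝ) {n : ℕ} (G₀ : SimpleGraph (Fin n)) {Ω : Type*}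
    [MeasurableSpace Ω] (P : Measure Ω) (G : ℝ≥0 → Ω → SimpleGraph (Fin n)) : Prop where
  edge_process : ∀ e : VertexPair n,
    IsMarkovJumpProcess P (onOffGenerator (β / ((n : ℝ) - 1)) α) (edgeIndicator G₀ e)
      (fun t ω => edgeIndicator (G t ω) e)
  independent : iIndepFun
    (fun (e : VertexPair n) (ω : Ω) (t : ℝ≥0) => edgeIndicator (G t ω) e) P

/-- The first time `t > 0` at which the graph has exactly `i` edges (`∞` if there is none). -/
def hittingTime {n : ℕ} {Ω : Type*} (G : ℝ≥0 → Ω → SimpleGraph (Fin n)) (i : ℕ) (ω : Ω) : ℝ≥0∞ :=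
  ⨅ (t : ℝ≥0) (_ : 0 < t ∧ numEdges (G t ω) = i), (t : ℝ≥0∞)

/-- The closest integer to `c n`. -/
def edgeTarget (c : ℝ) (n : ℕ) : ℕ := (round (c * n)).toNat

/-- The exponential distribution with expectation `1` is a probability measure. -/
instance isProbabilityMeasure_expMeasure_one : IsProbabilityMeasure (expMeasure 1) :=
  isProbabilityMeasure_expMeasure one_pos

end

/-! The number of edges is a birth-death chain on `{0, …, N}`, `N = n.choose 2`. Its birth rate in
`k` is `(N - k) β / (n - 1) = n β / 2 - k β / (n - 1)`, its death rate `k α`. To leading order the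
net drift is `n β / 2 - k α`, which vanishes at `k = n β / (2 α)`; the three regimes are the
positions of `c n` relative to this level.

Everything about the hitting time follows from test functions on `ℕ`. A nonnegative function with
generator at most `-1` off the target bounds the mean from above (`lintegral_hitTime_le`). One
vanishing at the target with generator at least `-1` bounds it from below (`le_lintegral_hitTime`).
An approximate solution `u` of `L u = s u` with `u = 1` at the target approximates the Laplace
transform at `s`, with an error `w` whose generator dominates the residual
(`norm_laplace_hitTime_sub_le`). These principles are proved by telescoping along dyadic skeletons
and refining the mesh; the generator enters only as the derivative at `0` of the transition
matrices.

(a) Below equilibrium the passage from `k` to `k + 1` takes about one over the net drift. These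
times sum to a Riemann sum of a logarithm, and `u = exp (-F)` nearly solves the Laplace equation, as
for a deterministic time. Convergence of the mean and of the Laplace transform at `1` to those of a
constant gives convergence in probability, by strict convexity of the exponential.

(b) At equilibrium the drift towards the target is about `α` times the distance, so increments
proportional to one over the distance give a function of suitable drift and of logarithmic size.

(c) Above equilibrium the mean passage times are explicit: `R k / r k`, where `R k` is a partial sum
of binomial weights divided by the last one (`passageSum_mul_weight`). Markov's inequality,
factorial bounds and geometric growth of `R` near the target give the bounds on the mean. For the
limit law, with `F` the mean remaining time and `m = F 0`, the function `1 - z / (1 + z) * F / m`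
nearly solves the Laplace equation: `F` is close to `m` up to a level `J` below the target, and the
time spent above `J` is a negligible part of `m`. -/

section JumpProcess

/-! ### Hitting times and dyadic skeletons, path by path. -/

/-- `X` is a right-continuous process on the finite set `S`, started in `x₀`, whose skeletons
`k ↦ X (k h)` are Markov chains with transition matrix `K h`; the matrix `L` is the derivative
of `K` at `0`. -/
structure HasGenerator {Ω S : Type*} [MeasurableSpace Ω] [Fintype S] [DecidableEq S]
    [MeasurableSpace S] (P : Measure Ω) (K : ℝ → S → S → ℝ) (L : S → S → ℝ) (x₀ : S)
    (X : ℝ≥0 → Ω → S) : Prop where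
  measurable : ∀ t, Measurable (X t)
  right_continuous : ∀ᵐ ω ∂P, ∀ t, ∀ᶠ s in 𝓝[>] t, X s ω = X t ω
  path_law : ∀ (h : ℝ≥0) (k : ℕ) (x : ℕ → S), x 0 = x₀ →
    P.real {ω | ∀ l ≤ k, X (l * h) ω = x l} = ∏ l ∈ Finset.range k, K h (x l) (x (l + 1))
  kernel_zero : ∀ x y, K 0 x y = if x = y then 1 else 0
  hasDerivAt_kernel : ∀ x y, HasDerivAt (fun h => K h x y) (L x y) 0

/-- The first positive time at which `X` is in `B`. -/
noncomputable def hitTime {Ω S : Type*} (X : ℝ≥0 → Ω → S) (B : Set S) (ω : Ω) : ℝ≥0∞ :=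
  ⨅ (t : ℝ≥0) (_ : 0 < t ∧ X t ω ∈ B), (t : ℝ≥0∞)

/-- The event that the skeleton of mesh `h` has not visited `B` up to its `k`-th step. -/
def alive {Ω S : Type*} (X : ℝ≥0 → Ω → S) (B : Set S) (h : ℝ≥0) (k : ℕ) : Set Ω :=
  {ω | ∀ l ≤ k, X (l * h) ω ∉ B}

/-- The first time at which the skeleton of mesh `h` is in `B`. -/
noncomputable def skeletonTime {Ω S : Type*} (X : ℝ≥0 → Ω → S) (B : Set S) (h : ℝ≥0) (ω : Ω) : ℝ≥0∞ :=
  ∑' k, (alive X B h k).indicator (fun _ => (h : ℝ≥0∞)) ω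

/-- The action of a matrix on functions. -/
noncomputable def matAct {S E : Type*} [Fintype S] [AddCommMonoid E] [Module ℝ E] (A : S → S → ℝ) (g : S → E)
    (x : S) : E :=
  ∑ y, A x y • g y

section Pathwise

variable {Ω S : Type*} {X : ℝ≥0 → Ω → S} {B : Set S} {h : ℝ≥0} {ω : Ω}

lemma alive_anti {k l : ℕ} (hkl : k ≤ l) : alive X B h l ⊆ alive X B h k :=
  fun _ hω j hj => hω j (hj.trans hkl)

lemma skeletonTime_le {k : ℕ} (hk : X (k * h) ω ∈ B) : skeletonTime X B h ω ≤ k * h := by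
  unfold skeletonTime
  rw [tsum_eq_sum (s := Finset.range k)]
  · calc _ ≤ ∑ l ∈ Finset.range k, (h : ℝ≥0∞) :=
        Finset.sum_le_sum fun l _ => Set.indicator_le_self' (fun _ _ => zero_le) ω
      _ = _ := by simp
  · intro l hl
    rw [Finset.mem_range, not_lt] at hl
    exact Set.indicator_of_notMem (fun hω : ω ∈ alive X B h l => hω k hl hk) _

lemma skeletonTime_eq {k : ℕ} (hk : X (k * h) ω ∈ B) (hlt : ∀ l < k, X (l * h) ω ∉ B) :
    skeletonTime X B h ω = k * h := by
  refine le_antisymm (skeletonTime_le hk) ?_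
  calc (k : ℝ≥0∞) * h = ∑ l ∈ Finset.range k, (h : ℝ≥0∞) := by simp
    _ = ∑ l ∈ Finset.range k, (alive X B h l).indicator (fun _ => (h : ℝ≥0∞)) ω := by
        refine Finset.sum_congr rfl fun l hl => ?_
        rw [Set.indicator_of_mem]
        exact fun j hj => hlt j (hj.trans_lt (Finset.mem_range.1 hl))
    _ ≤ _ := ENNReal.sum_le_tsum _

lemma skeletonTime_eq_top (hh : 0 < h) (hω : ∀ k : ℕ, X (k * h) ω ∉ B) :
    skeletonTime X B h ω = ∞ := by
  unfold skeletonTime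
  rw [← ENNReal.tsum_const_eq_top_of_ne_zero (α := ℕ) (c := (h : ℝ≥0∞)) (by simpa using hh.ne')]
  exact tsum_congr fun k => Set.indicator_of_mem (s := alive X B h k) (fun j _ => hω j) _

/-- A start in `B` is excluded because the skeleton counts a visit at time `0`, whereas `hitTime`
only sees positive times. -/
lemma hitTime_le_skeletonTime (hh : 0 < h) (h0 : X 0 ω ∉ B) :
    hitTime X B ω ≤ skeletonTime X B h ω := by
  classical
  by_cases hex : ∃ k : ℕ, X (k * h) ω ∈ B
  · rw [skeletonTime_eq (Nat.find_spec hex) fun l hl => Nat.find_min hex hl]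
    have hpos : Nat.find hex ≠ 0 := fun h' => by
      have := Nat.find_spec hex
      rw [h'] at this
      simp [h0] at this
    have := iInf₂_le (f := fun (t : ℝ≥0) (_ : 0 < t ∧ X t ω ∈ B) => (t : ℝ≥0∞))
      ((Nat.find hex : ℕ) * h) ⟨by positivity, Nat.find_spec hex⟩
    simpa [hitTime] using this
  · push Not at hex
    rw [skeletonTime_eq_top hh hex]
    exact le_top

/-- Dyadic grids are nested, so a finer one cannot see `B` later. This provides the dominating
function when the mesh tends to `0`. -/
lemma skeletonTime_anti (m : ℕ) :
    skeletonTime X B ((1 / 2) ^ (m + 1)) ω ≤ skeletonTime X B ((1 / 2) ^ m) ω := by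
  classical
  by_cases hex : ∃ k : ℕ, X (k * (1 / 2) ^ m) ω ∈ B
  · rw [skeletonTime_eq (Nat.find_spec hex) fun l hl => Nat.find_min hex hl]
    have key : ((2 * Nat.find hex : ℕ) : ℝ≥0) * (1 / 2) ^ (m + 1)
        = (Nat.find hex : ℕ) * (1 / 2) ^ m := by
      push_cast
      rw [pow_succ]
      have : (2 : ℝ≥0) * (1 / 2) = 1 := by norm_num
      calc _ = ((Nat.find hex : ℕ) : ℝ≥0) * (1 / 2) ^ m * (2 * (1 / 2)) := by ring
        _ = _ := by rw [this, mul_one]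
    have h1 := skeletonTime_le (X := X) (B := B) (h := (1 / 2) ^ (m + 1)) (ω := ω)
      (k := 2 * Nat.find hex) (by rw [key]; exact Nat.find_spec hex)
    refine h1.trans_eq ?_
    rw [← ENNReal.coe_natCast, ← ENNReal.coe_mul, key]
    simp
  · push Not at hex
    rw [skeletonTime_eq_top (by positivity) hex]
    exact le_top

/-- By right continuity the path stays in `B` on an interval just after any visit `t`, and a fine
enough grid has a point in that interval within one mesh of `t`. -/
lemma tendsto_skeletonTime (h0 : X 0 ω ∉ B) (hrc : ∀ t, ∀ᶠ s in 𝓝[>] t, X s ω = X t ω) :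
    Tendsto (fun m : ℕ => skeletonTime X B ((1 / 2) ^ m) ω) atTop (𝓝 (hitTime X B ω)) := by
  have hpow : Tendsto (fun m : ℕ => ((1 / 2 : ℝ≥0)) ^ m) atTop (𝓝 0) :=
    NNReal.tendsto_pow_atTop_nhds_zero_of_lt_one (by norm_num)
  rw [tendsto_order]
  refine ⟨fun a ha => Eventually.of_forall fun m =>
    ha.trans_le (hitTime_le_skeletonTime (by positivity) h0), fun b hb => ?_⟩
  unfold hitTime at hb
  obtain ⟨t, ht⟩ := iInf_lt_iff.1 hb
  obtain ⟨⟨ht0, htB⟩, htb⟩ := iInf_lt_iff.1 ht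
  obtain ⟨d, hd, hdX⟩ := mem_nhdsGT_iff_exists_Ioo_subset.1 (hrc t)
  have hd : t < d := hd
  have hsum : Tendsto (fun m : ℕ => ((t + (1 / 2) ^ m : ℝ≥0) : ℝ≥0∞)) atTop (𝓝 t) := by
    rw [ENNReal.tendsto_coe]
    simpa using tendsto_const_nhds.add hpow
  have hsum' : Tendsto (fun m : ℕ => t + (1 / 2 : ℝ≥0) ^ m) atTop (𝓝 t) := by
    simpa using tendsto_const_nhds.add hpow
  filter_upwards [hsum.eventually_lt_const htb, hsum'.eventually_lt_const hd] with m hm hmd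
  set h : ℝ≥0 := (1 / 2) ^ m with hh
  have hhpos : 0 < h := by positivity
  set k := ⌊t / h⌋₊ + 1 with hk
  have h1 : t < k * h := by
    have := Nat.lt_floor_add_one (t / h)
    rw [div_lt_iff₀ hhpos] at this
    simpa [hk] using this
  have h2 : k * h ≤ t + h := by
    have := Nat.floor_le (zero_le : 0 ≤ t / h)
    rw [le_div_iff₀ hhpos] at this
    rw [hk]
    push_cast
    rw [add_mul, one_mul]
    gcongr
  have h3 : X (k * h) ω ∈ B := by
    have : X (k * h) ω = X t ω := hdX ⟨h1, h2.trans_lt hmd⟩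
    rwa [this]
  calc _ ≤ (k : ℝ≥0∞) * h := skeletonTime_le h3
    _ = ((k * h : ℝ≥0) : ℝ≥0∞) := by push_cast; rfl
    _ ≤ ((t + h : ℝ≥0) : ℝ≥0∞) := by exact_mod_cast h2
    _ < b := hm

-- Right continuity reduces the infimum to countably many times, which makes the hitting time almost
-- everywhere measurable.
open Classical in
lemma hitTime_eq_iInf_rat (hrc : ∀ t, ∀ᶠ s in 𝓝[>] t, X s ω = X t ω) :
    hitTime X B ω = ⨅ q : ℚ, if 0 < q ∧ X (Real.toNNReal q) ω ∈ B
      then (Real.toNNReal q : ℝ≥0∞) else ∞ := by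
  refine le_antisymm (le_iInf fun q => ?_) (le_of_forall_gt fun b hb => ?_)
  · split_ifs with hq
    · exact iInf₂_le (f := fun (t : ℝ≥0) (_ : 0 < t ∧ X t ω ∈ B) => (t : ℝ≥0∞)) _
        ⟨by simpa using hq.1, hq.2⟩
    · exact le_top
  · unfold hitTime at hb
    obtain ⟨t, ht⟩ := iInf_lt_iff.1 hb
    obtain ⟨⟨ht0, htB⟩, htb⟩ := iInf_lt_iff.1 ht
    obtain ⟨d, hd, hdX⟩ := mem_nhdsGT_iff_exists_Ioo_subset.1 (hrc t)
    have hd : t < d := hd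
    obtain ⟨e, hte, heb⟩ : ∃ e : ℝ≥0, t < e ∧ (e : ℝ≥0∞) < b := by
      obtain ⟨e, h1, h2⟩ := ENNReal.lt_iff_exists_nnreal_btwn.1 htb
      exact ⟨e, by exact_mod_cast h1, h2⟩
    obtain ⟨q, hq1, hq2⟩ := exists_rat_btwn (show (t : ℝ) < min d e by
      exact_mod_cast lt_min hd hte)
    have hq0 : (0 : ℝ) ≤ q := t.2.trans hq1.le
    have hqt : t < Real.toNNReal q := by
      rw [← NNReal.coe_lt_coe, Real.coe_toNNReal _ hq0]; exact hq1
    have hqd : Real.toNNReal q < min d e := by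
      rw [← NNReal.coe_lt_coe, Real.coe_toNNReal _ hq0]; exact_mod_cast hq2
    have hX : X (Real.toNNReal q) ω = X t ω := hdX ⟨hqt, hqd.trans_le (min_le_left _ _)⟩
    refine (iInf_le _ q).trans_lt ?_
    rw [if_pos ⟨by exact_mod_cast t.2.trans_lt hq1, by rwa [hX]⟩]
    refine lt_of_le_of_lt ?_ heb
    exact_mod_cast (hqd.trans_le (min_le_right _ _)).le

end Pathwise

end JumpProcess

set_option linter.unusedSectionVars false

/-! ### Drift inequalities for the discrete-time skeleton. -/

section Skeleton

variable {Ω S : Type*} [MeasurableSpace Ω] [Fintype S] [DecidableEq S] [MeasurableSpace S]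
  [DiscreteMeasurableSpace S] {P : Measure Ω} [IsProbabilityMeasure P] {K : ℝ → S → S → ℝ}
  {L : S → S → ℝ} {x₀ : S} {X : ℝ≥0 → Ω → S} {B : Set S} {h : ℝ≥0}
  {E : Type*} [NormedAddCommGroup E] [NormedSpace ℝ E] [CompleteSpace E]

lemma integral_comp_of_fintype {T : Type*} [Fintype T] [MeasurableSpace T]
    [DiscreteMeasurableSpace T] {Z : Ω → T} (hZ : Measurable Z) (g : T → E) :
    ∫ ω, g (Z ω) ∂P = ∑ t, P.real {ω | Z ω = t} • g t := by
  have : IsProbabilityMeasure (P.map Z) := Measure.isProbabilityMeasure_map hZ.aemeasurable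
  rw [← integral_map hZ.aemeasurable (f := g) (by fun_prop), integral_fintype (by simp)]
  refine Finset.sum_congr rfl fun t _ => ?_
  rw [map_measureReal_apply hZ (by measurability)]
  rfl

lemma integrable_comp_of_fintype {T : Type*} [Fintype T] [MeasurableSpace T]
    [DiscreteMeasurableSpace T] {Z : Ω → T} (hZ : Measurable Z) (g : T → E) :
    Integrable (fun ω => g (Z ω)) P := by
  have : IsProbabilityMeasure (P.map Z) := Measure.isProbabilityMeasure_map hZ.aemeasurable
  exact (Integrable.of_finite (μ := P.map Z) (f := g)).comp_measurable hZ

variable (hX : HasGenerator P K L x₀ X)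

include hX

lemma HasGenerator.ae_start : ∀ᵐ ω ∂P, X 0 ω = x₀ := by
  have h1 := hX.path_law 0 0 (fun _ => x₀) rfl
  have hm : MeasurableSet {ω | X 0 ω = x₀} := hX.measurable 0 (measurableSet_singleton x₀)
  have h2 : P.real {ω | X 0 ω = x₀} = 1 := by simpa using h1
  refine (prob_compl_eq_zero_iff hm).2 ?_
  rwa [measureReal_def, ENNReal.toReal_eq_one_iff] at h2

lemma HasGenerator.measurableSet_alive (k : ℕ) : MeasurableSet (alive X B h k) := by
  have : alive X B h k = ⋂ l ≤ k, {ω | X (l * h) ω ∈ Bᶜ} := by ext; simp [alive]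
  rw [this]
  exact MeasurableSet.iInter fun l => MeasurableSet.iInter fun _ =>
    hX.measurable _ (MeasurableSet.of_discrete)

lemma HasGenerator.measureReal_path_step (k : ℕ) (p : Fin (k + 1) → S) (y : S) :
    P.real {ω | (fun l : Fin (k + 1) => X (l * h) ω, X ((k + 1 : ℕ) * h) ω) = (p, y)}
      = P.real {ω | (fun l : Fin (k + 1) => X (l * h) ω) = p} * K h (p (Fin.last k)) y := by
  by_cases hp : p 0 = x₀
  -- `path_law` takes a sequence indexed by `ℕ`; only its entries up to `k + 1` matter, and `y` sits
  -- at `k + 1`.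
  · set x : ℕ → S := fun l => if hl : l < k + 1 then p ⟨l, hl⟩ else y with hx
    have hx0 : x 0 = x₀ := by simp [hx]; exact hp
    have hxl : ∀ l : Fin (k + 1), x l = p l := fun l => by simp only [hx, l.2, dite_true]
    have e1 : {ω | (fun l : Fin (k + 1) => X (l * h) ω) = p} = {ω | ∀ l ≤ k, X (l * h) ω = x l} := by
      ext ω
      simp only [Set.mem_ofPred_eq, funext_iff]
      constructor
      · intro H l hl
        have := H ⟨l, Nat.lt_succ_of_le hl⟩
        rw [← hxl] at this
        exact this
      · intro H l
        rw [← hxl]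
        exact H l (Nat.le_of_lt_succ l.2)
    have e2 : {ω | (fun l : Fin (k + 1) => X (l * h) ω, X ((k + 1 : ℕ) * h) ω) = (p, y)}
        = {ω | ∀ l ≤ k + 1, X (l * h) ω = x l} := by
      ext ω
      have := Set.ext_iff.1 e1 ω
      simp only [Set.mem_ofPred_eq] at this
      simp only [Set.mem_ofPred_eq, Prod.mk.injEq, this]
      constructor
      · rintro ⟨H1, H2⟩ l hl
        rcases Nat.le_succ_iff.1 hl with h' | h'
        · exact H1 l h'
        · rw [h']; simp only [hx, lt_irrefl, dite_false]; exact H2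
      · intro H
        refine ⟨fun l hl => H l (by omega), ?_⟩
        have := H (k + 1) le_rfl
        simp only [hx, lt_irrefl, dite_false] at this
        exact this
    rw [e1, e2, hX.path_law h _ x hx0, hX.path_law h _ x hx0, Finset.prod_range_succ]
    congr 2
    · exact hxl (Fin.last k)
    · simp [hx]
  -- The law of paths is only given for the start `x₀`; any other start is a null event.
  · have hz : P.real {ω | (fun l : Fin (k + 1) => X (l * h) ω) = p} = 0 := by
      rw [measureReal_eq_zero_iff]
      refine measure_mono_null ?_ (ae_iff.1 hX.ae_start)
      intro ω hω h0
      apply hp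
      rw [← congrFun hω 0]
      simpa using h0
    rw [hz, zero_mul]
    refine le_antisymm (hz ▸ measureReal_mono ?_) measureReal_nonneg
    intro ω hω
    exact (Prod.mk.inj hω).1

lemma HasGenerator.measurable_path (k : ℕ) :
    Measurable fun ω => (fun l : Fin (k + 1) => X (l * h) ω, X ((k + 1 : ℕ) * h) ω) :=
  (measurable_pi_lambda _ fun _ => hX.measurable _).prodMk (hX.measurable _)

/-- The Markov property of the skeleton, on the event that `B` has not been visited. -/
lemma HasGenerator.setIntegral_alive_step (k : ℕ) (g : S → E) :
    ∫ ω in alive X B h k, g (X ((k + 1 : ℕ) * h) ω) ∂P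
      = ∫ ω in alive X B h k, matAct (K h) g (X (k * h) ω) ∂P := by
  classical
  have hA : ∀ ω, ω ∈ alive X B h k ↔ ∀ l : Fin (k + 1), X (l * h) ω ∉ B := fun ω =>
    ⟨fun H l => H l (Nat.le_of_lt_succ l.2), fun H l hl => H ⟨l, Nat.lt_succ_of_le hl⟩⟩
  have hZ : Measurable fun ω => (fun l : Fin (k + 1) => X (l * h) ω) :=
    measurable_pi_lambda _ fun _ => hX.measurable _
  rw [← integral_indicator (hX.measurableSet_alive k), ← integral_indicator (hX.measurableSet_alive k)]
  have e1 := integral_comp_of_fintype (P := P) (hX.measurable_path (h := h) k)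
    (fun q => if ∀ l, q.1 l ∉ B then g q.2 else 0)
  have e2 := integral_comp_of_fintype (P := P) hZ
    (fun p => if ∀ l, p l ∉ B then matAct (K h) g (p (Fin.last k)) else 0)
  refine ((integral_congr_ae (Eventually.of_forall fun ω => ?_)).trans
    (e1.trans (Eq.trans ?_ e2.symm))).trans (integral_congr_ae (Eventually.of_forall fun ω => ?_))
  · simp only [Set.indicator, hA]
  · rw [Fintype.sum_prod_type]
    refine Finset.sum_congr rfl fun p _ => ?_
    simp only [hX.measureReal_path_step]
    split_ifs
    · simp only [matAct, Finset.smul_sum, smul_smul]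
    · simp only [smul_zero, Finset.sum_const_zero]
  · simp only [Set.indicator, hA, Fin.val_last]

lemma HasGenerator.integrable_comp (t : ℝ≥0) (g : S → E) : Integrable (fun ω => g (X t ω)) P :=
  integrable_comp_of_fintype (hX.measurable t) g

lemma HasGenerator.setIntegral_alive_zero (hx₀ : x₀ ∉ B) (g : S → E) :
    ∫ ω in alive X B h 0, g (X ((0 : ℕ) * h) ω) ∂P = g x₀ := by
  rw [← integral_indicator (hX.measurableSet_alive 0)]
  have : ∀ᵐ ω ∂P, (alive X B h 0).indicator (fun ω => g (X ((0 : ℕ) * h) ω)) ω = g x₀ := by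
    filter_upwards [hX.ae_start] with ω hω
    rw [Set.indicator_of_mem]
    · simp [hω]
    · intro l hl
      obtain rfl : l = 0 := by omega
      simpa [hω] using hx₀
  rw [integral_congr_ae this]
  simp

/-- Drift inequality for a nonnegative function along the skeleton. -/
lemma HasGenerator.setIntegral_alive_succ_le {f r : S → ℝ} (hf : ∀ x, 0 ≤ f x)
    (hdrift : ∀ x ∉ B, matAct (K h) f x ≤ f x - r x) (k : ℕ) :
    ∫ ω in alive X B h (k + 1), f (X ((k + 1 : ℕ) * h) ω) ∂P
      ≤ ∫ ω in alive X B h k, f (X (k * h) ω) ∂P - ∫ ω in alive X B h k, r (X (k * h) ω) ∂P := by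
  calc _ ≤ ∫ ω in alive X B h k, f (X ((k + 1 : ℕ) * h) ω) ∂P :=
        setIntegral_mono_set (hX.integrable_comp _ f).integrableOn
          (Eventually.of_forall fun ω => hf _) (alive_anti k.le_succ).eventuallyLE
    _ = ∫ ω in alive X B h k, matAct (K h) f (X (k * h) ω) ∂P := hX.setIntegral_alive_step k f
    _ ≤ ∫ ω in alive X B h k, (f (X (k * h) ω) - r (X (k * h) ω)) ∂P := by
        refine setIntegral_mono_on (hX.integrable_comp _ _).integrableOn
          ((hX.integrable_comp _ f).sub (hX.integrable_comp _ r)).integrableOn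
          (hX.measurableSet_alive k) fun ω hω => hdrift _ (hω k le_rfl)
    _ = _ := integral_sub (hX.integrable_comp _ f).integrableOn
          (hX.integrable_comp _ r).integrableOn

/-- Drift inequality for a function vanishing on `B` along the skeleton. -/
lemma HasGenerator.le_setIntegral_alive_succ {f r : S → ℝ} (hf : ∀ x ∈ B, f x = 0)
    (hdrift : ∀ x ∉ B, f x - r x ≤ matAct (K h) f x) (k : ℕ) :
    ∫ ω in alive X B h k, f (X (k * h) ω) ∂P - ∫ ω in alive X B h k, r (X (k * h) ω) ∂P
      ≤ ∫ ω in alive X B h (k + 1), f (X ((k + 1 : ℕ) * h) ω) ∂P := by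
  calc _ = ∫ ω in alive X B h k, (f (X (k * h) ω) - r (X (k * h) ω)) ∂P :=
        (integral_sub (hX.integrable_comp _ f).integrableOn
          (hX.integrable_comp _ r).integrableOn).symm
    _ ≤ ∫ ω in alive X B h k, matAct (K h) f (X (k * h) ω) ∂P := by
        refine setIntegral_mono_on ((hX.integrable_comp _ f).sub (hX.integrable_comp _ r)).integrableOn
          (hX.integrable_comp _ _).integrableOn
          (hX.measurableSet_alive k) fun ω hω => hdrift _ (hω k le_rfl)
    _ = ∫ ω in alive X B h k, f (X ((k + 1 : ℕ) * h) ω) ∂P :=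
        (hX.setIntegral_alive_step k f).symm
    _ = _ := by
        refine setIntegral_eq_of_subset_of_forall_sdiff_eq_zero (hX.measurableSet_alive k)
          (alive_anti k.le_succ) fun ω hω => hf _ ?_
        by_contra hB
        refine hω.2 fun l hl => ?_
        rcases Nat.le_succ_iff.1 hl with h' | h'
        · exact hω.1 l h'
        · rwa [h']

/-- The drift inequality telescopes, and the remaining boundary integral is nonnegative. The sum is
`κ` times a partial sum of the mean of `skeletonTime`. -/
lemma HasGenerator.sum_alive_le {f : S → ℝ} {κ : ℝ} (hx₀ : x₀ ∉ B) (hf : ∀ x, 0 ≤ f x)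
    (hdrift : ∀ x ∉ B, matAct (K h) f x ≤ f x - h * κ) (k : ℕ) :
    ∑ l ∈ Finset.range k, h * κ * P.real (alive X B h l) ≤ f x₀ := by
  have key : ∑ l ∈ Finset.range k, h * κ * P.real (alive X B h l)
      ≤ f x₀ - ∫ ω in alive X B h k, f (X (k * h) ω) ∂P := by
    induction k with
    | zero => rw [hX.setIntegral_alive_zero hx₀]; simp
    | succ k ih =>
      have := hX.setIntegral_alive_succ_le hf hdrift k
      rw [setIntegral_const, smul_eq_mul] at this
      rw [Finset.sum_range_succ]
      linarith
  have : 0 ≤ ∫ ω in alive X B h k, f (X (k * h) ω) ∂P := integral_nonneg fun ω => hf _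
  linarith

/-- Same telescoping in the other direction. As `f` has no sign off `B`, the boundary integral stays
and must be shown to vanish in the limit. -/
lemma HasGenerator.le_sum_alive {f : S → ℝ} {κ : ℝ} (hx₀ : x₀ ∉ B) (hf : ∀ x ∈ B, f x = 0)
    (hdrift : ∀ x ∉ B, f x - h * κ ≤ matAct (K h) f x) (k : ℕ) :
    f x₀ ≤ ∑ l ∈ Finset.range k, h * κ * P.real (alive X B h l)
      + ∫ ω in alive X B h k, f (X (k * h) ω) ∂P := by
  induction k with
  | zero => rw [hX.setIntegral_alive_zero hx₀]; simp
  | succ k ih =>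
    have := hX.le_setIntegral_alive_succ hf hdrift k
    rw [setIntegral_const, smul_eq_mul] at this
    rw [Finset.sum_range_succ]
    linarith

lemma HasGenerator.lintegral_skeletonTime :
    ∫⁻ ω, skeletonTime X B h ω ∂P = ∑' k, h * P (alive X B h k) := by
  unfold skeletonTime
  rw [lintegral_tsum fun k => (measurable_const.indicator (hX.measurableSet_alive k)).aemeasurable]
  exact tsum_congr fun k => by rw [lintegral_indicator_const (hX.measurableSet_alive k)]

lemma HasGenerator.measurable_skeletonTime : Measurable (skeletonTime X B h) :=
  Measurable.tsum fun k => measurable_const.indicator (hX.measurableSet_alive k)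

lemma HasGenerator.sum_alive_eq (k : ℕ) :
    ∑ l ∈ Finset.range k, (h : ℝ≥0∞) * P (alive X B h l)
      = ENNReal.ofReal (∑ l ∈ Finset.range k, h * P.real (alive X B h l)) := by
  rw [ENNReal.ofReal_sum_of_nonneg fun _ _ => by positivity]
  refine Finset.sum_congr rfl fun l _ => ?_
  rw [ENNReal.ofReal_mul h.coe_nonneg, ofReal_measureReal, ENNReal.ofReal_coe_nnreal]

lemma HasGenerator.lintegral_skeletonTime_le {f : S → ℝ} {κ : ℝ} (hκ : 0 < κ) (hx₀ : x₀ ∉ B)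
    (hf : ∀ x, 0 ≤ f x) (hdrift : ∀ x ∉ B, matAct (K h) f x ≤ f x - h * κ) :
    ∫⁻ ω, skeletonTime X B h ω ∂P ≤ ENNReal.ofReal (f x₀ / κ) := by
  rw [hX.lintegral_skeletonTime]
  refine ENNReal.tsum_le_of_sum_range_le fun k => ?_
  rw [hX.sum_alive_eq]
  refine ENNReal.ofReal_le_ofReal ?_
  rw [le_div_iff₀ hκ, Finset.sum_mul]
  refine le_trans (Finset.sum_le_sum fun l _ => le_of_eq ?_) (hX.sum_alive_le hx₀ hf hdrift k)
  ring

lemma HasGenerator.tendsto_measureReal_alive (hh : 0 < h)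
    (hfin : ∫⁻ ω, skeletonTime X B h ω ∂P ≠ ∞) :
    Tendsto (fun k => P.real (alive X B h k)) atTop (𝓝 0) := by
  rw [hX.lintegral_skeletonTime, ENNReal.tsum_mul_left] at hfin
  have h1 : ∑' k, P (alive X B h k) ≠ ∞ := fun H => hfin (by
    rw [H, ENNReal.mul_top]; simpa using hh.ne')
  have := ENNReal.tendsto_atTop_zero_of_tsum_ne_top h1
  exact (ENNReal.tendsto_toReal (a := 0) (by simp)).comp this

lemma HasGenerator.tendsto_setIntegral_alive (hh : 0 < h)
    (hfin : ∫⁻ ω, skeletonTime X B h ω ∂P ≠ ∞) (f : S → ℝ) :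
    Tendsto (fun k : ℕ => ∫ ω in alive X B h k, f (X (k * h) ω) ∂P) atTop (𝓝 0) := by
  have h1 := (hX.tendsto_measureReal_alive hh hfin).const_mul (∑ x, ‖f x‖)
  rw [mul_zero] at h1
  refine squeeze_zero_norm (fun k => ?_) h1
  exact norm_setIntegral_le_of_norm_le_const (measure_lt_top _ _) fun ω _ =>
    Finset.single_le_sum (f := fun x => ‖f x‖) (fun _ _ => norm_nonneg _) (Finset.mem_univ _)

/-- A finite mean forces the survival probabilities to `0`; since `f` is bounded on the finite state
space, the boundary integral disappears. -/
lemma HasGenerator.le_lintegral_skeletonTime {f : S → ℝ} {κ : ℝ} (hκ : 0 < κ) (hh : 0 < h)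
    (hx₀ : x₀ ∉ B)
    (hf : ∀ x ∈ B, f x = 0) (hdrift : ∀ x ∉ B, f x - h * κ ≤ matAct (K h) f x)
    (hfin : ∫⁻ ω, skeletonTime X B h ω ∂P ≠ ∞) :
    ENNReal.ofReal (f x₀ / κ) ≤ ∫⁻ ω, skeletonTime X B h ω ∂P := by
  have h0 := hX.tendsto_setIntegral_alive hh hfin f
  refine ENNReal.ofReal_le_of_le_toReal ?_
  rw [div_le_iff₀ hκ]
  have h1 : ∀ k : ℕ, f x₀ ≤ (∫⁻ ω, skeletonTime X B h ω ∂P).toReal * κ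
      + ∫ ω in alive X B h k, f (X (k * h) ω) ∂P := fun k => by
    refine (hX.le_sum_alive hx₀ hf hdrift k).trans (add_le_add_left ?_ _)
    have h2 : ∑ l ∈ Finset.range k, (h : ℝ) * P.real (alive X B h l)
        ≤ (∫⁻ ω, skeletonTime X B h ω ∂P).toReal := by
      rw [← ENNReal.ofReal_le_iff_le_toReal hfin, ← hX.sum_alive_eq, hX.lintegral_skeletonTime]
      exact ENNReal.sum_le_tsum _
    calc _ = (∑ l ∈ Finset.range k, (h : ℝ) * P.real (alive X B h l)) * κ := by
          rw [Finset.sum_mul]; exact Finset.sum_congr rfl fun _ _ => by ring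
      _ ≤ _ := by gcongr
  refine ge_of_tendsto' (f := fun k : ℕ => (∫⁻ ω, skeletonTime X B h ω ∂P).toReal * κ
      + ∫ ω in alive X B h k, f (X (k * h) ω) ∂P) (x := atTop) ?_ h1
  simpa using tendsto_const_nhds.add h0

end Skeleton

/-! ### From the skeletons to continuous time. -/

section Limit

set_option linter.unusedSectionVars false

/-- The first-order expansion at `0` has an error `o(h)` which is uniform in the state because there
are finitely many states. -/
lemma eventually_norm_sub_le_of_hasDerivAt {S E : Type*} [Finite S] [NormedAddCommGroup E]
    [NormedSpace ℝ E] {φ : S → ℝ → E} {φ' : S → E} (hφ : ∀ x, HasDerivAt (φ x) (φ' x) 0)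
    {ε : ℝ} (hε : 0 < ε) :
    ∀ᶠ m : ℕ in atTop, ∀ x, ‖φ x ((1 / 2) ^ m : ℝ≥0) - φ x 0 - ((1 / 2) ^ m : ℝ≥0) • φ' x‖
      ≤ ((1 / 2) ^ m : ℝ≥0) * ε := by
  rw [eventually_all]
  intro x
  have hpow : Tendsto (fun m : ℕ => (((1 / 2) ^ m : ℝ≥0) : ℝ)) atTop (𝓝 0) := by
    simpa using tendsto_pow_atTop_nhds_zero_of_lt_one (r := (1 / 2 : ℝ)) (by norm_num) (by norm_num)
  have h1 := hpow.eventually ((hasDerivAt_iff_isLittleO.1 (hφ x)).def hε)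
  filter_upwards [h1] with m hm
  rw [sub_zero] at hm
  rw [mul_comm]
  refine hm.trans_eq ?_
  rw [Real.norm_of_nonneg (NNReal.coe_nonneg _)]

variable {Ω S : Type*} [MeasurableSpace Ω] [Fintype S] [DecidableEq S] [MeasurableSpace S]
  [DiscreteMeasurableSpace S] {P : Measure Ω} [IsProbabilityMeasure P] {K : ℝ → S → S → ℝ}
  {L : S → S → ℝ} {x₀ : S} {X : ℝ≥0 → Ω → S} {B : Set S} {h : ℝ≥0}
  {E : Type*} [NormedAddCommGroup E] [NormedSpace ℝ E]
  (hX : HasGenerator P K L x₀ X)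

include hX

lemma HasGenerator.matAct_zero (g : S → E) (x : S) : matAct (K 0) g x = g x := by
  simp [matAct, hX.kernel_zero]

lemma HasGenerator.hasDerivAt_matAct (g : S → E) (x : S) :
    HasDerivAt (fun t => matAct (K t) g x) (matAct L g x) 0 :=
  HasDerivAt.fun_sum fun y _ => (hX.hasDerivAt_kernel x y).smul_const (g y)

lemma HasGenerator.eventually_matAct_sub_le (g : S → E) {ε : ℝ} (hε : 0 < ε) :
    ∀ᶠ m : ℕ in atTop, ∀ x,
      ‖matAct (K ((1 / 2) ^ m : ℝ≥0)) g x - g x - ((1 / 2) ^ m : ℝ≥0) • matAct L g x‖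
        ≤ ((1 / 2) ^ m : ℝ≥0) * ε := by
  simpa only [hX.matAct_zero] using
    eventually_norm_sub_le_of_hasDerivAt (fun x => hX.hasDerivAt_matAct g x) hε

lemma HasGenerator.aemeasurable_hitTime : AEMeasurable (hitTime X B) P := by
  classical
  refine ⟨fun ω => ⨅ q : ℚ, if 0 < q ∧ X (Real.toNNReal q) ω ∈ B
      then (Real.toNNReal q : ℝ≥0∞) else ∞, ?_, ?_⟩
  · refine Measurable.iInf fun q => Measurable.ite ?_ measurable_const measurable_const
    exact (MeasurableSet.const _).inter (hX.measurable _ MeasurableSet.of_discrete)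
  · filter_upwards [hX.right_continuous] with ω hω
    exact hitTime_eq_iInf_rat hω

lemma HasGenerator.hitTime_eq_zero (hx₀ : x₀ ∈ B) : ∀ᵐ ω ∂P, hitTime X B ω = 0 := by
  filter_upwards [hX.right_continuous, hX.ae_start] with ω hω h0
  refine le_antisymm (le_of_forall_gt fun b hb => ?_) zero_le
  obtain ⟨e, he, heb⟩ := ENNReal.lt_iff_exists_nnreal_btwn.1 hb
  obtain ⟨d, hd, hdX⟩ := mem_nhdsGT_iff_exists_Ioo_subset.1 (hω 0)
  have hd : 0 < d := hd
  have he : 0 < e := by exact_mod_cast he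
  obtain ⟨t, ht0, ht⟩ := exists_between (lt_min hd he)
  refine lt_of_le_of_lt (iInf₂_le (f := fun (t : ℝ≥0) (_ : 0 < t ∧ X t ω ∈ B) => (t : ℝ≥0∞))
    t ⟨ht0, ?_⟩) (lt_trans (b := (e : ℝ≥0∞)) (by exact_mod_cast ht.trans_le (min_le_right _ _)) heb)
  have : X t ω = X 0 ω := hdX ⟨ht0, ht.trans_le (min_le_left _ _)⟩
  rwa [this, h0]

/-- Replacing the drift `-1` by `-κ` with `κ < 1` leaves room for the `o(h)` error of the transition
matrix. -/
lemma HasGenerator.eventually_lintegral_skeletonTime_le {f : S → ℝ} (hx₀ : x₀ ∉ B)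
    (hf : ∀ x, 0 ≤ f x) (hL : ∀ x ∉ B, matAct L f x ≤ -1) {κ : ℝ} (hκ : 0 < κ) (hκ1 : κ < 1) :
    ∀ᶠ m : ℕ in atTop,
      (∀ x ∉ B, matAct (K ((1 / 2) ^ m : ℝ≥0)) f x ≤ f x - ((1 / 2) ^ m : ℝ≥0) * κ) ∧
      ∫⁻ ω, skeletonTime X B ((1 / 2) ^ m) ω ∂P ≤ ENNReal.ofReal (f x₀ / κ) := by
  filter_upwards [hX.eventually_matAct_sub_le f (sub_pos.2 hκ1)] with m hm
  have h1 : ∀ x ∉ B, matAct (K ((1 / 2) ^ m : ℝ≥0)) f x ≤ f x - ((1 / 2) ^ m : ℝ≥0) * κ := by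
    intro x hx
    have h2 := (le_abs_self _).trans (hm x)
    have h3 := mul_le_mul_of_nonneg_left (hL x hx) (NNReal.coe_nonneg ((1 / 2) ^ m : ℝ≥0))
    rw [NNReal.smul_def, smul_eq_mul] at h2
    linarith
  exact ⟨h1, hX.lintegral_skeletonTime_le hκ hx₀ hf h1⟩

/-- A nonnegative function with drift at most `-1` off `B` bounds the mean hitting time of `B`. -/
theorem HasGenerator.lintegral_hitTime_le {f : S → ℝ} (hx₀ : x₀ ∉ B) (hf : ∀ x, 0 ≤ f x)
    (hL : ∀ x ∉ B, matAct L f x ≤ -1) :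
    ∫⁻ ω, hitTime X B ω ∂P ≤ ENNReal.ofReal (f x₀) := by
  have h1 : ∀ κ : ℝ, 0 < κ → κ < 1 → ∫⁻ ω, hitTime X B ω ∂P ≤ ENNReal.ofReal (f x₀ / κ) := by
    intro κ hκ hκ1
    obtain ⟨m, -, hm⟩ := (hX.eventually_lintegral_skeletonTime_le hx₀ hf hL hκ hκ1).exists
    refine le_trans (lintegral_mono_ae ?_) hm
    filter_upwards [hX.ae_start] with ω hω
    exact hitTime_le_skeletonTime (by positivity) (by rwa [hω])
  have h2 : Tendsto (fun κ : ℝ => ENNReal.ofReal (f x₀ / κ)) (𝓝[<] 1)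
      (𝓝 (ENNReal.ofReal (f x₀ / 1))) := by
    refine ENNReal.tendsto_ofReal (Tendsto.div tendsto_const_nhds ?_ one_ne_zero)
    exact tendsto_nhdsWithin_of_tendsto_nhds tendsto_id
  rw [div_one] at h2
  refine ge_of_tendsto h2 ?_
  filter_upwards [Ioo_mem_nhdsLT (show (0 : ℝ) < 1 by norm_num)] with κ hκ
  exact h1 κ hκ.1 hκ.2

lemma HasGenerator.ae_tendsto_skeletonTime (hx₀ : x₀ ∉ B) : ∀ᵐ ω ∂P,
    Tendsto (fun m : ℕ => skeletonTime X B ((1 / 2) ^ m) ω) atTop (𝓝 (hitTime X B ω)) := by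
  filter_upwards [hX.right_continuous, hX.ae_start] with ω hω h0
  exact tendsto_skeletonTime (by rwa [h0]) hω

lemma HasGenerator.tendsto_lintegral_skeletonTime (hx₀ : x₀ ∉ B) {M : ℕ}
    (hM : ∫⁻ ω, skeletonTime X B ((1 / 2) ^ M) ω ∂P ≠ ∞) :
    Tendsto (fun m : ℕ => ∫⁻ ω, skeletonTime X B ((1 / 2) ^ m) ω ∂P) atTop
      (𝓝 (∫⁻ ω, hitTime X B ω ∂P)) := by
  rw [← tendsto_add_atTop_iff_nat M]
  refine tendsto_lintegral_of_dominated_convergence (skeletonTime X B ((1 / 2) ^ M))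
    (fun _ => hX.measurable_skeletonTime) (fun m => Eventually.of_forall fun ω => ?_) hM ?_
  · exact antitone_nat_of_succ_le (f := fun m => skeletonTime X B ((1 / 2) ^ m) ω)
      (fun m => skeletonTime_anti m) (Nat.le_add_left M m)
  · filter_upwards [hX.ae_tendsto_skeletonTime hx₀] with ω hω
    exact hω.comp (tendsto_add_atTop_nat M)

/-- A function vanishing on `B` with drift at least `-1` off `B` bounds the mean hitting time
of `B` from below. -/
theorem HasGenerator.le_lintegral_hitTime {f g : S → ℝ} (hx₀ : x₀ ∉ B) (hf : ∀ x ∈ B, f x = 0)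
    (hL : ∀ x ∉ B, -1 ≤ matAct L f x) (hg : ∀ x, 0 ≤ g x) (hLg : ∀ x ∉ B, matAct L g x ≤ -1) :
    ENNReal.ofReal (f x₀) ≤ ∫⁻ ω, hitTime X B ω ∂P := by
  -- The auxiliary `g` only serves to make the skeleton means finite from some mesh on, as the lower
  -- bound and dominated convergence require.
  obtain ⟨M, hM⟩ := eventually_atTop.1 (hX.eventually_lintegral_skeletonTime_le hx₀ hg hLg
    (κ := 1 / 2) (by norm_num) (by norm_num))
  have hfin : ∀ m ≥ M, ∫⁻ ω, skeletonTime X B ((1 / 2) ^ m) ω ∂P ≠ ∞ := fun m hm =>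
    ((hM m hm).2.trans_lt ENNReal.ofReal_lt_top).ne
  have h1 : ∀ κ : ℝ, 1 < κ → ENNReal.ofReal (f x₀ / κ) ≤ ∫⁻ ω, hitTime X B ω ∂P := by
    intro κ hκ
    refine ge_of_tendsto (hX.tendsto_lintegral_skeletonTime hx₀ (hfin M le_rfl)) ?_
    filter_upwards [hX.eventually_matAct_sub_le f (sub_pos.2 hκ), eventually_ge_atTop M] with m hm hMm
    refine hX.le_lintegral_skeletonTime (by linarith) (by positivity) hx₀ hf (fun x hx => ?_)
      (hfin m hMm)
    have h2 := (neg_abs_le _).trans' (neg_le_neg (hm x))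
    have h3 := mul_le_mul_of_nonneg_left (hL x hx) (NNReal.coe_nonneg ((1 / 2) ^ m : ℝ≥0))
    rw [NNReal.smul_def, smul_eq_mul] at h2
    linarith
  have h2 : Tendsto (fun κ : ℝ => ENNReal.ofReal (f x₀ / κ)) (𝓝[>] 1)
      (𝓝 (ENNReal.ofReal (f x₀ / 1))) := by
    refine ENNReal.tendsto_ofReal (Tendsto.div tendsto_const_nhds ?_ one_ne_zero)
    exact tendsto_nhdsWithin_of_tendsto_nhds tendsto_id
  rw [div_one] at h2
  refine le_of_tendsto h2 ?_
  filter_upwards [self_mem_nhdsWithin] with κ hκ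
  exact h1 κ hκ

end Limit

/-! ### Laplace transforms of hitting times. -/

section Laplace

set_option linter.unusedSectionVars false

variable {Ω S : Type*} [MeasurableSpace Ω] [Fintype S] [DecidableEq S] [MeasurableSpace S]
  [DiscreteMeasurableSpace S] {P : Measure Ω} [IsProbabilityMeasure P] {K : ℝ → S → S → ℝ}
  {L : S → S → ℝ} {x₀ : S} {X : ℝ≥0 → Ω → S} {B : Set S} {h : ℝ≥0}

lemma norm_cexp_neg_mul_le_one {s : ℂ} (hs : 0 ≤ s.re) {t : ℝ} (ht : 0 ≤ t) :
    ‖Complex.exp (-s * t)‖ ≤ 1 := by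
  rw [Complex.norm_exp, Real.exp_le_one_iff]
  simp only [Complex.mul_re, Complex.neg_re, Complex.ofReal_re, Complex.ofReal_im, mul_zero,
    sub_zero]
  nlinarith

lemma integrable_cexp_neg_mul {s : ℂ} (hs : 0 ≤ s.re) {T : Ω → ℝ≥0∞} (hT : AEMeasurable T P) :
    Integrable (fun ω => Complex.exp (-s * (T ω).toReal)) P := by
  refine Integrable.of_bound (C := 1) ?_
    (Eventually.of_forall fun ω => norm_cexp_neg_mul_le_one hs ENNReal.toReal_nonneg)
  have : AEMeasurable (fun ω => ((T ω).toReal : ℂ)) P :=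
    Complex.measurable_ofReal.comp_aemeasurable hT.ennreal_toReal
  exact (Complex.measurable_exp.comp_aemeasurable (this.const_mul (-s))).aestronglyMeasurable

variable (hX : HasGenerator P K L x₀ X)

include hX

/-- The Laplace transform of the first visit to `B` of the skeleton, with the part of the path
that has not visited `B` in `k` steps replaced by its value under `u`. -/
lemma HasGenerator.stopped_laplace_succ {u : S → ℂ} {s : ℂ} (hs : 0 ≤ s.re)
    (hu : ∀ x ∈ B, u x = 1) (k : ℕ) :
    (∫ ω in alive X B h (k + 1), Complex.exp (-s * h) ^ (k + 1) * u (X ((k + 1 : ℕ) * h) ω) ∂P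
        + ∫ ω in (alive X B h (k + 1))ᶜ, Complex.exp (-s * (skeletonTime X B h ω).toReal) ∂P)
      - (∫ ω in alive X B h k, Complex.exp (-s * h) ^ k * u (X (k * h) ω) ∂P
        + ∫ ω in (alive X B h k)ᶜ, Complex.exp (-s * (skeletonTime X B h ω).toReal) ∂P)
      = Complex.exp (-s * h) ^ k * ∫ ω in alive X B h k,
        (Complex.exp (-s * h) * matAct (K h) u (X (k * h) ω) - u (X (k * h) ω)) ∂P := by
  have hint := integrable_cexp_neg_mul (P := P) hs (hX.measurable_skeletonTime (B := B) (h := h)).aemeasurable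
  have hsub : alive X B h (k + 1) ⊆ alive X B h k := alive_anti k.le_succ
  have hA := hX.measurableSet_alive (B := B) (h := h)
  have hcompl : (alive X B h (k + 1))ᶜ
      = (alive X B h k)ᶜ ∪ (alive X B h k \ alive X B h (k + 1)) := by
    ext ω
    have := @hsub ω
    simp only [Set.mem_compl_iff, Set.mem_union, Set.mem_sdiff]
    tauto
  have hY : ∀ l m : ℕ, Integrable
      (fun ω => Complex.exp (-s * h) ^ l * u (X (m * h) ω)) P :=
    fun l m => (hX.integrable_comp _ u).const_mul _
  -- Paths leaving the surviving event at step `k + 1` have skeleton time exactly `(k + 1) h`, and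
  -- `u` equals `1` there, so both descriptions of their contribution agree.
  have h1 : ∫ ω in alive X B h k \ alive X B h (k + 1),
        Complex.exp (-s * (skeletonTime X B h ω).toReal) ∂P
      = ∫ ω in alive X B h k \ alive X B h (k + 1),
        Complex.exp (-s * h) ^ (k + 1) * u (X ((k + 1 : ℕ) * h) ω) ∂P := by
    refine setIntegral_congr_fun ((hA k).diff (hA (k + 1))) fun ω hω => ?_
    have hB : X ((k + 1 : ℕ) * h) ω ∈ B := by
      by_contra hB
      refine hω.2 fun l hl => ?_
      rcases Nat.le_succ_iff.1 hl with h' | h'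
      · exact hω.1 l h'
      · rwa [h']
    have hσ := skeletonTime_eq hB fun l hl => hω.1 l (Nat.le_of_lt_succ hl)
    simp only [hσ, hu _ hB, mul_one, ← Complex.exp_nat_mul]
    congr 1
    rw [ENNReal.toReal_mul, ENNReal.toReal_natCast, ENNReal.coe_toReal]
    push_cast
    ring
  have h2 := hX.setIntegral_alive_step (B := B) (h := h) k u
  have h3 := integral_inter_add_sdiff (s := alive X B h k) (hA (k + 1)) (hY (k + 1) (k + 1)).integrableOn
  rw [Set.inter_eq_right.2 hsub] at h3
  have h6 : ∫ ω in alive X B h k, Complex.exp (-s * h) * matAct (K h) u (X (k * h) ω) ∂P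
      = Complex.exp (-s * h) * ∫ ω in alive X B h k, matAct (K h) u (X (k * h) ω) ∂P :=
    integral_const_mul _ _
  rw [hcompl, setIntegral_union (by
      rw [Set.disjoint_left]
      exact fun ω h1 h2 => h1 h2.1) ((hA k).diff (hA (k + 1))) hint.integrableOn hint.integrableOn, h1,
    integral_sub ((hX.integrable_comp _ (matAct (K h) u)).const_mul _).integrableOn
      (hX.integrable_comp _ u).integrableOn, h6, ← h2]
  have h4 : ∫ ω in alive X B h k, Complex.exp (-s * h) ^ (k + 1) * u (X ((k + 1 : ℕ) * h) ω) ∂P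
      = Complex.exp (-s * h) ^ (k + 1) * ∫ ω in alive X B h k, u (X ((k + 1 : ℕ) * h) ω) ∂P :=
    integral_const_mul _ _
  have h5 : ∫ ω in alive X B h k, Complex.exp (-s * h) ^ k * u (X (k * h) ω) ∂P
      = Complex.exp (-s * h) ^ k * ∫ ω in alive X B h k, u (X (k * h) ω) ∂P :=
    integral_const_mul _ _
  have h7 : ∫ ω in alive X B h (k + 1), Complex.exp (-s * h) ^ (k + 1) * u (X ((k + 1 : ℕ) * h) ω) ∂P
      = Complex.exp (-s * h) ^ (k + 1) * ∫ ω in alive X B h (k + 1), u (X ((k + 1 : ℕ) * h) ω) ∂P :=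
    integral_const_mul _ _
  rw [h5, h7]
  rw [h4, h7] at h3
  rw [pow_succ] at h3 ⊢
  linear_combination h3

/-- The stopped transform moves from `u x₀` at step `0` to the Laplace transform as the number of
steps grows. Each step changes it by at most the residual `h (ψ + ε)` on the surviving paths. The
decrease of `w` pays for `ψ`; the two errors `ε` accumulate over a mean time at most `f x₀ / κ`. -/
lemma HasGenerator.norm_laplace_skeletonTime_sub_le {u : S → ℂ} {w f ψ : S → ℝ} {s : ℂ} {ε κ : ℝ}
    (hx₀ : x₀ ∉ B) (hh : 0 < h) (hs : 0 ≤ s.re) (hu : ∀ x ∈ B, u x = 1) (hw : ∀ x, 0 ≤ w x)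
    (hε : 0 ≤ ε) (hκ : 0 < κ) (hf : ∀ x, 0 ≤ f x)
    (hKu : ∀ x ∉ B, ‖Complex.exp (-s * h) * matAct (K h) u x - u x‖ ≤ h * (ψ x + ε))
    (hKw : ∀ x ∉ B, matAct (K h) w x ≤ w x - h * (ψ x - ε))
    (hKf : ∀ x ∉ B, matAct (K h) f x ≤ f x - h * κ) :
    ‖∫ ω, Complex.exp (-s * (skeletonTime X B h ω).toReal) ∂P - u x₀‖
      ≤ w x₀ + 2 * ε * (f x₀ / κ) := by
  have hA := hX.measurableSet_alive (B := B) (h := h)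
  have hint := integrable_cexp_neg_mul (P := P) hs (hX.measurable_skeletonTime (B := B) (h := h)).aemeasurable
  have hfin : ∫⁻ ω, skeletonTime X B h ω ∂P ≠ ∞ :=
    ((hX.lintegral_skeletonTime_le hκ hx₀ hf hKf).trans_lt ENNReal.ofReal_lt_top).ne
  set ρ := Complex.exp (-s * h) with hρ
  have hρ1 : ‖ρ‖ ≤ 1 := norm_cexp_neg_mul_le_one hs h.coe_nonneg
  set d : ℕ → ℂ := fun k => ∫ ω in alive X B h k, ρ ^ k * u (X (k * h) ω) ∂P
        + ∫ ω in (alive X B h k)ᶜ, Complex.exp (-s * (skeletonTime X B h ω).toReal) ∂P with hd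
  have hd0 : d 0 = u x₀ := by
    have h1 := hX.setIntegral_alive_zero (h := h) hx₀ u
    have h2 : P (alive X B h 0)ᶜ = 0 := by
      refine measure_mono_null ?_ (ae_iff.1 hX.ae_start)
      intro ω hω h0
      refine hω fun l hl => ?_
      obtain rfl : l = 0 := by omega
      simpa [h0] using hx₀
    simp only [hd, pow_zero, one_mul, h1, setIntegral_measure_zero _ h2, add_zero]
  have hdsucc : ∀ k, ‖d (k + 1) - d k‖ ≤ ∫ ω in alive X B h k, h * ψ (X (k * h) ω) ∂P
      + h * ε * P.real (alive X B h k) := by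
    intro k
    have h1 := hX.stopped_laplace_succ (h := h) hs hu k
    rw [show d (k + 1) - d k = _ from h1, norm_mul, norm_pow]
    calc _ ≤ 1 * ‖∫ ω in alive X B h k, (ρ * matAct (K h) u (X (k * h) ω) - u (X (k * h) ω)) ∂P‖ :=
          mul_le_mul_of_nonneg_right (pow_le_one₀ (norm_nonneg _) hρ1) (norm_nonneg _)
      _ ≤ ∫ ω in alive X B h k, h * (ψ (X (k * h) ω) + ε) ∂P := by
          rw [one_mul]
          refine norm_integral_le_of_norm_le
            (hX.integrable_comp _ (fun x => h * (ψ x + ε))).integrableOn ?_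
          refine (ae_restrict_iff' (hA k)).2 (Eventually.of_forall fun ω hω => ?_)
          exact hKu _ (hω k le_rfl)
      _ = _ := by
          simp only [mul_add]
          rw [integral_add (hX.integrable_comp _ (fun x => h * ψ x)).integrableOn
            (integrable_const _), setIntegral_const, smul_eq_mul]
          ring
  have hbsucc : ∀ k : ℕ, ∫ ω in alive X B h k, h * ψ (X (k * h) ω) ∂P ≤
      ∫ ω in alive X B h k, w (X (k * h) ω) ∂P
      - ∫ ω in alive X B h (k + 1), w (X ((k + 1 : ℕ) * h) ω) ∂P
      + h * ε * P.real (alive X B h k) := by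
    intro k
    have h1 := hX.setIntegral_alive_succ_le hw hKw k
    have h2 : ∫ ω in alive X B h k, h * (ψ (X (k * h) ω) - ε) ∂P
        = ∫ ω in alive X B h k, h * ψ (X (k * h) ω) ∂P - h * ε * P.real (alive X B h k) := by
      simp only [mul_sub]
      rw [integral_sub (hX.integrable_comp _ (fun x => h * ψ x)).integrableOn
            (integrable_const _), setIntegral_const, smul_eq_mul]
      ring
    linarith
  have hdist : ∀ k, ‖d k - u x₀‖ ≤ w x₀ - ∫ ω in alive X B h k, w (X (k * h) ω) ∂P
      + 2 * ε * ∑ l ∈ Finset.range k, h * P.real (alive X B h l) := by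
    intro k
    induction k with
    | zero => rw [hX.setIntegral_alive_zero hx₀, hd0]; simp
    | succ k ih =>
      rw [Finset.sum_range_succ]
      have h1 : ‖d (k + 1) - u x₀‖ ≤ ‖d (k + 1) - d k‖ + ‖d k - u x₀‖ := by
        simpa using norm_add_le (d (k + 1) - d k) (d k - u x₀)
      have h2 := hdsucc k
      have h3 := hbsucc k
      linarith
  have hbound : ∀ k, ‖d k - u x₀‖ ≤ w x₀ + 2 * ε * (f x₀ / κ) := by
    intro k
    refine (hdist k).trans ?_
    have h1 : 0 ≤ ∫ ω in alive X B h k, w (X (k * h) ω) ∂P := integral_nonneg fun ω => hw _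
    have h2 : ∑ l ∈ Finset.range k, h * P.real (alive X B h l) ≤ f x₀ / κ := by
      rw [le_div_iff₀ hκ, Finset.sum_mul]
      refine le_trans (Finset.sum_le_sum fun l _ => le_of_eq ?_) (hX.sum_alive_le hx₀ hf hKf k)
      ring
    have h3 := mul_le_mul_of_nonneg_left h2 (by positivity : 0 ≤ 2 * ε)
    linarith
  have hlim : Tendsto d atTop
      (𝓝 (∫ ω, Complex.exp (-s * (skeletonTime X B h ω).toReal) ∂P)) := by
    rw [tendsto_iff_norm_sub_tendsto_zero]
    have h1 := (hX.tendsto_measureReal_alive hh hfin).const_mul (∑ x, ‖u x‖ + 1)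
    rw [mul_zero] at h1
    refine squeeze_zero (fun _ => norm_nonneg _) (fun k => ?_) h1
    have h2 : d k - ∫ ω, Complex.exp (-s * (skeletonTime X B h ω).toReal) ∂P
        = ∫ ω in alive X B h k, (ρ ^ k * u (X (k * h) ω)
          - Complex.exp (-s * (skeletonTime X B h ω).toReal)) ∂P := by
      rw [integral_sub ((hX.integrable_comp _ u).const_mul _).integrableOn hint.integrableOn,
        ← integral_add_compl (hA k) hint]
      simp only [hd]
      ring
    rw [h2]
    refine norm_setIntegral_le_of_norm_le_const (measure_lt_top _ _) fun ω _ => ?_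
    refine (norm_sub_le _ _).trans (add_le_add ?_ (norm_cexp_neg_mul_le_one hs ENNReal.toReal_nonneg))
    rw [norm_mul, norm_pow]
    calc _ ≤ 1 * ‖u (X (k * h) ω)‖ :=
          mul_le_mul_of_nonneg_right (pow_le_one₀ (norm_nonneg _) hρ1) (norm_nonneg _)
      _ ≤ _ := by
          rw [one_mul]
          exact Finset.single_le_sum (f := fun x => ‖u x‖) (fun _ _ => norm_nonneg _)
            (Finset.mem_univ _)
  exact le_of_tendsto ((hlim.sub_const _).norm) (Eventually.of_forall hbound)

/-- Approximation of the Laplace transform of the hitting time of `B` by the value at the starting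
point of an approximate solution of the corresponding boundary value problem. -/
theorem HasGenerator.norm_laplace_hitTime_sub_le {u : S → ℂ} {w f : S → ℝ} {s : ℂ}
    (hx₀ : x₀ ∉ B) (hs : 0 ≤ s.re) (hu : ∀ x ∈ B, u x = 1) (hw : ∀ x, 0 ≤ w x)
    (hf : ∀ x, 0 ≤ f x) (hLf : ∀ x ∉ B, matAct L f x ≤ -1)
    (hLu : ∀ x ∉ B, ‖s * u x - matAct L u x‖ ≤ -matAct L w x) :
    ‖∫ ω, Complex.exp (-s * (hitTime X B ω).toReal) ∂P - u x₀‖ ≤ w x₀ := by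
  have hfin : ∀ᵐ ω ∂P, hitTime X B ω ≠ ∞ := by
    refine (ae_lt_top' hX.aemeasurable_hitTime ?_).mono fun ω h => h.ne
    exact ((hX.lintegral_hitTime_le hx₀ hf hLf).trans_lt ENNReal.ofReal_lt_top).ne
  have hlim : Tendsto (fun m : ℕ =>
      ∫ ω, Complex.exp (-s * (skeletonTime X B ((1 / 2) ^ m) ω).toReal) ∂P) atTop
      (𝓝 (∫ ω, Complex.exp (-s * (hitTime X B ω).toReal) ∂P)) := by
    refine tendsto_integral_of_dominated_convergence (fun _ => 1) (fun m => ?_)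
      (integrable_const _) (fun m => Eventually.of_forall fun ω =>
        norm_cexp_neg_mul_le_one hs ENNReal.toReal_nonneg) ?_
    · exact (integrable_cexp_neg_mul hs hX.measurable_skeletonTime.aemeasurable).aestronglyMeasurable
    · filter_upwards [hX.ae_tendsto_skeletonTime hx₀, hfin] with ω h1 h2
      have h3 := (ENNReal.tendsto_toReal h2).comp h1
      have h4 : Continuous fun t : ℝ => Complex.exp (-s * t) := by fun_prop
      exact (h4.tendsto _).comp h3
  have key : ∀ ε : ℝ, 0 < ε →
      ‖∫ ω, Complex.exp (-s * (hitTime X B ω).toReal) ∂P - u x₀‖ ≤ w x₀ + 2 * ε * (f x₀ / (1 / 2)) := by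
    intro ε hε
    refine le_of_tendsto ((hlim.sub_const _).norm) ?_
    have hder : ∀ x, HasDerivAt (fun t : ℝ => Complex.exp (-s * t) * matAct (K t) u x)
        (matAct L u x - s * u x) 0 := by
      intro x
      have h1 : HasDerivAt (fun t : ℝ => Complex.exp (-s * t)) (-s) 0 := by
        have : HasDerivAt (fun t : ℝ => -s * (t : ℂ)) (-s) 0 := by
          simpa using (Complex.ofRealCLM.hasDerivAt (x := (0 : ℝ))).const_mul (-s)
        simpa using this.cexp
      have h2 := h1.mul (hX.hasDerivAt_matAct u x)
      refine h2.congr_deriv ?_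
      rw [hX.matAct_zero]
      simp
      ring
    filter_upwards [hX.eventually_lintegral_skeletonTime_le hx₀ hf hLf (κ := 1 / 2) (by norm_num)
      (by norm_num), hX.eventually_matAct_sub_le w hε,
      eventually_norm_sub_le_of_hasDerivAt hder hε] with m h1 h2 h3
    -- With `ψ` the exact residual of `u`, the hypothesis on `w` is precisely the drift that is
    -- needed, and `ε` absorbs the discretization.
    refine hX.norm_laplace_skeletonTime_sub_le (ψ := fun x => ‖s * u x - matAct L u x‖) hx₀
      (by positivity) hs hu hw hε.le (by norm_num) hf (fun x _ => ?_) (fun x hx => ?_) h1.1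
    · have h4 := h3 x
      simp only [hX.matAct_zero, Complex.ofReal_zero, mul_zero, Complex.exp_zero, one_mul] at h4
      have h5 : ‖((1 / 2) ^ m : ℝ≥0) • (matAct L u x - s * u x)‖
          = ((1 / 2) ^ m : ℝ≥0) * ‖s * u x - matAct L u x‖ := by
        rw [NNReal.smul_def, norm_smul, Real.norm_of_nonneg (NNReal.coe_nonneg _), norm_sub_rev]
      have h6 := norm_le_norm_add_norm_sub' (Complex.exp (-s * ((1 / 2) ^ m : ℝ≥0))
        * matAct (K ((1 / 2) ^ m : ℝ≥0)) u x - u x) (((1 / 2) ^ m : ℝ≥0) • (matAct L u x - s * u x))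
      rw [h5] at h6
      rw [mul_add]
      exact h6.trans (add_le_add_right h4 _)
    · have h4 := (le_abs_self _).trans (h2 x)
      have h5 := mul_le_mul_of_nonneg_left (hLu x hx) (NNReal.coe_nonneg ((1 / 2) ^ m : ℝ≥0))
      rw [NNReal.smul_def, smul_eq_mul] at h4
      linarith
  refine le_of_forall_pos_le_add fun δ hδ => ?_
  have hf0 := hf x₀
  refine (key (δ / (4 * (f x₀ + 1))) (by positivity)).trans ?_
  have : 2 * (δ / (4 * (f x₀ + 1))) * (f x₀ / (1 / 2)) = δ * (f x₀ / (f x₀ + 1)) := by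
    field_simp; ring
  rw [this]
  have : f x₀ / (f x₀ + 1) ≤ 1 := by rw [div_le_one (by linarith)]; linarith
  nlinarith

end Laplace

set_option linter.unusedSectionVars false

/-! ### Independent on-off chains and the chain counting the `true` ones. -/

section ProductChain

variable {I : Type*} [Fintype I] [DecidableEq I]

/-- Transition matrices of a family of independent two-state chains with generator `Q`. -/
noncomputable def prodKernel (Q : Matrix Bool Bool ℝ) (h : ℝ) (x y : I → Bool) : ℝ :=
  ∏ e, NormedSpace.exp (h • Q) (x e) (y e)

/-- Generator of a family of independent two-state chains with generator `Q`. -/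
def prodGen (Q : Matrix Bool Bool ℝ) (x y : I → Bool) : ℝ :=
  ∑ e, (∏ e' ∈ Finset.univ.erase e, if x e' = y e' then 1 else 0) * Q (x e) (y e)

/-- The number of chains in state `true`. -/
def countTrue (x : I → Bool) : ℕ := (Finset.univ.filter fun e => x e = true).card

/-- Generator of the birth-death chain counting the chains in state `true` among `N` independent
ones with birth rate `lam` and death rate `mu`. -/
def countGen {E : Type*} [AddCommGroup E] [Module ℝ E] (N : ℕ) (lam mu : ℝ) (F : ℕ → E)
    (k : ℕ) : E :=
  ((N - k : ℝ) * lam) • (F (k + 1) - F k) + (k * mu) • (F (k - 1) - F k)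

lemma prodKernel_zero (Q : Matrix Bool Bool ℝ) (x y : I → Bool) :
    prodKernel Q 0 x y = if x = y then 1 else 0 := by
  simp only [prodKernel, zero_smul, NormedSpace.exp_zero, Matrix.one_apply]
  split_ifs with hxy
  · simp [hxy]
  · obtain ⟨e, he⟩ := Function.ne_iff.1 hxy
    exact Finset.prod_eq_zero (Finset.mem_univ e) (if_neg he)

section

attribute [local instance] Matrix.linftyOpNormedRing Matrix.linftyOpNormedAlgebra

lemma hasDerivAt_exp_smul_apply (Q : Matrix Bool Bool ℝ) (a b : Bool) :
    HasDerivAt (fun h : ℝ => NormedSpace.exp (h • Q) a b) (Q a b) 0 := by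
  have h1 := hasDerivAt_exp_smul_const (𝕂 := ℝ) Q 0
  rw [zero_smul, NormedSpace.exp_zero, one_mul] at h1
  have h2 := (Matrix.entryLinearMap ℝ ℝ a b).toContinuousLinearMap.hasFDerivAt.comp_hasDerivAt
    (0 : ℝ) h1
  exact h2

end

lemma hasDerivAt_prodKernel (Q : Matrix Bool Bool ℝ) (x y : I → Bool) :
    HasDerivAt (fun h => prodKernel Q h x y) (prodGen Q x y) 0 := by
  have := HasDerivAt.fun_finsetProd (u := Finset.univ) (x := (0 : ℝ))
    (f := fun (e : I) (h : ℝ) => NormedSpace.exp (h • Q) (x e) (y e)) (f' := fun e => Q (x e) (y e))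
    (fun e _ => hasDerivAt_exp_smul_apply Q (x e) (y e))
  simp only [zero_smul, NormedSpace.exp_zero, Matrix.one_apply, smul_eq_mul] at this
  exact this

/-- The indicators in `prodGen` kill every `y` which differs from `x` at a coordinate other than
`e`, so only the updates of `x` at one coordinate remain. -/
lemma matAct_prodGen {E : Type*} [AddCommGroup E] [Module ℝ E] (Q : Matrix Bool Bool ℝ)
    (g : (I → Bool) → E) (x : I → Bool) :
    matAct (prodGen Q) g x = ∑ e, ∑ b, Q (x e) b • g (Function.update x e b) := by
  simp only [matAct, prodGen, Finset.sum_smul]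
  rw [Finset.sum_comm]
  refine Finset.sum_congr rfl fun e _ => ?_
  symm
  refine Fintype.sum_of_injective (fun b => Function.update x e b)
    (Function.update_injective x e) _ _ ?_ ?_
  · intro y hy
    have : ∃ e' ≠ e, x e' ≠ y e' := by
      by_contra! H
      refine hy ⟨y e, ?_⟩
      ext e'
      by_cases he : e' = e
      · subst he; simp
      · simp [he, H e' he]
    obtain ⟨e', he', hne⟩ := this
    rw [Finset.prod_eq_zero (i := e') (by simp [he']) (if_neg hne), zero_mul, zero_smul]
  · intro b
    rw [Finset.prod_eq_one, one_mul, Function.update_self]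
    intro e' he'
    rw [Function.update_of_ne (Finset.ne_of_mem_erase he'), if_pos rfl]

lemma countTrue_update_true {x : I → Bool} {e : I} (he : x e = false) :
    countTrue (Function.update x e true) = countTrue x + 1 := by
  unfold countTrue
  rw [← Finset.card_insert_of_notMem (a := e) (by simp [he])]
  congr 1
  ext e'
  by_cases h : e' = e
  · subst h; simp
  · simp [h]

lemma countTrue_update_false {x : I → Bool} {e : I} (he : x e = true) :
    countTrue (Function.update x e false) = countTrue x - 1 := by
  unfold countTrue
  rw [← Finset.card_erase_of_mem (a := e) (by simp [he])]
  congr 1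
  ext e'
  by_cases h : e' = e
  · subst h; simp
  · simp [h]

lemma countTrue_le (x : I → Bool) : countTrue x ≤ Fintype.card I :=
  (Finset.card_filter_le _ _).trans_eq Finset.card_univ

/-- The number of present edges is itself a birth-death chain. -/
lemma matAct_prodGen_countTrue {E : Type*} [AddCommGroup E] [Module ℝ E] (lam mu : ℝ) (F : ℕ → E)
    (x : I → Bool) :
    matAct (prodGen (onOffGenerator lam mu)) (fun y => F (countTrue y)) x
      = countGen (Fintype.card I) lam mu F (countTrue x) := by
  rw [matAct_prodGen]
  have h1 : ∀ e, ∑ b, onOffGenerator lam mu (x e) b • F (countTrue (Function.update x e b))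
      = if x e = true then mu • (F (countTrue x - 1) - F (countTrue x))
        else lam • (F (countTrue x + 1) - F (countTrue x)) := by
    intro e
    rw [Fintype.sum_bool]
    rcases hx : x e with _ | _
    · have : Function.update x e false = x := by rw [← hx, Function.update_eq_self]
      simp [onOffGenerator, countTrue_update_true hx, this, sub_eq_add_neg]
    · have : Function.update x e true = x := by rw [← hx, Function.update_eq_self]
      simp [onOffGenerator, countTrue_update_false hx, this, sub_eq_add_neg, add_comm]
  simp only [h1]
  rw [Finset.sum_ite, Finset.sum_const, Finset.sum_const]
  have h2 : ((Finset.univ.filter fun e => ¬ x e = true).card : ℝ)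
      = Fintype.card I - countTrue x := by
    rw [eq_sub_iff_add_eq', ← Finset.card_univ, countTrue]
    exact_mod_cast Finset.card_filter_add_card_filter_not (s := Finset.univ) (fun e => x e = true)
  rw [← Nat.cast_smul_eq_nsmul ℝ, ← Nat.cast_smul_eq_nsmul ℝ, h2, smul_smul, smul_smul, countGen,
    add_comm]
  rfl

end ProductChain

/-! ### The dynamic graph as a product chain. -/

section ERGraph

/-- The edge configuration of a graph-valued process. -/
noncomputable def edgeConfig {n : ℕ} {Ω : Type*} (G : ℝ≥0 → Ω → SimpleGraph (Fin n)) (t : ℝ≥0) (ω : Ω) :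
    VertexPair n → Bool :=
  fun e => edgeIndicator (G t ω) e

lemma countTrue_edgeIndicator {n : ℕ} (H : SimpleGraph (Fin n)) :
    countTrue (fun e : VertexPair n => edgeIndicator H e) = numEdges H := by
  classical
  unfold countTrue numEdges edgeIndicator
  rw [← Set.ncard_coe_finset]
  refine (Set.ncard_congr (fun e _ => (e : Sym2 (Fin n))) ?_ ?_ ?_)
  · intro e he; simpa using he
  · intro a b _ _ hab; exact Subtype.ext hab
  · intro e he
    exact ⟨⟨e, SimpleGraph.not_isDiag_of_mem_edgeSet H he⟩, by simpa using he, rfl⟩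

lemma card_vertexPair (n : ℕ) : Fintype.card (VertexPair n) = n.choose 2 := by
  have := Sym2.card_subtype_not_diag (α := Fin n)
  rw [Fintype.card_fin] at this
  convert this

lemma hittingTime_eq_hitTime {n : ℕ} {Ω : Type*} (G : ℝ≥0 → Ω → SimpleGraph (Fin n)) (i : ℕ) :
    hittingTime G i = hitTime (edgeConfig G) {x | countTrue x = i} := by
  ext ω
  have : ∀ t, countTrue (edgeConfig G t ω) = numEdges (G t ω) := fun t => countTrue_edgeIndicator _
  simp only [hittingTime, hitTime, Set.mem_ofPred_eq, this]

/-- Independence factors the probability of a joint path over the edges; exchanging the products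
over edges and over time steps gives the product kernel. -/
lemma IsDynamicERGraph.hasGenerator {α β : ℝ} {n : ℕ} {G₀ : SimpleGraph (Fin n)} {Ω : Type*}
    [MeasurableSpace Ω] {P : Measure Ω} {G : ℝ≥0 → Ω → SimpleGraph (Fin n)}
    (hG : IsDynamicERGraph α β G₀ P G) :
    HasGenerator P (prodKernel (onOffGenerator (β / ((n : ℝ) - 1)) α))
      (prodGen (onOffGenerator (β / ((n : ℝ) - 1)) α)) (fun e => edgeIndicator G₀ e)
      (edgeConfig G) where
  measurable t := measurable_pi_lambda _ fun e =>
    measurable_to_countable' fun b => (hG.edge_process e).measurableSet_eq t b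
  right_continuous := by
    filter_upwards [ae_all_iff.2 fun e => (hG.edge_process e).right_continuous] with ω hω t
    filter_upwards [eventually_all.2 fun e => hω e t] with s hs
    exact funext hs
  path_law h k x hx := by
    have h1 : {ω | ∀ l ≤ k, edgeConfig G (l * h) ω = x l}
        = ⋂ e, {ω | ∀ l ≤ k, edgeIndicator (G (l * h) ω) e = x l e} := by
      ext ω
      simp only [edgeConfig, Set.mem_ofPred_eq, Set.mem_iInter, funext_iff]
      exact ⟨fun H e l hl => H l hl e, fun H l hl e => H e l hl⟩
    have h2 := hG.independent.meas_iInter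
      (s := fun e => {ω | ∀ l ≤ k, edgeIndicator (G (l * h) ω) e = x l e}) (fun e => by
        refine ⟨{p : ℝ≥0 → Bool | ∀ l ≤ k, p (l * h) = x l e}, ?_, rfl⟩
        simp only [Set.ofPred_forall]
        exact MeasurableSet.iInter fun l => MeasurableSet.iInter fun _ =>
          (measurableSet_singleton (x l e)).preimage (measurable_pi_apply (l * h)))
    rw [h1, measureReal_def, h2, ENNReal.toReal_prod]
    simp only [prodKernel]
    rw [Finset.prod_comm]
    refine Finset.prod_congr rfl fun e _ => ?_
    have h3 := (hG.edge_process e).fin_dim_dist k (fun l => l * h) (fun l => x l e)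
      (fun a b hab => by
        change (a : ℝ≥0) * h ≤ b * h; gcongr) (by simp) (by rw [hx])
    rw [← measureReal_def, h3]
    refine Finset.prod_congr rfl fun l _ => ?_
    have h4 : (((l + 1 : ℕ) * h : ℝ≥0) : ℝ) - ((l * h : ℝ≥0) : ℝ) = h := by push_cast; ring
    rw [h4]
  kernel_zero := prodKernel_zero _
  hasDerivAt_kernel := hasDerivAt_prodKernel _

end ERGraph

/-! ### Extending test functions beyond the target level. -/

section CountDrift

/-- The test function principles require a drift at every level except `i`, even for a chain started
below `i`. Adding a multiple of `C` repairs the levels above `i` without changing the values up to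
`i`. The increments of `C` decrease geometrically upwards, at a ratio `R` chosen so that a downward
jump outweighs all upward ones. -/
lemma exists_countGen_le_neg_one_above (N i : ℕ) (lam : ℝ) {mu : ℝ} (hmu : 0 < mu) :
    ∃ C : ℕ → ℝ, (∀ k, 0 ≤ C k) ∧ (∀ k ≤ i, C k = 0) ∧
      ∀ k ≤ N, i < k → countGen N lam mu C k ≤ -1 := by
  set R := (1 + N * |lam|) / mu + 1 with hR
  have hR1 : 1 ≤ R := by rw [hR]; simp only [le_add_iff_nonneg_left]; positivity
  -- The generator at level `N` reads the increment at `N + 1`; with the exponent `N + 1 - l` this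
  -- one is `R ^ 0` and the ratio is still exactly `R`.
  refine ⟨fun k => ∑ l ∈ Finset.Ioc i k, R ^ (N + 1 - l), fun k => ?_, fun k hk => ?_,
    fun k hkN hk => ?_⟩
  · exact Finset.sum_nonneg fun l _ => by positivity
  · simp [Finset.Ioc_eq_empty_of_le hk]
  · obtain ⟨k, rfl⟩ := Nat.exists_eq_succ_of_ne_zero (by omega : k ≠ 0)
    have h1 : ∑ l ∈ Finset.Ioc i (k + 1 + 1), R ^ (N + 1 - l)
        = ∑ l ∈ Finset.Ioc i (k + 1), R ^ (N + 1 - l) + R ^ (N + 1 - (k + 1 + 1)) :=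
      Finset.sum_Ioc_succ_top (by omega) _
    have h2 : ∑ l ∈ Finset.Ioc i (k + 1), R ^ (N + 1 - l)
        = ∑ l ∈ Finset.Ioc i k, R ^ (N + 1 - l) + R ^ (N + 1 - (k + 1)) :=
      Finset.sum_Ioc_succ_top (by omega) _
    simp only [countGen, Nat.succ_eq_add_one, h1, smul_eq_mul, Nat.add_sub_cancel]
    rw [h2]
    have h3 : R ^ (N + 1 - (k + 1)) = R * R ^ (N + 1 - (k + 1 + 1)) := by
      rw [← pow_succ']; congr 1; omega
    rw [h3]
    set D := R ^ (N + 1 - (k + 1 + 1))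
    have hD : 1 ≤ D := one_le_pow₀ hR1
    have h4 : ((N : ℝ) - ((k + 1 : ℕ) : ℝ)) * lam ≤ N * |lam| := by
      have h5 : ((k + 1 : ℕ) : ℝ) ≤ N := by exact_mod_cast hkN
      have h6 : (0 : ℝ) ≤ ((k + 1 : ℕ) : ℝ) := by positivity
      calc _ ≤ ((N : ℝ) - ((k + 1 : ℕ) : ℝ)) * |lam| :=
            mul_le_mul_of_nonneg_left (le_abs_self _) (by linarith)
        _ ≤ _ := mul_le_mul_of_nonneg_right (by linarith) (abs_nonneg _)
    have h7 : 1 + N * |lam| ≤ mu * R := by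
      rw [hR, mul_add, mul_div_cancel₀ _ hmu.ne']; linarith
    have h8 : mu * R ≤ ((k + 1 : ℕ) : ℝ) * mu * R := by
      have h9 : (1 : ℝ) ≤ ((k + 1 : ℕ) : ℝ) := by push_cast; linarith [k.cast_nonneg (α := ℝ)]
      have : 0 ≤ mu * R := by positivity
      nlinarith
    nlinarith

/-- Capping the argument at `i` freezes a test function above the target, where only the multiple of
`C` then contributes to the drift. -/
lemma countGen_min_of_lt {E : Type*} [AddCommGroup E] [Module ℝ E] {N i k : ℕ} (lam mu : ℝ)
    (F : ℕ → E) (hk : k < i) :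
    countGen N lam mu (fun k => F (min k i)) k = countGen N lam mu F k := by
  simp only [countGen]
  rw [min_eq_left (by omega), min_eq_left (by omega), min_eq_left (by omega)]

lemma countGen_min_of_gt {E : Type*} [AddCommGroup E] [Module ℝ E] {N i k : ℕ} (lam mu : ℝ)
    (F : ℕ → E) (hk : i < k) :
    countGen N lam mu (fun k => F (min k i)) k = 0 := by
  simp only [countGen]
  rw [min_eq_right (by omega), min_eq_right (by omega), min_eq_right (by omega)]
  simp

lemma countGen_of_eq_zero_of_lt {N i k : ℕ} (lam mu : ℝ)
    {F : ℕ → ℝ} (hF : ∀ k ≤ i, F k = 0) (hk : k < i) :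
    countGen N lam mu F k = 0 := by
  simp only [countGen]
  rw [hF _ (by omega), hF _ (by omega), hF _ (by omega)]
  simp

lemma countGen_add_mul {N : ℕ} (lam mu a : ℝ) (F C : ℕ → ℝ) (k : ℕ) :
    countGen N lam mu (fun k => F k + a * C k) k
      = countGen N lam mu F k + a * countGen N lam mu C k := by
  simp only [countGen, smul_eq_mul]
  ring

end CountDrift

/-! ### Test function principles for the number of edges. -/

section ERHitting

variable {α β : ℝ} {n : ℕ} {G₀ : SimpleGraph (Fin n)} {Ω : Type*}
    [MeasurableSpace Ω] {P : Measure Ω} [IsProbabilityMeasure P]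
    {G : ℝ≥0 → Ω → SimpleGraph (Fin n)} (hG : IsDynamicERGraph α β G₀ P G)

include hG

lemma IsDynamicERGraph.aemeasurable_hittingTime (i : ℕ) : AEMeasurable (hittingTime G i) P := by
  rw [hittingTime_eq_hitTime]
  exact hG.hasGenerator.aemeasurable_hitTime

omit [IsProbabilityMeasure P] hG in
lemma matAct_prodGen_edge {E : Type*} [AddCommGroup E] [Module ℝ E] (lam mu : ℝ) (F : ℕ → E)
    (x : VertexPair n → Bool) :
    matAct (prodGen (onOffGenerator lam mu)) (fun y => F (countTrue y)) x
      = countGen (n.choose 2) lam mu F (countTrue x) := by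
  rw [matAct_prodGen_countTrue, card_vertexPair]

omit [IsProbabilityMeasure P] hG in
lemma countTrue_edge_le (x : VertexPair n → Bool) : countTrue x ≤ n.choose 2 :=
  (countTrue_le x).trans_eq (card_vertexPair n)

theorem IsDynamicERGraph.lintegral_hittingTime_le {i : ℕ} {F : ℕ → ℝ} (hF : ∀ k, 0 ≤ F k)
    (hgen : ∀ k ≤ n.choose 2, k ≠ i → countGen (n.choose 2) (β / ((n : ℝ) - 1)) α F k ≤ -1) :
    ∫⁻ ω, hittingTime G i ω ∂P ≤ ENNReal.ofReal (F (numEdges G₀)) := by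
  rw [hittingTime_eq_hitTime]
  by_cases h0 : numEdges G₀ = i
  · rw [lintegral_congr_ae (hG.hasGenerator.hitTime_eq_zero (by
      simp [countTrue_edgeIndicator, h0]))]
    simp
  · have := hG.hasGenerator.lintegral_hitTime_le (B := {x | countTrue x = i})
      (f := fun x => F (countTrue x)) (by simpa [countTrue_edgeIndicator] using h0)
      (fun x => hF _) (fun x hx => by
        rw [matAct_prodGen_edge]; exact hgen _ (countTrue_edge_le x) hx)
    rwa [countTrue_edgeIndicator] at this

theorem IsDynamicERGraph.le_lintegral_hittingTime {i : ℕ} {F F' : ℕ → ℝ} (h0 : numEdges G₀ ≠ i)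
    (hFi : F i = 0)
    (hgen : ∀ k ≤ n.choose 2, k ≠ i → -1 ≤ countGen (n.choose 2) (β / ((n : ℝ) - 1)) α F k)
    (hF' : ∀ k, 0 ≤ F' k)
    (hgen' : ∀ k ≤ n.choose 2, k ≠ i → countGen (n.choose 2) (β / ((n : ℝ) - 1)) α F' k ≤ -1) :
    ENNReal.ofReal (F (numEdges G₀)) ≤ ∫⁻ ω, hittingTime G i ω ∂P := by
  rw [hittingTime_eq_hitTime]
  have := hG.hasGenerator.le_lintegral_hitTime (B := {x | countTrue x = i})
    (f := fun x => F (countTrue x)) (g := fun x => F' (countTrue x))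
    (by simpa [countTrue_edgeIndicator] using h0)
    (fun x (hx : countTrue x = i) => by simp [hx, hFi])
    (fun x hx => by rw [matAct_prodGen_edge]; exact hgen _ (countTrue_edge_le x) hx)
    (fun x => hF' _) (fun x hx => by
      rw [matAct_prodGen_edge]; exact hgen' _ (countTrue_edge_le x) hx)
  rwa [countTrue_edgeIndicator] at this

theorem IsDynamicERGraph.norm_laplace_hittingTime_sub_le {i : ℕ} {u : ℕ → ℂ} {w F : ℕ → ℝ} {s : ℂ}
    (h0 : numEdges G₀ ≠ i) (hs : 0 ≤ s.re) (hu : u i = 1) (hw : ∀ k, 0 ≤ w k)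
    (hF : ∀ k, 0 ≤ F k)
    (hgen : ∀ k ≤ n.choose 2, k ≠ i → countGen (n.choose 2) (β / ((n : ℝ) - 1)) α F k ≤ -1)
    (hgenu : ∀ k ≤ n.choose 2, k ≠ i →
      ‖s * u k - countGen (n.choose 2) (β / ((n : ℝ) - 1)) α u k‖
        ≤ -countGen (n.choose 2) (β / ((n : ℝ) - 1)) α w k) :
    ‖∫ ω, Complex.exp (-s * (hittingTime G i ω).toReal) ∂P - u (numEdges G₀)‖
      ≤ w (numEdges G₀) := by
  rw [hittingTime_eq_hitTime]
  have := hG.hasGenerator.norm_laplace_hitTime_sub_le (B := {x | countTrue x = i}) (s := s)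
    (u := fun x => u (countTrue x)) (w := fun x => w (countTrue x)) (f := fun x => F (countTrue x))
    (by simpa [countTrue_edgeIndicator] using h0) hs
    (fun x (hx : countTrue x = i) => by simp [hx, hu]) (fun x => hw _) (fun x => hF _)
    (fun x hx => by rw [matAct_prodGen_edge]; exact hgen _ (countTrue_edge_le x) hx)
    (fun x hx => by
      rw [matAct_prodGen_edge, matAct_prodGen_edge]; exact hgenu _ (countTrue_edge_le x) hx)
  rwa [countTrue_edgeIndicator] at this

omit [IsProbabilityMeasure P] hG in
/-- Extension above `i` of a function with drift at most `-a` below `i`. -/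
lemma countGen_extend_le {N i : ℕ} {lam mu a : ℝ} (ha : 0 ≤ a) {F C : ℕ → ℝ} {ψ : ℕ → ℝ}
    (hCi : ∀ k ≤ i, C k = 0) (hC : ∀ k ≤ N, i < k → countGen N lam mu C k ≤ -1)
    (hF : ∀ k < i, countGen N lam mu F k ≤ -ψ k) (hψ : ∀ k, i < k → ψ k ≤ a) :
    ∀ k ≤ N, k ≠ i → countGen N lam mu (fun k => F (min k i) + a * C k) k ≤ -ψ k := by
  intro k hkN hk
  rw [countGen_add_mul (F := fun k => F (min k i))]
  rcases lt_or_gt_of_ne hk with hk | hk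
  · rw [countGen_min_of_lt _ _ F hk, countGen_of_eq_zero_of_lt _ _ hCi hk]
    simpa using hF k hk
  · rw [countGen_min_of_gt _ _ F hk]
    have h1 := hC k hkN hk
    have h2 := hψ k hk
    nlinarith

/-- Upper bound of the mean time to reach `i` edges from below, by a function with drift at most
`-1` below `i`. -/
theorem IsDynamicERGraph.lintegral_hittingTime_le_of_lt {i : ℕ} {F : ℕ → ℝ} (hα : 0 < α)
    (h0 : numEdges G₀ < i) (hF : ∀ k ≤ i, 0 ≤ F k)
    (hgen : ∀ k < i, countGen (n.choose 2) (β / ((n : ℝ) - 1)) α F k ≤ -1) :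
    ∫⁻ ω, hittingTime G i ω ∂P ≤ ENNReal.ofReal (F (numEdges G₀)) := by
  obtain ⟨C, hC, hCi, hCgen⟩ := exists_countGen_le_neg_one_above (n.choose 2) i (β / ((n : ℝ) - 1)) hα
  have h1 := hG.lintegral_hittingTime_le (i := i) (F := fun k => F (min k i) + 1 * C k)
    (fun k => add_nonneg (hF _ (min_le_right _ _)) (by simpa using hC k))
    (countGen_extend_le zero_le_one hCi hCgen hgen fun _ _ => le_rfl)
  simpa [min_eq_left h0.le, hCi _ h0.le] using h1

/-- Lower bound of the mean time to reach `i` edges from below, by a function with drift at least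
`-1` below `i`. -/
theorem IsDynamicERGraph.le_lintegral_hittingTime_of_lt {i : ℕ} {F F' : ℕ → ℝ} (hα : 0 < α)
    (h0 : numEdges G₀ < i) (hFi : F i = 0)
    (hgen : ∀ k < i, -1 ≤ countGen (n.choose 2) (β / ((n : ℝ) - 1)) α F k)
    (hF' : ∀ k ≤ i, 0 ≤ F' k)
    (hgen' : ∀ k < i, countGen (n.choose 2) (β / ((n : ℝ) - 1)) α F' k ≤ -1) :
    ENNReal.ofReal (F (numEdges G₀)) ≤ ∫⁻ ω, hittingTime G i ω ∂P := by
  obtain ⟨C, hC, hCi, hCgen⟩ := exists_countGen_le_neg_one_above (n.choose 2) i (β / ((n : ℝ) - 1)) hα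
  have h1 := hG.le_lintegral_hittingTime (i := i) (F := fun k => F (min k i))
    (F' := fun k => F' (min k i) + 1 * C k) h0.ne (by simpa using hFi)
    (fun k hkN hk => by
      rcases lt_or_gt_of_ne hk with hk | hk
      · rw [countGen_min_of_lt _ _ F hk]; exact hgen _ hk
      · rw [countGen_min_of_gt _ _ F hk]; norm_num)
    (fun k => add_nonneg (hF' _ (min_le_right _ _)) (by simpa using hC _))
    (countGen_extend_le zero_le_one hCi hCgen hgen' fun _ _ => le_rfl)
  simpa [min_eq_left h0.le] using h1

/-- Approximation of the Laplace transform of the time to reach `i` edges from below. -/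
theorem IsDynamicERGraph.norm_laplace_hittingTime_sub_le_of_lt {i : ℕ} {u : ℕ → ℂ} {w F : ℕ → ℝ}
    {s : ℂ} (hα : 0 < α) (h0 : numEdges G₀ < i) (hs : 0 ≤ s.re) (hu : u i = 1)
    (hw : ∀ k ≤ i, 0 ≤ w k) (hF : ∀ k ≤ i, 0 ≤ F k)
    (hgen : ∀ k < i, countGen (n.choose 2) (β / ((n : ℝ) - 1)) α F k ≤ -1)
    (hgenu : ∀ k < i, ‖s * u k - countGen (n.choose 2) (β / ((n : ℝ) - 1)) α u k‖
      ≤ -countGen (n.choose 2) (β / ((n : ℝ) - 1)) α w k) :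
    ‖∫ ω, Complex.exp (-s * (hittingTime G i ω).toReal) ∂P - u (numEdges G₀)‖
      ≤ w (numEdges G₀) := by
  obtain ⟨C, hC, hCi, hCgen⟩ := exists_countGen_le_neg_one_above (n.choose 2) i (β / ((n : ℝ) - 1)) hα
  -- Above `i` the capped `u` is constantly `1`, so its residual has norm `‖s‖`, which `‖s‖ * C`
  -- pays for.
  have hext := countGen_extend_le (norm_nonneg s) hCi hCgen
    (ψ := fun k => ‖s * u (min k i)
      - countGen (n.choose 2) (β / ((n : ℝ) - 1)) α (fun k => u (min k i)) k‖)
    (fun k hk => by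
      rw [countGen_min_of_lt _ _ u hk, min_eq_left hk.le]
      exact le_neg_of_le_neg (hgenu k hk))
    (fun k hk => by
      rw [countGen_min_of_gt _ _ u hk, min_eq_right hk.le, hu, mul_one, sub_zero])
  have h1 := hG.norm_laplace_hittingTime_sub_le (i := i) (s := s) (u := fun k => u (min k i))
    (w := fun k => w (min k i) + ‖s‖ * C k) (F := fun k => F (min k i) + 1 * C k) h0.ne hs
    (by simpa using hu)
    (fun k => add_nonneg (hw _ (min_le_right _ _)) (mul_nonneg (norm_nonneg _) (hC _)))
    (fun k => add_nonneg (hF _ (min_le_right _ _)) (by simpa using hC _))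
    (countGen_extend_le zero_le_one hCi hCgen hgen fun _ _ => le_rfl)
    (fun k hkN hk => le_neg_of_le_neg (hext k hkN hk))
  simpa [min_eq_left h0.le, hCi _ h0.le] using h1

end ERHitting

/-! ### Rates, rounding and harmonic sums. -/

section Rates

/-- Here `S k` plays the role of the passage time from `k` to `k + 1`. At `k = 0` the truncated
index `k - 1` is harmless, being multiplied by `k`. -/
lemma countGen_sum_Ico {N i k : ℕ} (lam mu : ℝ) (S : ℕ → ℝ) (hk : k < i) :
    countGen N lam mu (fun k => ∑ l ∈ Finset.Ico k i, S l) k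
      = -((N - k : ℝ) * lam * S k - k * mu * S (k - 1)) := by
  have h1 : ∑ l ∈ Finset.Ico k i, S l = S k + ∑ l ∈ Finset.Ico (k + 1) i, S l :=
    Finset.sum_eq_sum_Ico_succ_bot hk S
  rcases Nat.eq_zero_or_pos k with rfl | hpos
  · simp only [countGen, smul_eq_mul, h1]
    simp
  · have h2 : ∑ l ∈ Finset.Ico (k - 1) i, S l = S (k - 1) + ∑ l ∈ Finset.Ico (k - 1 + 1) i, S l :=
      Finset.sum_eq_sum_Ico_succ_bot (by omega) S
    rw [Nat.sub_add_cancel hpos] at h2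
    simp only [countGen, smul_eq_mul, h2]
    rw [h1]
    ring

lemma birthRate_eq {n : ℕ} (hn : 2 ≤ n) (β : ℝ) (k : ℕ) :
    (((n.choose 2 : ℕ) : ℝ) - k) * (β / ((n : ℝ) - 1)) = n * β / 2 - k * (β / ((n : ℝ) - 1)) := by
  have : (n : ℝ) - 1 ≠ 0 := by
    have : (2 : ℝ) ≤ n := by exact_mod_cast hn
    linarith
  rw [Nat.cast_choose_two]
  field_simp

lemma edgeTarget_bounds {c : ℝ} (hc : 0 ≤ c) (n : ℕ) :
    c * n - 1 / 2 ≤ edgeTarget c n ∧ (edgeTarget c n : ℝ) ≤ c * n + 1 / 2 := by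
  have h0 : 0 ≤ round (c * n) := by
    rw [round_eq, Int.floor_nonneg]; positivity
  have h1 : (edgeTarget c n : ℝ) = round (c * n) := by
    unfold edgeTarget
    exact_mod_cast congrArg (fun z : ℤ => (z : ℝ)) (Int.toNat_of_nonneg h0)
  have h2 := abs_le.1 (abs_sub_round (c * n))
  rw [h1]
  constructor <;> linarith [h2.1, h2.2]

lemma sum_Ico_one_div_le {i j : ℕ} :
    ∑ l ∈ Finset.Ico j i, 1 / ((i : ℝ) - l) ≤ 1 + Real.log i := by
  have h1 : ∑ l ∈ Finset.range i, 1 / ((i : ℝ) - l) = (harmonic i : ℝ) := by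
    rw [harmonic, ← Finset.sum_range_reflect]
    push_cast
    refine Finset.sum_congr rfl fun l hl => ?_
    have hl := Finset.mem_range.1 hl
    rw [one_div]
    congr 1
    rw [Nat.sub_sub, Nat.cast_sub (by omega)]
    push_cast
    ring
  refine le_trans ?_ (harmonic_le_one_add_log i)
  rw [← h1]
  refine Finset.sum_le_sum_of_subset_of_nonneg (fun l hl => ?_) fun l hl _ => ?_
  · exact Finset.mem_range.2 (Finset.mem_Ico.1 hl).2
  · have : (l : ℝ) ≤ i := by exact_mod_cast (Finset.mem_range.1 hl).le
    exact one_div_nonneg.2 (by linarith)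

lemma sum_Ioc_one_div_le {i j : ℕ} :
    ∑ l ∈ Finset.Ioc i j, 1 / ((l : ℝ) - i) ≤ 1 + Real.log j := by
  rcases le_total j i with h | h
  · rw [Finset.Ioc_eq_empty_of_le h, Finset.sum_empty]
    have := Real.log_natCast_nonneg j
    linarith
  obtain ⟨d, rfl⟩ := Nat.exists_eq_add_of_le h
  have h1 : ∑ l ∈ Finset.Ioc i (i + d), 1 / ((l : ℝ) - i) = (harmonic d : ℝ) := by
    rw [harmonic]
    push_cast
    induction d with
    | zero => simp
    | succ d ih =>
      rw [Finset.sum_range_succ, ← ih (by omega), ← add_assoc, Finset.sum_Ioc_succ_top (by omega)]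
      congr 1
      push_cast
      rw [one_div]
      congr 1
      ring
  rw [h1]
  refine (harmonic_le_one_add_log d).trans ?_
  rcases Nat.eq_zero_or_pos d with rfl | hd
  · simpa using Real.log_natCast_nonneg i
  · have : Real.log d ≤ Real.log ((i + d : ℕ) : ℝ) :=
      Real.log_le_log (by exact_mod_cast hd) (by push_cast; linarith [i.cast_nonneg (α := ℝ)])
    linarith

end Rates

/-! ### Logarithmic bound at the equilibrium level. -/

section Critical

/-- Distance-harmonic function to the level `i`. -/
noncomputable def levelFun (A : ℝ) (i k : ℕ) : ℝ :=
  A * (∑ l ∈ Finset.Ico k i, 1 / ((i : ℝ) - l) + ∑ l ∈ Finset.Ioc i k, 1 / ((l : ℝ) - i))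

lemma levelFun_nonneg {A : ℝ} (hA : 0 ≤ A) (i k : ℕ) : 0 ≤ levelFun A i k := by
  refine mul_nonneg hA (add_nonneg (Finset.sum_nonneg fun l hl => ?_)
    (Finset.sum_nonneg fun l hl => ?_))
  · have : (l : ℝ) ≤ i := by exact_mod_cast (Finset.mem_Ico.1 hl).2.le
    exact one_div_nonneg.2 (by linarith)
  · have : (i : ℝ) ≤ l := by exact_mod_cast (Finset.mem_Ioc.1 hl).1.le
    exact one_div_nonneg.2 (by linarith)

lemma levelFun_le {A : ℝ} (hA : 0 ≤ A) {i k m : ℕ} (hi : i ≤ m) (hk : k ≤ m) :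
    levelFun A i k ≤ A * (2 + 2 * Real.log m) := by
  have hlog : ∀ j ≤ m, Real.log j ≤ Real.log m := by
    intro j hj
    rcases Nat.eq_zero_or_pos j with rfl | hpos
    · simpa using Real.log_natCast_nonneg m
    · exact Real.log_le_log (by exact_mod_cast hpos) (by exact_mod_cast hj)
  refine mul_le_mul_of_nonneg_left ?_ hA
  linarith [sum_Ico_one_div_le (i := i) (j := k), sum_Ioc_one_div_le (i := i) (j := k), hlog i hi,
    hlog k hk]

lemma countGen_levelFun_of_lt {N i k : ℕ} (lam mu A : ℝ) (hk : k < i) :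
    countGen N lam mu (levelFun A i) k
      = -(A * ((N - k : ℝ) * lam / (i - k) - k * mu / (i - k + 1))) := by
  have h1 := countGen_sum_Ico (N := N) lam mu (fun l => A * (1 / ((i : ℝ) - l))) hk
  have h2 : ∀ j ≤ i, levelFun A i j = ∑ l ∈ Finset.Ico j i, A * (1 / ((i : ℝ) - l)) := by
    intro j hj
    rw [levelFun, Finset.Ioc_eq_empty_of_le hj, Finset.sum_empty, add_zero, Finset.mul_sum]
  have h3 : countGen N lam mu (levelFun A i) k
      = countGen N lam mu (fun k => ∑ l ∈ Finset.Ico k i, A * (1 / ((i : ℝ) - l))) k := by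
    simp only [countGen]
    rw [h2 _ (by omega), h2 _ (by omega), h2 _ (by omega)]
  rw [h3, h1]
  rcases Nat.eq_zero_or_pos k with rfl | hpos
  · simp; ring
  · rw [Nat.cast_sub hpos]
    push_cast
    rw [show (i : ℝ) - (k - 1) = i - k + 1 by ring]
    ring

lemma countGen_levelFun_of_gt {N i k : ℕ} (lam mu A : ℝ) (hk : i < k) :
    countGen N lam mu (levelFun A i) k
      = A * ((N - k : ℝ) * lam / (k - i + 1) - k * mu / (k - i)) := by
  obtain ⟨k, rfl⟩ := Nat.exists_eq_succ_of_ne_zero (by omega : k ≠ 0)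
  have h2 : ∀ j, i ≤ j → levelFun A i j = A * ∑ l ∈ Finset.Ioc i j, (1 / ((l : ℝ) - i)) := by
    intro j hj
    rw [levelFun, Finset.Ico_eq_empty_of_le hj, Finset.sum_empty, zero_add]
  simp only [countGen, Nat.succ_eq_add_one, Nat.add_sub_cancel, smul_eq_mul]
  rw [h2 _ (by omega), h2 _ (by omega), h2 _ (by omega), Finset.sum_Ioc_succ_top (by omega),
    Finset.sum_Ioc_succ_top (by omega)]
  push_cast
  rw [show (k : ℝ) + 1 + 1 - i = k + 1 - i + 1 by ring]
  ring

/-- The drift towards the target at distance `d` is `α d` up to a bounded deficit `E`. If `d ≥ 2 E /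
α`, half of `α d` covers `E`. Otherwise `k` is large, and the discretization gain `k α / (d + 1)`,
due to the smaller increment on the far side, covers it. -/
lemma drift_below_critical {α E d k r : ℝ} (hα : 0 < α) (hk : 0 ≤ k) (hd : 1 ≤ d)
    (hr : α * d - E ≤ r - k * α) (hkd : E * (2 * E / α + 1) / α + 2 * E / α ≤ k + d) :
    -(2 / α * (r / d - k * α / (d + 1))) ≤ -1 := by
  have h2 : E ≤ α * d / 2 + k * α / (d + 1) := by
    rcases le_total (2 * E / α) d with h | h
    · have h1 : E ≤ α * d / 2 := by
        rw [div_le_iff₀ hα] at h; linarith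
      have : 0 ≤ k * α / (d + 1) := by positivity
      linarith
    · have h3 : E * (2 * E / α + 1) / α ≤ k := by linarith
      rw [div_le_iff₀ hα] at h3
      have hE : 0 ≤ E := by
        have : 0 ≤ 2 * E / α := by linarith
        rw [le_div_iff₀ hα] at this
        linarith
      have h4 : E ≤ k * α / (d + 1) := by
        rw [le_div_iff₀ (by linarith)]
        refine le_trans (mul_le_mul_of_nonneg_left ?_ hE) h3
        linarith
      have : 0 ≤ α * d / 2 := by positivity
      linarith
  have h3 : r / d - k * α / (d + 1) = ((r - k * α) + k * α / (d + 1)) / d := by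
    field_simp
    ring
  rw [h3, neg_le_neg_iff, div_mul_div_comm, le_div_iff₀ (by positivity)]
  linarith

lemma drift_above_critical {α d k r : ℝ} (hα : 0 < α) (hd : 1 ≤ d) (hr0 : 0 ≤ r)
    (hr : r ≤ k * α - α * d / 2) : 2 / α * (r / (d + 1) - k * α / d) ≤ -1 := by
  have h2 : r / (d + 1) ≤ r / d := by gcongr; linarith
  have h3 : r / d - k * α / d ≤ -(α / 2) := by
    rw [← sub_div, div_le_iff₀ (by linarith)]
    linarith
  calc _ ≤ 2 / α * (-(α / 2)) := mul_le_mul_of_nonneg_left (by linarith) (by positivity)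
    _ = -1 := by field_simp

/-- Logarithmic bound of the mean time to reach the equilibrium number of edges. -/
theorem critical_lintegral_hittingTime_le {α β c : ℝ} (hα : 0 < α) (hβ : 0 < β)
    (hc : c = β / (2 * α)) :
    ∃ M : ℝ, ∀ᶠ n : ℕ in atTop, ∀ (j : ℕ) (G₀ : SimpleGraph (Fin n)), numEdges G₀ = j →
        ∀ (Ω : Type u) [MeasurableSpace Ω] (P : Measure Ω) [IsProbabilityMeasure P]
          (G : ℝ≥0 → Ω → SimpleGraph (Fin n)), IsDynamicERGraph α β G₀ P G →
          ∫⁻ ω, hittingTime G (edgeTarget c n) ω ∂P ≤ ENNReal.ofReal (M * Real.log n) := by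
  have hc0 : 0 < c := by rw [hc]; positivity
  have hcα : c * α * 2 = β := by rw [hc]; field_simp
  -- `α / 2` comes from rounding `c n`; the rest bounds `i β / (n - 1)`, the correction of the birth
  -- rate.
  set E := α / 2 + (2 * c + 1 / 2) * β with hE
  have hE0 : 0 < E := by positivity
  set D := 2 * E / α with hD
  have hD0 : 0 < D := by positivity
  -- The edge counts are at most `n ^ 2`, so the two harmonic sums are at most `2 + 4 log n ≤ 6 log
  -- n` once `log n ≥ 1`; the prefactor is `2 / α`.
  refine ⟨12 / α, ?_⟩
  filter_upwards [eventually_ge_atTop 3, eventually_ge_atTop ⌈c + 1⌉₊,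
    eventually_ge_atTop ⌈(E * (D + 1) / α + D + 1 / 2) / c⌉₊] with n hn3 hnc hnE
  intro j G₀ hj Ω _ P _ G hG
  have hn : (3 : ℝ) ≤ n := by exact_mod_cast hn3
  have hnc : c + 1 ≤ n := Nat.ceil_le.1 hnc
  have hnE : E * (D + 1) / α + D + 1 / 2 ≤ c * n := by
    have := Nat.ceil_le.1 hnE
    rwa [div_le_iff₀' hc0] at this
  set i := edgeTarget c n with hi
  obtain ⟨hi1, hi2⟩ := edgeTarget_bounds hc0.le n
  rw [← hi] at hi1 hi2
  set lam := β / ((n : ℝ) - 1) with hlam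
  have hn1 : 0 < (n : ℝ) - 1 := by linarith
  have hlam0 : 0 < lam := by positivity
  have hlamn : lam * (n - 1) = β := by rw [hlam]; field_simp
  have hrate := birthRate_eq (by omega : 2 ≤ n) β
  rw [← hlam] at hrate
  have hilam : i * lam ≤ (2 * c + 1 / 2) * β := by
    have h1 : (i : ℝ) ≤ (2 * c + 1 / 2) * (n - 1) := by nlinarith
    calc (i : ℝ) * lam ≤ (2 * c + 1 / 2) * (n - 1) * lam := by gcongr
      _ = _ := by rw [mul_assoc, mul_comm _ lam, hlamn]
  have hA : (0 : ℝ) ≤ 2 / α := by positivity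
  have key := hG.lintegral_hittingTime_le (i := i) (F := levelFun (2 / α) i)
    (levelFun_nonneg hA i) (fun k hkN hk => by
      rw [← hlam]
      rcases lt_or_gt_of_ne hk with hk | hk
      · rw [countGen_levelFun_of_lt _ _ _ hk, hrate]
        have hkd : (k : ℝ) + 1 ≤ i := by exact_mod_cast hk
        obtain ⟨d, hd⟩ : ∃ d : ℝ, d = i - k := ⟨_, rfl⟩
        rw [← hd]
        have hd1 : 1 ≤ d := by linarith
        have hk0 : (0 : ℝ) ≤ k := k.cast_nonneg
        have h1 : α * d - E ≤ n * β / 2 - k * lam - k * α := by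
          have : k * lam ≤ i * lam := by gcongr
          rw [← hcα, hE, hd]
          nlinarith
        exact drift_below_critical hα hk0 hd1 h1 (by rw [← hD]; linarith)
      · rw [countGen_levelFun_of_gt _ _ _ hk]
        have hkd : (i : ℝ) + 1 ≤ k := by exact_mod_cast hk
        obtain ⟨d, hd⟩ : ∃ d : ℝ, d = k - i := ⟨_, rfl⟩
        rw [← hd]
        have hd1 : 1 ≤ d := by linarith
        have hk0 : (0 : ℝ) ≤ k := k.cast_nonneg
        have hr0 : 0 ≤ (((n.choose 2 : ℕ) : ℝ) - k) * lam := by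
          have : (k : ℝ) ≤ (n.choose 2 : ℕ) := by exact_mod_cast hkN
          exact mul_nonneg (by linarith) hlam0.le
        -- The rounding error `α / 2` is absorbed by half of `α d`, since `d ≥ 1`.
        have h1 : (((n.choose 2 : ℕ) : ℝ) - k) * lam ≤ k * α - α * d / 2 := by
          rw [hrate, ← hcα]
          have : 0 ≤ k * lam := by positivity
          nlinarith
        exact drift_above_critical hα hd1 hr0 h1)
  refine key.trans (ENNReal.ofReal_le_ofReal ?_)
  have hiN : i ≤ n ^ 2 := by
    have : (i : ℝ) ≤ (n : ℝ) ^ 2 := by nlinarith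
    exact_mod_cast this
  have hjN : numEdges G₀ ≤ n ^ 2 := by
    rw [← countTrue_edgeIndicator]
    refine (countTrue_edge_le _).trans ?_
    exact Nat.choose_le_pow n 2
  refine (levelFun_le hA hiN hjN).trans ?_
  have hlog : 1 ≤ Real.log n := by
    rw [Real.le_log_iff_exp_le (by linarith)]
    exact Real.exp_one_lt_three.le.trans hn
  push_cast
  rw [Real.log_pow]
  push_cast
  rw [show 12 / α * Real.log n = 2 / α * (6 * Real.log n) by ring]
  exact mul_le_mul_of_nonneg_left (by linarith) hA

end Critical

/-! ### Asymptotics of the target level and a logarithmic Riemann sum. -/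

section LimitRates

lemma tendsto_edgeTarget_div {c : ℝ} (hc : 0 ≤ c) :
    Tendsto (fun n : ℕ => (edgeTarget c n : ℝ) / n) atTop (𝓝 c) := by
  have h1 : Tendsto (fun n : ℕ => (1 / 2 : ℝ) / n) atTop (𝓝 0) := tendsto_const_div_atTop_nhds_zero_nat _
  have h2 := (tendsto_const_nhds (x := c)).sub h1
  have h3 := (tendsto_const_nhds (x := c)).add h1
  rw [sub_zero] at h2
  rw [add_zero] at h3
  refine tendsto_of_tendsto_of_tendsto_of_le_of_le' h2 h3 ?_ ?_
  · filter_upwards [eventually_gt_atTop 0] with n hn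
    have hn : (0 : ℝ) < n := by exact_mod_cast hn
    rw [le_div_iff₀ hn, sub_mul, div_mul_cancel₀ _ hn.ne']
    exact (edgeTarget_bounds hc n).1
  · filter_upwards [eventually_gt_atTop 0] with n hn
    have hn : (0 : ℝ) < n := by exact_mod_cast hn
    rw [div_le_iff₀ hn, add_mul, div_mul_cancel₀ _ hn.ne']
    exact (edgeTarget_bounds hc n).2

lemma tendsto_div_natCast_sub_one (β : ℝ) :
    Tendsto (fun n : ℕ => β / ((n : ℝ) - 1)) atTop (𝓝 0) :=
  tendsto_const_nhds.div_atTop (tendsto_atTop_add_const_right _ (-1) tendsto_natCast_atTop_atTop)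

lemma numEdges_bot (n : ℕ) : numEdges (⊥ : SimpleGraph (Fin n)) = 0 := by
  simp [numEdges]

lemma eventually_edgeTarget_pos {c : ℝ} (hc : 0 < c) : ∀ᶠ n : ℕ in atTop, 0 < edgeTarget c n := by
  filter_upwards [(tendsto_edgeTarget_div hc.le).eventually_const_lt hc] with n hn
  by_contra h
  simp [Nat.eq_zero_of_not_pos h] at hn

/-- Comparison with the integral of `g / (a - x g)`: apply `log y ≤ y - 1` to the ratio of
consecutive denominators and to its inverse. In the lower bound the error telescopes to a single
endpoint term. -/
lemma log_sub_le_sum_one_div {a g : ℝ} (hg : 0 ≤ g) (i : ℕ) (hi : 0 < a - i * g) :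
    Real.log a - Real.log (a - i * g) - g / (a - i * g) ≤ g * ∑ l ∈ Finset.Ico 0 i, 1 / (a - l * g) ∧
      g * ∑ l ∈ Finset.Ico 0 i, 1 / (a - l * g) ≤ Real.log a - Real.log (a - i * g) := by
  induction i with
  | zero =>
    simp only [Nat.cast_zero, zero_mul, sub_zero] at hi
    simp
    positivity
  | succ i ih =>
    push_cast at hi ⊢
    have hi' : 0 < a - i * g := by nlinarith
    obtain ⟨h1, h2⟩ := ih hi'
    rw [Finset.sum_Ico_succ_top (by omega), mul_add]
    have h3 := Real.log_le_sub_one_of_pos (div_pos hi hi')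
    have h4 := Real.log_le_sub_one_of_pos (div_pos hi' hi)
    rw [Real.log_div hi.ne' hi'.ne'] at h3
    rw [Real.log_div hi'.ne' hi.ne'] at h4
    have h5 : (a - (i + 1) * g) / (a - i * g) - 1 = -(g * (1 / (a - i * g))) := by
      field_simp; ring
    have h6 : (a - i * g) / (a - (i + 1) * g) - 1 = g / (a - (i + 1) * g) := by
      rw [div_sub_one hi.ne']; congr 1; ring
    have h7 : g / (a - i * g) = g * (1 / (a - i * g)) := by ring
    constructor <;> linarith

end LimitRates

/-! ### Mean and Laplace transform below equilibrium. -/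

section Subcritical

lemma countGen_ofReal (N : ℕ) (lam mu : ℝ) (F : ℕ → ℝ) (k : ℕ) :
    countGen N lam mu (fun k => (F k : ℂ)) k = (countGen N lam mu F k : ℝ) := by
  simp [countGen]

/-- Estimates of the mean and of the Laplace transform of the hitting time from below, from
approximate mean passage times `S k` from `k` to `k + 1`. -/
lemma IsDynamicERGraph.passage_estimates {α β : ℝ} {n i : ℕ} {Ω : Type*}
    [MeasurableSpace Ω] {P : Measure Ω} [IsProbabilityMeasure P]
    {G : ℝ≥0 → Ω → SimpleGraph (Fin n)}
    (hG : IsDynamicERGraph α β (⊥ : SimpleGraph (Fin n)) P G) (hα : 0 < α) (hi : 0 < i)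
    {S r : ℕ → ℝ} {η : ℝ} (hη : 0 ≤ η)
    (hr : ∀ k < i, (((n.choose 2 : ℕ) : ℝ) - k) * (β / ((n : ℝ) - 1)) = r k)
    (hr0 : ∀ k < i, 0 ≤ r k)
    (hS0 : ∀ k < i, 0 ≤ S k) (hS1 : ∀ k < i, S k ≤ 1)
    (hlow : ∀ k < i, 1 ≤ r k * S k - k * α * S (k - 1))
    (hup : ∀ k < i, r k * S k - k * α * S (k - 1) ≤ 1 + η)
    (hsq : ∀ k < i, r k * S k ^ 2 + k * α * S (k - 1) ^ 2 ≤ η) :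
    ENNReal.ofReal ((∑ l ∈ Finset.Ico 0 i, S l) / (1 + η)) ≤ ∫⁻ ω, hittingTime G i ω ∂P ∧
    ∫⁻ ω, hittingTime G i ω ∂P ≤ ENNReal.ofReal (∑ l ∈ Finset.Ico 0 i, S l) ∧
    ‖∫ ω, Complex.exp (-1 * (hittingTime G i ω).toReal) ∂P
      - (Real.exp (-∑ l ∈ Finset.Ico 0 i, S l) : ℝ)‖ ≤ 2 * η * ∑ l ∈ Finset.Ico 0 i, S l := by
  set F : ℕ → ℝ := fun k => ∑ l ∈ Finset.Ico k i, S l with hF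
  have h0 : numEdges (⊥ : SimpleGraph (Fin n)) < i := by rwa [numEdges_bot]
  have hFnn : ∀ k, 0 ≤ F k := fun k =>
    Finset.sum_nonneg fun l hl => hS0 l (Finset.mem_Ico.1 hl).2
  have hgen : ∀ k < i, countGen (n.choose 2) (β / ((n : ℝ) - 1)) α F k
      = -(r k * S k - k * α * S (k - 1)) := fun k hk => by
    rw [hF, countGen_sum_Ico _ _ _ hk, hr k hk]
  have hgen1 : ∀ k < i, countGen (n.choose 2) (β / ((n : ℝ) - 1)) α F k ≤ -1 := fun k hk => by
    rw [hgen k hk]; linarith [hlow k hk]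
  have hgenmul : ∀ (a : ℝ) (k : ℕ), countGen (n.choose 2) (β / ((n : ℝ) - 1)) α (fun k => a * F k) k
      = a * countGen (n.choose 2) (β / ((n : ℝ) - 1)) α F k := fun a k => by
    simp only [countGen, smul_eq_mul]; ring
  have hFi : F i = 0 := by simp [hF]
  refine ⟨?_, ?_, ?_⟩
  -- The generator of `F` lies between `-(1 + η)` and `-1`; dividing by `1 + η` brings it above
  -- `-1`.
  · have := hG.le_lintegral_hittingTime_of_lt (F := fun k => (1 + η)⁻¹ * F k) hα h0 (by simp [hFi])
      (fun k hk => by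
        rw [hgenmul, hgen k hk, mul_neg, neg_le_neg_iff, inv_mul_le_iff₀ (by linarith), mul_one]
        exact hup k hk) (fun k _ => hFnn k) hgen1
    rwa [numEdges_bot, inv_mul_eq_div] at this
  · have := hG.lintegral_hittingTime_le_of_lt hα h0 (fun k _ => hFnn k) hgen1
    rwa [numEdges_bot] at this
  -- A deterministic remaining time `F k` would have Laplace transform `exp (-F k)` at `1`.
  · have := hG.norm_laplace_hittingTime_sub_le_of_lt (s := 1) (i := i)
      (u := fun k => ((Real.exp (-F k) : ℝ) : ℂ)) (w := fun k => 2 * η * F k) (F := F) hα h0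
      (by simp) (by simp [hFi]) (fun k _ => mul_nonneg (by positivity) (hFnn k)) (fun k _ => hFnn k)
      hgen1 (fun k hk => ?_)
    · rwa [numEdges_bot] at this
    · rw [hgenmul, hgen k hk, countGen_ofReal, one_mul, ← Complex.ofReal_sub, Complex.norm_real,
        Real.norm_eq_abs, mul_neg, neg_neg]
      -- The generator acts on `exp (-F)` as multiplication by `Z`. The linear part of `Z` is
      -- between `1` and `1 + η`, and the second-order part is at most `η` by `hsq`, so the residual
      -- is at most `2 * η`.
      set Z := r k * (Real.exp (S k) - 1) + k * α * (Real.exp (-S (k - 1)) - 1) with hZ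
      have h1 : countGen (n.choose 2) (β / ((n : ℝ) - 1)) α (fun k => Real.exp (-F k)) k
          = Real.exp (-F k) * Z := by
        have hFk : F k = S k + F (k + 1) := Finset.sum_eq_sum_Ico_succ_bot hk S
        have e1 : Real.exp (-F (k + 1)) = Real.exp (-F k) * Real.exp (S k) := by
          rw [← Real.exp_add, hFk]; congr 1; ring
        simp only [countGen, smul_eq_mul, hr k hk, e1]
        rcases Nat.eq_zero_or_pos k with rfl | hpos
        · simp [hZ]; ring
        · have hFk' : F (k - 1) = S (k - 1) + F k := by
            have := Finset.sum_eq_sum_Ico_succ_bot (show k - 1 < i by omega) S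
            rwa [Nat.sub_add_cancel hpos] at this
          have e2 : Real.exp (-F (k - 1)) = Real.exp (-F k) * Real.exp (-S (k - 1)) := by
            rw [← Real.exp_add, hFk']; congr 1; ring
          rw [e2, hZ]; ring
      have hkα : 0 ≤ k * α := by positivity
      have hS0' := hS0 (k - 1) (by omega)
      have hS1' := hS1 (k - 1) (by omega)
      have hZ1 : 1 ≤ Z := by
        have e1 := Real.add_one_le_exp (S k)
        have e2 := Real.add_one_le_exp (-S (k - 1))
        have e3 := mul_le_mul_of_nonneg_left (show S k ≤ Real.exp (S k) - 1 by linarith) (hr0 k hk)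
        have e4 := mul_le_mul_of_nonneg_left
          (show -S (k - 1) ≤ Real.exp (-S (k - 1)) - 1 by linarith) hkα
        have := hlow k hk
        linarith
      have hZ2 : Z ≤ 1 + 2 * η := by
        have e1 := (le_abs_self _).trans (Real.abs_exp_sub_one_sub_id_le (x := S k)
          (by rw [abs_of_nonneg (hS0 k hk)]; exact hS1 k hk))
        have e2 := (le_abs_self _).trans (Real.abs_exp_sub_one_sub_id_le (x := -S (k - 1))
          (by rw [abs_neg, abs_of_nonneg hS0']; exact hS1'))
        have e3 := mul_le_mul_of_nonneg_left
          (show Real.exp (S k) - 1 ≤ S k + S k ^ 2 by linarith) (hr0 k hk)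
        have e4 := mul_le_mul_of_nonneg_left
          (show Real.exp (-S (k - 1)) - 1 ≤ -S (k - 1) + S (k - 1) ^ 2 by
            rw [neg_sq] at e2; linarith) hkα
        have := hup k hk
        have := hsq k hk
        linarith
      have hexp : Real.exp (-F k) ≤ 1 := by
        rw [Real.exp_le_one_iff]; linarith [hFnn k]
      rw [h1, abs_sub_comm, abs_of_nonneg (by nlinarith [Real.exp_pos (-F k)])]
      calc Real.exp (-F k) * Z - Real.exp (-F k) = Real.exp (-F k) * (Z - 1) := by ring
        _ ≤ 1 * (2 * η) := mul_le_mul hexp (by linarith) (by linarith) zero_le_one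
        _ ≤ 2 * η * (r k * S k - k * α * S (k - 1)) := by
          rw [one_mul]
          exact le_mul_of_one_le_right (by positivity) (hlow k hk)

/-- Approximate mean time to reach `edgeTarget c n` edges from the empty graph. -/
noncomputable def subcriticalMean (α β c : ℝ) (n : ℕ) : ℝ :=
  ∑ l ∈ Finset.Ico 0 (edgeTarget c n), 1 / (n * β / 2 - l * (α + β / ((n : ℝ) - 1)))

lemma tendsto_subcriticalMean {α β c : ℝ} (hα : 0 < α) (hβ : 0 < β) (hc : 0 < c)
    (hcβ : c < β / (2 * α)) :
    Tendsto (subcriticalMean α β c) atTop (𝓝 (-Real.log (1 - 2 * α / β * c) / α)) := by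
  have hgap : 0 < β / 2 - c * α := by
    rw [lt_div_iff₀ (by positivity)] at hcβ; linarith
  have hg : Tendsto (fun n : ℕ => α + β / ((n : ℝ) - 1)) atTop (𝓝 α) := by
    simpa using tendsto_const_nhds.add (tendsto_div_natCast_sub_one β)
  have hD : Tendsto (fun n : ℕ => β / 2 - (edgeTarget c n : ℝ) / n * (α + β / ((n : ℝ) - 1))) atTop
      (𝓝 (β / 2 - c * α)) := tendsto_const_nhds.sub ((tendsto_edgeTarget_div hc.le).mul hg)
  have hlog : Tendsto (fun n : ℕ => Real.log (β / 2)
      - Real.log (β / 2 - (edgeTarget c n : ℝ) / n * (α + β / ((n : ℝ) - 1)))) atTop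
      (𝓝 (-Real.log (1 - 2 * α / β * c))) := by
    have h1 : -Real.log (1 - 2 * α / β * c) = Real.log (β / 2) - Real.log (β / 2 - c * α) := by
      rw [← Real.log_div (by positivity) hgap.ne', ← Real.log_inv]
      congr 1
      rw [inv_eq_one_div, div_eq_div_iff (by
        have : 1 - 2 * α / β * c = (β / 2 - c * α) / (β / 2) := by field_simp
        rw [this]; positivity) hgap.ne']
      field_simp
    rw [h1]
    exact tendsto_const_nhds.sub (hD.log hgap.ne')
  have herr : Tendsto (fun n : ℕ => (α + β / ((n : ℝ) - 1)) /
      (β / 2 - (edgeTarget c n : ℝ) / n * (α + β / ((n : ℝ) - 1))) * (1 / (n : ℝ))) atTop (𝓝 0) := by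
    simpa using (hg.div hD hgap.ne').mul tendsto_one_div_atTop_nhds_zero_nat
  have hlow := (hlog.sub herr).div hg hα.ne'
  rw [sub_zero] at hlow
  refine tendsto_of_tendsto_of_tendsto_of_le_of_le' hlow (hlog.div hg hα.ne') ?_ ?_
  all_goals
    filter_upwards [hD.eventually_const_lt hgap, eventually_ge_atTop 2] with n hn hn2
    have hn0 : (0 : ℝ) < n := by exact_mod_cast (by omega : 0 < n)
    have hn1 : 0 < (n : ℝ) - 1 := by
      have : (2 : ℝ) ≤ n := by exact_mod_cast hn2
      linarith
    have hγ : 0 < α + β / ((n : ℝ) - 1) := by positivity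
    have hd : n * β / 2 - edgeTarget c n * (α + β / ((n : ℝ) - 1))
        = n * (β / 2 - (edgeTarget c n : ℝ) / n * (α + β / ((n : ℝ) - 1))) := by
      field_simp
    have hb := log_sub_le_sum_one_div (a := n * β / 2) hγ.le (edgeTarget c n) (by rw [hd]; positivity)
    rw [hd, Real.log_mul hn0.ne' hn.ne', show n * β / 2 = n * (β / 2) by ring,
      Real.log_mul hn0.ne' (by positivity)] at hb
    have hsum : subcriticalMean α β c n = ∑ l ∈ Finset.Ico 0 (edgeTarget c n),
      1 / (n * (β / 2) - l * (α + β / ((n : ℝ) - 1))) := by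
      unfold subcriticalMean
      simp only [mul_div_assoc]
  · simp only [Pi.div_apply]
    rw [div_le_iff₀ hγ, hsum]
    refine (le_of_eq ?_).trans (hb.1.trans (le_of_eq (mul_comm _ _)))
    rw [div_mul_div_comm, mul_one, mul_comm (n : ℝ) (β / 2 - _)]
    ring
  · simp only [Pi.div_apply]
    rw [le_div_iff₀ hγ, hsum]
    refine ((le_of_eq (mul_comm _ _)).trans hb.2).trans (le_of_eq ?_)
    ring

/-- In the subcritical regime, mean and Laplace transform of the hitting time are close to those
of a constant. -/
lemma subcritical_estimates {α β c : ℝ} (hα : 0 < α) (hβ : 0 < β) (hc : 0 < c)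
    (hcβ : c < β / (2 * α)) :
    ∃ C : ℝ, 0 ≤ C ∧ ∀ᶠ n : ℕ in atTop, ∀ (Ω : Type u) [MeasurableSpace Ω] (P : Measure Ω)
      [IsProbabilityMeasure P] (G : ℝ≥0 → Ω → SimpleGraph (Fin n)),
      IsDynamicERGraph α β (⊥ : SimpleGraph (Fin n)) P G →
      ENNReal.ofReal (subcriticalMean α β c n / (1 + C / n))
        ≤ ∫⁻ ω, hittingTime G (edgeTarget c n) ω ∂P ∧
      ∫⁻ ω, hittingTime G (edgeTarget c n) ω ∂P ≤ ENNReal.ofReal (subcriticalMean α β c n) ∧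
      ‖∫ ω, Complex.exp (-1 * (hittingTime G (edgeTarget c n) ω).toReal) ∂P
        - (Real.exp (-subcriticalMean α β c n) : ℝ)‖ ≤ 2 * (C / n) * subcriticalMean α β c n := by
  have hgap : 0 < β / 2 - c * α := by
    rw [lt_div_iff₀ (by positivity)] at hcβ; linarith
  set δ := (β / 2 - c * α) / 2 with hδ
  have hδ0 : 0 < δ := by positivity
  have hg : Tendsto (fun n : ℕ => α + β / ((n : ℝ) - 1)) atTop (𝓝 α) := by
    simpa using tendsto_const_nhds.add (tendsto_div_natCast_sub_one β)
  have hD : Tendsto (fun n : ℕ => β / 2 - (edgeTarget c n : ℝ) / n * (α + β / ((n : ℝ) - 1))) atTop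
      (𝓝 (β / 2 - c * α)) := tendsto_const_nhds.sub ((tendsto_edgeTarget_div hc.le).mul hg)
  -- The net drift is at least `n δ`, so `S ≤ 1 / (n δ)`. With `k ≤ (c + 1) n` the first summand
  -- bounds the excess of the drift over `1`, the other two the quadratic terms; all are of order `1
  -- / n`.
  set C := ((c + 1) * α * (α + β) + β / 2 + (c + 1) * α) / δ ^ 2 with hC
  refine ⟨C, by positivity, ?_⟩
  filter_upwards [hD.eventually_const_lt (show δ < β / 2 - c * α by rw [hδ]; linarith),
    eventually_ge_atTop 2, eventually_edgeTarget_pos hc, eventually_ge_atTop ⌈1 / δ⌉₊]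
    with n hn hn2 hi hnδ
  intro Ω _ P _ G hG
  have hnδ : 1 ≤ n * δ := by
    have := Nat.ceil_le.1 hnδ
    rwa [div_le_iff₀ hδ0] at this
  have hn2' : (2 : ℝ) ≤ n := by exact_mod_cast hn2
  have hn0 : (0 : ℝ) < n := by linarith
  have hn1 : 1 ≤ (n : ℝ) - 1 := by linarith
  have hiup : (edgeTarget c n : ℝ) ≤ (c + 1) * n := by
    linarith [(edgeTarget_bounds hc.le n).2]
  have hrate := birthRate_eq hn2 β
  unfold subcriticalMean
  set i := edgeTarget c n with hidef
  set lam := β / ((n : ℝ) - 1) with hlam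
  have hlam0 : 0 < lam := by positivity
  have hlam1 : lam ≤ β := div_le_self hβ.le hn1
  have hγ : 0 < α + lam := by positivity
  have hd : ∀ l ≤ i, n * δ ≤ n * β / 2 - l * (α + lam) := by
    intro l hl
    have h1 : (l : ℝ) * (α + lam) ≤ i * (α + lam) := by gcongr
    have h2 : n * δ ≤ n * (β / 2 - (i : ℝ) / n * (α + lam)) := by gcongr
    have h3 : n * (β / 2 - (i : ℝ) / n * (α + lam)) = n * β / 2 - i * (α + lam) := by
      field_simp
    linarith
  have hnδ0 : 0 < n * δ := by positivity
  have hS : ∀ l ≤ i, 0 ≤ 1 / (n * β / 2 - l * (α + lam)) ∧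
      1 / (n * β / 2 - l * (α + lam)) ≤ 1 / (n * δ) := fun l hl =>
    ⟨one_div_nonneg.2 (hnδ0.le.trans (hd l hl)), one_div_le_one_div_of_le hnδ0 (hd l hl)⟩
  have hki : ∀ k < i, (k : ℝ) ≤ (c + 1) * n := fun k hk =>
    le_trans (by exact_mod_cast hk.le) hiup
  have hCn : C / n = ((c + 1) * n * α * (α + β) + (n * β / 2 + (c + 1) * n * α)) / (n * δ) ^ 2 := by
    rw [hC]; field_simp; ring
  -- As `S k` is the inverse of birth minus death rate, the left side is `1 + k α (S k - S (k -
  -- 1))`, and a difference of inverses is the product of the inverses times the increment `α +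
  -- lam`.
  have hpass : ∀ k < i, (n * β / 2 - k * lam) * (1 / (n * β / 2 - k * (α + lam)))
      - k * α * (1 / (n * β / 2 - ((k - 1 : ℕ) : ℝ) * (α + lam)))
      = 1 + k * α * (α + lam) * ((1 / (n * β / 2 - k * (α + lam)))
        * (1 / (n * β / 2 - ((k - 1 : ℕ) : ℝ) * (α + lam)))) := by
    intro k hk
    have h1 := hnδ0.trans_le (hd k hk.le)
    have h2 := hnδ0.trans_le (hd (k - 1) (by omega))
    rcases Nat.eq_zero_or_pos k with rfl | hpos
    · simp only [CharP.cast_eq_zero, zero_mul, sub_zero, add_zero] at h1 ⊢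
      rw [mul_one_div, div_self h1.ne']
    · rw [Nat.cast_sub hpos] at h2 ⊢
      push_cast at h2 ⊢
      have hx := mul_one_div_cancel h1.ne'
      have hy := mul_one_div_cancel h2.ne'
      linear_combination hx + k * α * ((1 / (n * β / 2 - (k - 1) * (α + lam))) * hx
        - (1 / (n * β / 2 - k * (α + lam))) * hy)
  refine hG.passage_estimates hα hi (r := fun k => n * β / 2 - k * lam)
    (S := fun l => 1 / (n * β / 2 - l * (α + lam))) (by positivity) (fun k _ => hrate k)
    (fun k hk => ?_) (fun k hk => (hS k hk.le).1)
    (fun k hk => (hS k hk.le).2.trans ((div_le_one hnδ0).2 hnδ)) (fun k hk => ?_) (fun k hk => ?_)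
    (fun k hk => ?_)
  · have h1 := hnδ0.trans_le (hd k hk.le)
    have : 0 ≤ k * α := by positivity
    linarith
  · rw [hpass k hk]
    have h1 := (hS k hk.le).1
    have h2 := (hS (k - 1) (by omega)).1
    have : 0 ≤ k * α * (α + lam) := by positivity
    linarith [mul_nonneg this (mul_nonneg h1 h2)]
  · rw [hpass k hk, add_le_add_iff_left, hCn]
    calc _ ≤ (c + 1) * n * α * (α + β) * (1 / (n * δ) * (1 / (n * δ))) := by
          have h1 := hS k hk.le
          have h2 := hS (k - 1) (by omega)
          have h3 := mul_le_mul h1.2 h2.2 h2.1 (by positivity)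
          refine mul_le_mul ?_ h3 (mul_nonneg h1.1 h2.1) (by positivity)
          have := hki k hk
          gcongr
      _ = ((c + 1) * n * α * (α + β)) / (n * δ) ^ 2 := by field_simp
      _ ≤ _ := by
          have : 0 ≤ n * β / 2 + (c + 1) * n * α := by positivity
          exact div_le_div_of_nonneg_right (by linarith) (by positivity)
  · rw [hCn]
    have h1 := hS k hk.le
    have h2 := hS (k - 1) (by omega)
    have h3 := pow_le_pow_left₀ h1.1 h1.2 2
    have h4 := pow_le_pow_left₀ h2.1 h2.2 2
    calc _ ≤ (n * β / 2) * (1 / (n * δ)) ^ 2 + (c + 1) * n * α * (1 / (n * δ)) ^ 2 := by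
          refine add_le_add (mul_le_mul ?_ h3 (by positivity) (by positivity))
            (mul_le_mul ?_ h4 (by positivity) (by positivity))
          · have : 0 ≤ k * lam := by positivity
            linarith
          · have := hki k hk
            gcongr
      _ = (n * β / 2 + (c + 1) * n * α) / (n * δ) ^ 2 := by field_simp
      _ ≤ _ := by
          have : 0 ≤ (c + 1) * n * α * (α + β) := by positivity
          exact div_le_div_of_nonneg_right (by linarith) (by positivity)

end Subcritical

/-! ### From means and Laplace transforms to convergence in probability. -/

section ConvergenceInProbability

/-- Quantitative strict convexity. For `y ≤ 2`, squaring `exp (-y / 2) ≥ 1 - y / 2 ≥ 0` gives the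
gap `y ^ 2 / 4`; for `y ≥ 2` the linear part alone gives `1`. -/
lemma min_sq_one_le_exp_neg {y ε : ℝ} (hε : 0 ≤ ε) (hy : ε ≤ |y|) :
    min (ε ^ 2 / 4) 1 ≤ Real.exp (-y) - 1 + y := by
  rcases le_total y 2 with h | h
  · refine (min_le_left _ _).trans ?_
    have h1 := Real.add_one_le_exp (-(y / 2))
    have h2 : Real.exp (-y) = Real.exp (-(y / 2)) ^ 2 := by
      rw [← Real.exp_nat_mul]; congr 1; push_cast; ring
    have h3 : (-(y / 2) + 1) ^ 2 ≤ Real.exp (-(y / 2)) ^ 2 := pow_le_pow_left₀ (by linarith) h1 2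
    have h4 : ε ^ 2 ≤ y ^ 2 := by rw [← sq_abs y]; exact pow_le_pow_left₀ hε hy 2
    rw [h2]
    nlinarith
  · refine (min_le_right _ _).trans ?_
    linarith [Real.exp_pos (-y)]

/-- Convergence of the means and of the Laplace transforms at `1` to those of a constant implies
convergence in probability to this constant. -/
lemma tendsto_measure_of_tendsto_laplace {Ω : ℕ → Type u} [∀ n, MeasurableSpace (Ω n)]
    {P : ∀ n, Measure (Ω n)} [∀ n, IsProbabilityMeasure (P n)] {T : ∀ n, Ω n → ℝ≥0∞} {t : ℝ}
    (ht : 0 ≤ t) (hT : ∀ n, AEMeasurable (T n) (P n))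
    (hmean : Tendsto (fun n => ∫⁻ ω, T n ω ∂(P n)) atTop (𝓝 (ENNReal.ofReal t)))
    (hlap : Tendsto (fun n => ∫ ω, Complex.exp (-1 * (T n ω).toReal) ∂(P n)) atTop
      (𝓝 (Real.exp (-t) : ℝ))) {ε : ℝ} (hε : 0 < ε) :
    Tendsto (fun n => P n {ω | T n ω = ∞ ∨ ε ≤ |(T n ω).toReal - t|}) atTop (𝓝 0) := by
  set κ := Real.exp (-t) * min (ε ^ 2 / 4) 1 with hκ
  have hκ0 : 0 < κ := by positivity
  have hm : Tendsto (fun n => (∫⁻ ω, T n ω ∂(P n)).toReal) atTop (𝓝 t) := by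
    have := (ENNReal.tendsto_toReal (by simp)).comp hmean
    rwa [ENNReal.toReal_ofReal ht] at this
  have hl : Tendsto (fun n => (∫ ω, Complex.exp (-1 * (T n ω).toReal) ∂(P n)).re) atTop
      (𝓝 (Real.exp (-t))) := by
    have := (Complex.continuous_re.tendsto _).comp hlap
    rwa [Complex.ofReal_re] at this
  have hb : Tendsto (fun n => ((∫ ω, Complex.exp (-1 * (T n ω).toReal) ∂(P n)).re - Real.exp (-t)
      + Real.exp (-t) * ((∫⁻ ω, T n ω ∂(P n)).toReal - t)) / κ) atTop (𝓝 0) := by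
    have := ((hl.sub_const (Real.exp (-t))).add
      ((hm.sub_const t).const_mul (Real.exp (-t)))).div_const κ
    simpa using this
  have hb' := ENNReal.tendsto_ofReal hb
  rw [ENNReal.ofReal_zero] at hb'
  refine tendsto_of_tendsto_of_tendsto_of_le_of_le' tendsto_const_nhds hb'
    (Eventually.of_forall fun _ => zero_le) ?_
  filter_upwards [hmean.eventually_lt_const ENNReal.ofReal_lt_top] with n hn
  have hfin : ∀ᵐ ω ∂(P n), T n ω < ∞ := ae_lt_top' (hT n) hn.ne
  have hi1 : Integrable (fun ω => (T n ω).toReal) (P n) := integrable_toReal_of_lintegral_ne_top (hT n) hn.ne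
  have hi2c := integrable_cexp_neg_mul (P := P n) (s := 1) (by simp) (hT n)
  have hre : ∀ x : ℝ, (Complex.exp (-1 * x)).re = Real.exp (-x) := fun x => by
    rw [neg_one_mul, ← Complex.ofReal_neg, Complex.exp_ofReal_re]
  have hi2 : Integrable (fun ω => Real.exp (-(T n ω).toReal)) (P n) := by
    have := hi2c.re
    simpa only [RCLike.re_to_complex, hre] using this
  have hlre : (∫ ω, Complex.exp (-1 * (T n ω).toReal) ∂(P n)).re
      = ∫ ω, Real.exp (-(T n ω).toReal) ∂(P n) := by
    have := integral_re hi2c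
    simp only [RCLike.re_to_complex, hre] at this
    exact this.symm
  have hmre : (∫⁻ ω, T n ω ∂(P n)).toReal = ∫ ω, (T n ω).toReal ∂(P n) :=
    (integral_toReal (hT n) hfin).symm
  -- The gap between `exp (-T)` and its tangent at `t`: nonnegative, at least `κ` when `|T - t| ≥
  -- ε`, and of mean tending to `0` by the two hypotheses, so Markov's inequality concludes.
  set ψ : Ω n → ℝ := fun ω => Real.exp (-(T n ω).toReal) - Real.exp (-t)
    + Real.exp (-t) * ((T n ω).toReal - t) with hψ
  have hψeq : ∀ ω, ψ ω = Real.exp (-t) * (Real.exp (-((T n ω).toReal - t)) - 1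
      + ((T n ω).toReal - t)) := fun ω => by
    have : Real.exp (-(T n ω).toReal) = Real.exp (-t) * Real.exp (-((T n ω).toReal - t)) := by
      rw [← Real.exp_add]; congr 1; ring
    rw [hψ]
    simp only
    rw [this]; ring
  have hψ0 : ∀ ω, 0 ≤ ψ ω := fun ω => by
    rw [hψeq]
    refine mul_nonneg (Real.exp_pos _).le ?_
    have := min_sq_one_le_exp_neg (y := (T n ω).toReal - t) le_rfl (abs_nonneg _)
    simpa using this
  have hψint : Integrable ψ (P n) :=
    (hi2.sub (integrable_const _)).add ((hi1.sub (integrable_const _)).const_mul _)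
  have hψval : ∫ ω, ψ ω ∂(P n) = (∫ ω, Complex.exp (-1 * (T n ω).toReal) ∂(P n)).re - Real.exp (-t)
      + Real.exp (-t) * ((∫⁻ ω, T n ω ∂(P n)).toReal - t) := by
    have e1 : ∫ ω, ψ ω ∂(P n) = ∫ ω, (Real.exp (-(T n ω).toReal) - Real.exp (-t)) ∂(P n)
        + ∫ ω, Real.exp (-t) * ((T n ω).toReal - t) ∂(P n) :=
      integral_add (hi2.sub (integrable_const _)) ((hi1.sub (integrable_const _)).const_mul _)
    rw [hlre, hmre, e1, integral_sub hi2 (integrable_const _),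
      integral_const_mul, integral_sub hi1 (integrable_const _)]
    simp
  have hmarkov := mul_meas_ge_le_integral_of_nonneg (Eventually.of_forall hψ0) hψint κ
  rw [hψval] at hmarkov
  calc P n {ω | T n ω = ∞ ∨ ε ≤ |(T n ω).toReal - t|} ≤ P n {ω | κ ≤ ψ ω} := by
        refine measure_mono_ae ?_
        filter_upwards [hfin] with ω hω hmem
        rcases hmem with h | h
        · exact absurd h hω.ne
        · change κ ≤ ψ ω
          rw [hψeq, hκ]
          exact mul_le_mul_of_nonneg_left (min_sq_one_le_exp_neg hε.le h) (Real.exp_pos _).le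
    _ = ENNReal.ofReal ((P n).real {ω | κ ≤ ψ ω}) := (ofReal_measureReal).symm
    _ ≤ _ := by
        refine ENNReal.ofReal_le_ofReal ?_
        rw [le_div_iff₀ hκ0, mul_comm]
        exact hmarkov

end ConvergenceInProbability

/-! ### Convergence below equilibrium. -/

section Subcritical

/-- Convergence of the hitting times in the subcritical regime. -/
theorem subcritical_tendsto {α β c : ℝ} (hα : 0 < α) (hβ : 0 < β) (hc : 0 < c)
    (hcβ : c < β / (2 * α)) (Ω : ℕ → Type u) [∀ n, MeasurableSpace (Ω n)] (P : ∀ n, Measure (Ω n))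
    [∀ n, IsProbabilityMeasure (P n)] (G : ∀ n, ℝ≥0 → Ω n → SimpleGraph (Fin n))
    (hG : ∀ n, IsDynamicERGraph α β (⊥ : SimpleGraph (Fin n)) (P n) (G n)) :
    (∀ ε : ℝ, 0 < ε →
      Tendsto (fun n => P n {ω | hittingTime (G n) (edgeTarget c n) ω = ∞ ∨
        ε ≤ |(hittingTime (G n) (edgeTarget c n) ω).toReal -
          -Real.log (1 - 2 * α / β * c) / α|}) atTop (𝓝 0)) ∧
    Tendsto (fun n => ∫⁻ ω, hittingTime (G n) (edgeTarget c n) ω ∂(P n)) atTop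
      (𝓝 (ENNReal.ofReal (-Real.log (1 - 2 * α / β * c) / α))) := by
  obtain ⟨C, hC, hest⟩ := subcritical_estimates.{u} hα hβ hc hcβ
  have hm := tendsto_subcriticalMean hα hβ hc hcβ
  set t := -Real.log (1 - 2 * α / β * c) / α with ht
  have hCn : Tendsto (fun n : ℕ => C / (n : ℝ)) atTop (𝓝 0) := tendsto_const_div_atTop_nhds_zero_nat C
  have ht0 : 0 ≤ t := by
    have h1 : 0 ≤ 2 * α / β * c := by positivity
    have h2 : 2 * α / β * c < 1 := by
      rw [lt_div_iff₀ (by positivity)] at hcβ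
      rw [div_mul_eq_mul_div, div_lt_one hβ]
      linarith
    have := Real.log_nonpos (x := 1 - 2 * α / β * c) (by linarith) (by linarith)
    exact div_nonneg (by linarith) hα.le
  have hmean : Tendsto (fun n => ∫⁻ ω, hittingTime (G n) (edgeTarget c n) ω ∂(P n)) atTop
      (𝓝 (ENNReal.ofReal t)) := by
    have hlow : Tendsto (fun n : ℕ => ENNReal.ofReal (subcriticalMean α β c n / (1 + C / n))) atTop
        (𝓝 (ENNReal.ofReal t)) := by
      refine ENNReal.tendsto_ofReal ?_
      have := hm.div (tendsto_const_nhds.add hCn) (by norm_num : (1 : ℝ) + 0 ≠ 0)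
      rwa [add_zero, div_one] at this
    refine tendsto_of_tendsto_of_tendsto_of_le_of_le' hlow (ENNReal.tendsto_ofReal hm) ?_ ?_
    · filter_upwards [hest] with n hn using (hn (Ω n) (P n) (G n) (hG n)).1
    · filter_upwards [hest] with n hn using (hn (Ω n) (P n) (G n) (hG n)).2.1
  refine ⟨fun ε hε => tendsto_measure_of_tendsto_laplace ht0
    (fun n => (hG n).aemeasurable_hittingTime _) hmean ?_ hε, hmean⟩
  have h1 : Tendsto (fun n : ℕ => ((Real.exp (-subcriticalMean α β c n) : ℝ) : ℂ)) atTop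
      (𝓝 (Real.exp (-t) : ℝ)) :=
    (Complex.continuous_ofReal.tendsto _).comp ((Real.continuous_exp.tendsto _).comp hm.neg)
  have h2 : Tendsto (fun n : ℕ => 2 * (C / (n : ℝ)) * subcriticalMean α β c n) atTop (𝓝 0) := by
    simpa using (hCn.const_mul 2).mul hm
  have h3 : Tendsto (fun n => ∫ ω, Complex.exp (-1 * (hittingTime (G n) (edgeTarget c n) ω).toReal) ∂(P n)
      - ((Real.exp (-subcriticalMean α β c n) : ℝ) : ℂ)) atTop (𝓝 0) := by
    refine squeeze_zero_norm' ?_ h2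
    filter_upwards [hest] with n hn using (hn (Ω n) (P n) (G n) (hG n)).2.2
  simpa using h3.add h1

end Subcritical

/-! ### Recursion for the mean passage times. -/

section PassageSum

/-- The solution of `R 0 = 1`, `R (k + 1) = 1 + q k * R k`. For a birth-death chain with birth rates
`r` and death rates `d`, and `q k = d (k + 1) / r k`, the mean passage time from `k` to `k + 1` is
`R k / r k`. -/
def passageSum (q : ℕ → ℝ) : ℕ → ℝ
  | 0 => 1
  | k + 1 => 1 + q k * passageSum q k

variable {q : ℕ → ℝ} {i J₀ : ℕ} {ρ : ℝ}

lemma one_le_passageSum (hq : ∀ k, k + 1 < i → 0 ≤ q k) {k : ℕ} (hk : k < i) :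
    1 ≤ passageSum q k := by
  induction k with
  | zero => exact le_rfl
  | succ k ih =>
    have := mul_nonneg (hq k hk) (zero_le_one.trans (ih (by omega)))
    simp only [passageSum]
    linarith

lemma passageSum_le_succ (hq : ∀ k, k + 1 < i → 0 ≤ q k)
    (hmono : ∀ k, k + 2 < i → q k ≤ q (k + 1)) {k : ℕ} (hk : k + 1 < i) :
    passageSum q k ≤ passageSum q (k + 1) := by
  induction k with
  | zero => simpa [passageSum] using hq 0 hk
  | succ k ih =>
    have h1 := ih (by omega)
    have h2 := one_le_passageSum hq (show k < i by omega)
    have h3 : q k * passageSum q k ≤ q (k + 1) * passageSum q (k + 1) :=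
      mul_le_mul (hmono k hk) h1 (by linarith) (hq _ hk)
    calc passageSum q (k + 1) = 1 + q k * passageSum q k := rfl
      _ ≤ 1 + q (k + 1) * passageSum q (k + 1) := by linarith
      _ = passageSum q (k + 1 + 1) := rfl

lemma passageSum_mono (hq : ∀ k, k + 1 < i → 0 ≤ q k)
    (hmono : ∀ k, k + 2 < i → q k ≤ q (k + 1)) {k l : ℕ} (hkl : k ≤ l) (hl : l < i) :
    passageSum q k ≤ passageSum q l := by
  induction l, hkl using Nat.le_induction with
  | base => exact le_rfl
  | succ l _ ih => exact (ih (by omega)).trans (passageSum_le_succ hq hmono hl)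

lemma pow_mul_passageSum_le (hq : ∀ k, k + 1 < i → 0 ≤ q k) (hρ : 1 < ρ)
    (hqρ : ∀ k, J₀ ≤ k → k + 1 < i → ρ ≤ q k) {k l : ℕ} (hk : J₀ ≤ k) (hkl : k ≤ l) (hl : l < i) :
    ρ ^ (l - k) * passageSum q k ≤ passageSum q l := by
  induction l, hkl using Nat.le_induction with
  | base => simp
  | succ l hkl ih =>
    have h1 := ih (by omega)
    have h2 := one_le_passageSum hq (show l < i by omega)
    have h3 := mul_le_mul_of_nonneg_right (hqρ l (hk.trans hkl) hl) (zero_le_one.trans h2)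
    rw [Nat.succ_sub hkl, pow_succ']
    simp only [passageSum]
    nlinarith

/-- Crude linear growth: a ratio at least `1` adds at least `1` at each step. It suffices to make `1
/ passageSum q J` small. -/
lemma sub_le_passageSum (hq : ∀ k, k + 1 < i → 0 ≤ q k) (hρ : 1 < ρ)
    (hqρ : ∀ k, J₀ ≤ k → k + 1 < i → ρ ≤ q k) {l : ℕ} (hl0 : J₀ ≤ l) (hl : l < i) :
    (l : ℝ) - J₀ ≤ passageSum q l := by
  induction l, hl0 using Nat.le_induction with
  | base => linarith [one_le_passageSum hq hl]
  | succ l hkl ih =>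
    have h1 := ih (by omega)
    have h2 := one_le_passageSum hq (show l < i by omega)
    have h3 := hqρ l hkl hl
    have h4 := mul_le_mul_of_nonneg_right h3 (zero_le_one.trans h2)
    simp only [passageSum]
    push_cast
    nlinarith

end PassageSum

/-! ### Exact mean and approximate characteristic function. -/

section Passage

/-- The mean time to reach `i` from `k` for a birth-death chain with birth rates `r`, in terms of
the ratios `q` of death to birth rates. -/
noncomputable def meanPassage (q r : ℕ → ℝ) (i k : ℕ) : ℝ :=
  ∑ l ∈ Finset.Ico k i, passageSum q l / r l

variable {α β : ℝ} {n i J₀ J : ℕ} {r q : ℕ → ℝ} {ρ : ℝ}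

lemma meanPassage_nonneg (hr : ∀ k < i, 0 < r k) (hq : ∀ k, k + 1 < i → 0 ≤ q k) (k : ℕ) :
    0 ≤ meanPassage q r i k :=
  Finset.sum_nonneg fun l hl =>
    have hl := (Finset.mem_Ico.1 hl).2
    div_nonneg (zero_le_one.trans (one_le_passageSum hq hl)) (hr l hl).le

/-- Multiplying the increments by the rates turns the generator into `-(R k - q (k - 1) * R (k -
1))`, which the recursion makes `-1`. -/
lemma countGen_meanPassage {lam : ℝ}
    (hr : ∀ k < i, 0 < r k) (hN : ∀ k < i, (((n.choose 2 : ℕ) : ℝ) - k) * lam = r k)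
    (hq : ∀ k, k + 1 < i → q k = (k + 1) * α / r k) {k : ℕ} (hk : k < i) :
    countGen (n.choose 2) lam α (meanPassage q r i) k = -1 := by
  unfold meanPassage
  rw [countGen_sum_Ico _ _ _ hk, hN k hk, mul_div_cancel₀ _ (hr k hk).ne']
  rcases k with _ | k
  · simp [passageSum]
  · have := (hr k (by omega)).ne'
    simp only [passageSum, hq k hk, Nat.add_sub_cancel]
    push_cast
    field_simp
    ring

lemma meanPassage_zero_pos (hi : 0 < i) (hr : ∀ k < i, 0 < r k)
    (hq : ∀ k, k + 1 < i → 0 ≤ q k) : 0 < meanPassage q r i 0 :=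
  Finset.sum_pos (fun l hl =>
    have hl := (Finset.mem_Ico.1 hl).2
    div_pos (zero_lt_one.trans_le (one_le_passageSum hq hl)) (hr l hl)) (by simpa using hi.ne')

lemma meanPassage_zero_eq_add (hJ : J ≤ i) :
    meanPassage q r i 0 = meanPassage q r J 0 + meanPassage q r i J :=
  (Finset.sum_Ico_consecutive _ (Nat.zero_le _) hJ).symm

/-- The mean time spent above `J` before reaching `i` is negligible. -/
noncomputable def excessPassage (q r : ℕ → ℝ) (ρ : ℝ) (i J k : ℕ) : ℝ :=
  ∑ l ∈ Finset.Ico k i, if l < J then 0 else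
    ((ρ - 1)⁻¹ / passageSum q J * passageSum q l - (ρ - 1)⁻¹) / r l

lemma excessPassage_term_bounds (hρ : 1 < ρ) (hr : ∀ k < i, 0 < r k)
    (hq : ∀ k, k + 1 < i → 0 ≤ q k) (hmono : ∀ k, k + 2 < i → q k ≤ q (k + 1)) {l : ℕ}
    (hJ : J < i) (hl : l < i) :
    0 ≤ (if l < J then 0 else
      ((ρ - 1)⁻¹ / passageSum q J * passageSum q l - (ρ - 1)⁻¹) / r l) ∧
    (if l < J then 0 else
      ((ρ - 1)⁻¹ / passageSum q J * passageSum q l - (ρ - 1)⁻¹) / r l)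
      ≤ (ρ - 1)⁻¹ / passageSum q J * (passageSum q l / r l) := by
  have hρ' : 0 < (ρ - 1)⁻¹ := inv_pos.2 (by linarith)
  have hRJ := one_le_passageSum hq hJ
  have hRl := one_le_passageSum hq hl
  have hrl := hr l hl
  have hRJ0 : 0 < passageSum q J := by linarith
  split_ifs with h
  · exact ⟨le_rfl, by positivity⟩
  · have h1 := passageSum_mono hq hmono (not_lt.1 h) hl
    constructor
    · refine div_nonneg ?_ hrl.le
      rw [sub_nonneg, div_mul_eq_mul_div, le_div_iff₀ hRJ0]
      exact mul_le_mul_of_nonneg_left h1 hρ'.le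
    · rw [← mul_div_assoc]
      exact div_le_div_of_nonneg_right (by linarith) hrl.le

lemma excessPassage_nonneg (hρ : 1 < ρ) (hr : ∀ k < i, 0 < r k)
    (hq : ∀ k, k + 1 < i → 0 ≤ q k) (hmono : ∀ k, k + 2 < i → q k ≤ q (k + 1))
    (hJ : J < i) (k : ℕ) : 0 ≤ excessPassage q r ρ i J k :=
  Finset.sum_nonneg fun _ hl =>
    (excessPassage_term_bounds hρ hr hq hmono hJ (Finset.mem_Ico.1 hl).2).1

lemma excessPassage_le (hρ : 1 < ρ) (hr : ∀ k < i, 0 < r k)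
    (hq : ∀ k, k + 1 < i → 0 ≤ q k) (hmono : ∀ k, k + 2 < i → q k ≤ q (k + 1))
    (hJ : J < i) (k : ℕ) :
    excessPassage q r ρ i J k ≤ (ρ - 1)⁻¹ / passageSum q J * meanPassage q r i k := by
  rw [meanPassage, Finset.mul_sum]
  exact Finset.sum_le_sum fun _ hl =>
    (excessPassage_term_bounds hρ hr hq hmono hJ (Finset.mem_Ico.1 hl).2).2

/-- Write `a' = (ρ - 1)⁻¹` and `a = a' / R J`. The increments `(a * R l - a') / r l` vanish at `l =
J`, so switching them on there creates no drift at `J`. At `k + 1 > J` the recursion gives the drift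
`-(a + a' * (q k - 1))`, which is at most `-1` because `q k ≥ ρ`. The subtracted constant is what
allows the small prefactor `a`. -/
lemma countGen_excessPassage_le {lam : ℝ} (hρ : 1 < ρ)
    (hr : ∀ k < i, 0 < r k) (hN : ∀ k < i, (((n.choose 2 : ℕ) : ℝ) - k) * lam = r k)
    (hq0 : ∀ k, k + 1 < i → 0 ≤ q k)
    (hq : ∀ k, k + 1 < i → q k = (k + 1) * α / r k)
    (hqρ : ∀ k, J₀ ≤ k → k + 1 < i → ρ ≤ q k) (hJ₀ : J₀ ≤ J) (hJ1 : J < i) {k : ℕ} (hk : k < i) :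
    countGen (n.choose 2) lam α (excessPassage q r ρ i J) k ≤ -(if J < k then 1 else 0) := by
  unfold excessPassage
  rw [countGen_sum_Ico _ _ _ hk, hN k hk, neg_le_neg_iff]
  have hRJ := one_le_passageSum hq0 hJ1
  have hRJ0 : passageSum q J ≠ 0 := by linarith
  have hρ0 : ρ - 1 ≠ 0 := by linarith
  rcases lt_trichotomy k J with h | rfl | h
  · rw [if_neg (by omega), if_pos h, if_pos (by omega)]
    simp
  · rw [if_neg (lt_irrefl _), if_neg (lt_irrefl _), div_mul_cancel₀ _ hRJ0, sub_self, zero_div,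
      mul_zero, zero_sub]
    rcases k with _ | k
    · simp
    · rw [if_pos (by simp)]
      simp
  · obtain ⟨k, rfl⟩ := Nat.exists_eq_succ_of_ne_zero (by omega : k ≠ 0)
    rw [if_pos h, if_neg (by omega), if_neg (by simp; omega)]
    have h1 := hqρ k (by omega) hk
    have h2 := hr k (by omega)
    have h3 : ((k + 1 : ℕ) : ℝ) * α = q k * r k := by
      rw [hq k hk, div_mul_cancel₀ _ h2.ne']; push_cast; ring
    simp only [Nat.succ_eq_add_one, Nat.add_sub_cancel, h3]
    rw [mul_div_cancel₀ _ (hr _ hk).ne', mul_assoc, mul_div_cancel₀ _ h2.ne']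
    simp only [passageSum]
    have h4 : 1 ≤ (ρ - 1)⁻¹ * (q k - 1) := by
      refine (inv_mul_cancel₀ hρ0).symm.le.trans ?_
      exact mul_le_mul_of_nonneg_left (by linarith) (inv_nonneg.2 (by linarith))
    have h5 : 0 ≤ (ρ - 1)⁻¹ / passageSum q J :=
      div_nonneg (inv_nonneg.2 (by linarith)) (by linarith)
    nlinarith

variable {Ω : Type*} [MeasurableSpace Ω] {P : Measure Ω} [IsProbabilityMeasure P]
    {G : ℝ≥0 → Ω → SimpleGraph (Fin n)}

/-- The mean hitting time from the empty graph. -/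
lemma IsDynamicERGraph.lintegral_hittingTime_eq
    (hG : IsDynamicERGraph α β (⊥ : SimpleGraph (Fin n)) P G) (hα : 0 < α) (hi : 0 < i)
    (hr : ∀ k < i, 0 < r k)
    (hN : ∀ k < i, (((n.choose 2 : ℕ) : ℝ) - k) * (β / ((n : ℝ) - 1)) = r k)
    (hq : ∀ k, k + 1 < i → q k = (k + 1) * α / r k) :
    ∫⁻ ω, hittingTime G i ω ∂P = ENNReal.ofReal (meanPassage q r i 0) := by
  have h0 : numEdges (⊥ : SimpleGraph (Fin n)) < i := by rwa [numEdges_bot]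
  have hq0 : ∀ k, k + 1 < i → 0 ≤ q k := fun k hk => by
    rw [hq k hk]; have := hr k (by omega); positivity
  have hgen := fun k (hk : k < i) => countGen_meanPassage hr hN hq hk
  refine le_antisymm ?_ ?_
  · have := hG.lintegral_hittingTime_le_of_lt (F := meanPassage q r i) hα h0
      (fun k _ => meanPassage_nonneg hr hq0 k) (fun k hk => (hgen k hk).le)
    rwa [numEdges_bot] at this
  · have := hG.le_lintegral_hittingTime_of_lt (F := meanPassage q r i) hα h0
      (by simp [meanPassage]) (fun k hk => (hgen k hk).ge)
      (fun k _ => meanPassage_nonneg hr hq0 k) (fun k hk => (hgen k hk).le)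
    rwa [numEdges_bot] at this

/-- The characteristic function of the normalized hitting time is close to that of the exponential
distribution. -/
lemma IsDynamicERGraph.norm_charFun_sub_le
    (hG : IsDynamicERGraph α β (⊥ : SimpleGraph (Fin n)) P G) (hα : 0 < α) (hρ : 1 < ρ)
    (hr : ∀ k < i, 0 < r k)
    (hN : ∀ k < i, (((n.choose 2 : ℕ) : ℝ) - k) * (β / ((n : ℝ) - 1)) = r k)
    (hq : ∀ k, k + 1 < i → q k = (k + 1) * α / r k)
    (hmono : ∀ k, k + 2 < i → q k ≤ q (k + 1))
    (hqρ : ∀ k, J₀ ≤ k → k + 1 < i → ρ ≤ q k) (hJ₀ : J₀ ≤ J) (hJ1 : J < i) (θ : ℝ) :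
    ‖∫ ω, Complex.exp ((θ / meanPassage q r i 0 : ℝ) * Complex.I * (hittingTime G i ω).toReal) ∂P
      - (1 - θ * Complex.I)⁻¹‖
      ≤ θ ^ 2 * (meanPassage q r J 0 / meanPassage q r i 0 + (ρ - 1)⁻¹ / passageSum q J) := by
  have hi : 0 < i := by omega
  have h0 : numEdges (⊥ : SimpleGraph (Fin n)) < i := by rwa [numEdges_bot]
  have hq0 : ∀ k, k + 1 < i → 0 ≤ q k := fun k hk => by
    rw [hq k hk]; have := hr k (by omega); positivity
  have hgen := fun k (hk : k < i) => countGen_meanPassage hr hN hq hk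
  set m := meanPassage q r i 0 with hm
  have hm0 : 0 < m := meanPassage_zero_pos hi hr hq0
  have hF := meanPassage_nonneg (i := i) hr hq0
  have hF' : ∀ k ≤ i, 0 ≤ meanPassage q r k 0 := fun k hk =>
    meanPassage_nonneg (fun l hl => hr l (by omega)) (fun l hl => hq0 l (by omega)) 0
  have hE := excessPassage_nonneg (J := J) hρ hr hq0 hmono hJ1
  set z : ℂ := -(θ * Complex.I) with hz
  have hz1 : 1 ≤ ‖1 + z‖ := by
    have := Complex.abs_re_le_norm (1 + z)
    simpa [hz] using this
  have hz1' : 1 + z ≠ 0 := fun h => by rw [h, norm_zero] at hz1; linarith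
  have hznorm : ‖z‖ = |θ| := by simp [hz]
  have hmC : (m : ℂ) ≠ 0 := by exact_mod_cast hm0.ne'
  -- With `F` the mean time to `i`, `u` is affine in `F` and equals `1 / (1 + z)` at `0`. As `L F =
  -- -1`, its residual is `z ^ 2 / (m ^ 2 * (1 + z)) * (m - F k)`, where `m - F k` is the mean time
  -- from `0` to `k`. Up to level `J` this is at most the mean time to `J`, paid by the first part
  -- of `w`; above `J` it is at most `m`, paid by `excessPassage`.
  have key := hG.norm_laplace_hittingTime_sub_le_of_lt (s := z / m) (i := i)
    (u := fun k => 1 - z / (1 + z) * (meanPassage q r i k / m : ℝ))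
    (w := fun k => θ ^ 2 / m ^ 2 * (meanPassage q r J 0 * meanPassage q r i k
      + m * excessPassage q r ρ i J k)) (F := meanPassage q r i) hα h0
    (by rw [hz]; simp [Complex.div_re]) (by simp [meanPassage])
    (fun k _ => mul_nonneg (by positivity) (add_nonneg (mul_nonneg (hF' J hJ1.le) (hF k))
      (mul_nonneg hm0.le (hE k)))) (fun k _ => hF k) (fun k hk => (hgen k hk).le)
    (fun k hk => by
      have e1 : countGen (n.choose 2) (β / ((n : ℝ) - 1)) α
          (fun k => (1 : ℂ) - z / (1 + z) * (meanPassage q r i k / m : ℝ)) k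
          = -(z / (1 + z) / m) * (countGen (n.choose 2) (β / ((n : ℝ) - 1)) α
            (meanPassage q r i) k : ℝ) := by
        simp only [countGen, smul_eq_mul, Complex.real_smul]
        push_cast
        ring
      have e2 : countGen (n.choose 2) (β / ((n : ℝ) - 1)) α
          (fun k => θ ^ 2 / m ^ 2 * (meanPassage q r J 0 * meanPassage q r i k
            + m * excessPassage q r ρ i J k)) k
          = θ ^ 2 / m ^ 2 * (meanPassage q r J 0 * countGen (n.choose 2) (β / ((n : ℝ) - 1)) α
            (meanPassage q r i) k + m * countGen (n.choose 2) (β / ((n : ℝ) - 1)) α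
            (excessPassage q r ρ i J) k) := by
        simp only [countGen, smul_eq_mul]
        ring
      have e3 := countGen_excessPassage_le hρ hr hN hq0 hq hqρ hJ₀ hJ1 hk
      have e4 : z / m * (1 - z / (1 + z) * (meanPassage q r i k / m : ℝ))
          - -(z / (1 + z) / m) * ((-1 : ℝ) : ℂ)
          = z ^ 2 / (m ^ 2 * (1 + z)) * (m - meanPassage q r i k : ℝ) := by
        push_cast
        field_simp
        ring
      have e5 : m - meanPassage q r i k = meanPassage q r k 0 := by
        rw [hm, meanPassage_zero_eq_add hk.le]; ring
      rw [e1, e2, hgen k hk, e4, e5, norm_mul, norm_div, norm_pow, hznorm, sq_abs, norm_mul,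
        norm_pow, Complex.norm_real, Complex.norm_real, Real.norm_of_nonneg hm0.le,
        Real.norm_of_nonneg (hF' k hk.le), ← mul_neg]
      refine mul_le_mul ?_ ?_ (hF' k hk.le) (by positivity)
      · exact div_le_div_of_nonneg_left (by positivity) (by positivity)
          (le_mul_of_one_le_right (by positivity) hz1)
      · split_ifs at e3 with h
        · have h1 : meanPassage q r k 0 ≤ m := by rw [← e5]; linarith [hF k]
          have h2 := hF' J hJ1.le
          nlinarith
        · have h1 : meanPassage q r k 0 ≤ meanPassage q r J 0 := by
            rw [meanPassage_zero_eq_add (i := J) (J := k) (by omega)]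
            linarith [meanPassage_nonneg (i := J) (fun l hl => hr l (by omega))
              (fun l hl => hq0 l (by omega)) k]
          nlinarith)
  rw [numEdges_bot] at key
  have hu0 : (1 : ℂ) - z / (1 + z) * (meanPassage q r i 0 / m : ℝ) = (1 - θ * Complex.I)⁻¹ := by
    rw [← hm, div_self hm0.ne', Complex.ofReal_one, mul_one]
    have : (1 : ℂ) - θ * Complex.I = 1 + z := by rw [hz]; ring
    rw [this]
    field_simp
    ring
  have hs : ∀ x : ℝ, -(z / m) * x = (θ / m : ℝ) * Complex.I * x := fun x => by
    rw [hz]; push_cast; ring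
  rw [hu0] at key
  simp only [hs] at key
  refine key.trans ?_
  rw [← hm]
  have hEle := excessPassage_le (J := J) hρ hr hq0 hmono hJ1 0
  rw [← hm] at hEle
  calc _ ≤ θ ^ 2 / m ^ 2 * (meanPassage q r J 0 * m + m * ((ρ - 1)⁻¹ / passageSum q J * m)) := by
        gcongr
    _ = _ := by field_simp

end Passage

/-! ### Rates above equilibrium and negligible contributions. -/

section Supercritical

/-- Rate of appearance of an edge in a graph with `k` edges. -/
noncomputable def edgeBirth (β : ℝ) (n k : ℕ) : ℝ := n * β / 2 - k * (β / ((n : ℝ) - 1))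

/-- Rate of disappearance of an edge in a graph with `k + 1` edges, divided by the rate of
appearance of an edge in a graph with `k` edges. -/
noncomputable def edgeRatio (α β : ℝ) (n k : ℕ) : ℝ := (k + 1) * α / edgeBirth β n k

/-- For large `n`, the properties of the rates below the level `edgeTarget c n`. -/
lemma eventually_supercritical_rates {α β c : ℝ} (hα : 0 < α) (hβ : 0 < β)
    (hcβ : β / (2 * α) < c) :
    ∃ ρ : ℝ, 1 < ρ ∧ ∃ J₀ J : ℕ → ℕ, ∃ δ : ℝ, 0 < δ ∧ ∀ᶠ n : ℕ in atTop,
      (∀ k < edgeTarget c n, (((n.choose 2 : ℕ) : ℝ) - k) * (β / ((n : ℝ) - 1)) = edgeBirth β n k) ∧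
      (∀ k < edgeTarget c n, n * β / 4 ≤ edgeBirth β n k ∧ edgeBirth β n k ≤ n * β / 2) ∧
      (∀ k, k + 2 < edgeTarget c n → edgeRatio α β n k ≤ edgeRatio α β n (k + 1)) ∧
      (∀ k, J₀ n ≤ k → k + 1 < edgeTarget c n → ρ ≤ edgeRatio α β n k) ∧
      J₀ n ≤ J n ∧ J n < edgeTarget c n ∧ δ * n ≤ (J n : ℝ) - J₀ n ∧
      δ * n ≤ ((edgeTarget c n - 1 - J n : ℕ) : ℝ) ∧ (J n : ℝ) ≤ (c + 1) * n := by
  set b := β / (2 * α) with hb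
  have hb0 : 0 < b := by positivity
  have hc0 : 0 < c := hb0.trans hcβ
  have hbα : b * α * 2 = β := by rw [hb]; field_simp
  -- `b₁` and `b₂` cut the interval from `b` to `c` into thirds; `δ` is half a third, the other half
  -- being left for rounding. At levels above `b₁ n` the ratio of death to birth rate is at least
  -- `b₁ / b > 1`.
  set b₁ := (2 * b + c) / 3 with hb₁
  set b₂ := (b + 2 * c) / 3 with hb₂
  set δ := (c - b) / 6 with hδ
  have hδ0 : 0 < δ := by rw [hδ]; linarith
  have hρ : 1 < b₁ / b := by rw [one_lt_div hb0, hb₁]; linarith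
  refine ⟨b₁ / b, hρ, fun n => ⌈b₁ * n⌉₊, fun n => ⌈b₂ * n⌉₊, δ, hδ0, ?_⟩
  -- `8 * c + 2 ≤ n` keeps the birth rates above half of `n β / 2`. The `5 / 2` sums the losses in
  -- `i - 1 - J`: one half from rounding, one from the ceiling and one from the shift.
  filter_upwards [eventually_ge_atTop 2, eventually_ge_atTop ⌈8 * c + 2⌉₊,
    eventually_ge_atTop ⌈(5 / 2) / δ⌉₊] with n hn2 hnc hnδ
  have hnc : 8 * c + 2 ≤ n := Nat.ceil_le.1 hnc
  have hnδ : 5 / 2 ≤ n * δ := by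
    have := Nat.ceil_le.1 hnδ
    rwa [div_le_iff₀ hδ0] at this
  have hn2' : (2 : ℝ) ≤ n := by exact_mod_cast hn2
  have hn0 : (0 : ℝ) < n := by linarith
  have hn1 : 0 < (n : ℝ) - 1 := by linarith
  obtain ⟨hi1, hi2⟩ := edgeTarget_bounds hc0.le n
  set i := edgeTarget c n
  set lam := β / ((n : ℝ) - 1) with hlam
  have hlam0 : 0 < lam := by positivity
  have hlamn : lam * (n - 1) = β := by rw [hlam]; field_simp
  have hilam : i * lam ≤ n * β / 4 := by
    have h1 : (i : ℝ) ≤ (2 * c + 1 / 2) * (n - 1) := by nlinarith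
    calc (i : ℝ) * lam ≤ (2 * c + 1 / 2) * (n - 1) * lam := by gcongr
      _ = (2 * c + 1 / 2) * β := by rw [mul_assoc, mul_comm _ lam, hlamn]
      _ ≤ n / 4 * β := by gcongr; linarith
      _ = _ := by ring
  have hbirth : ∀ k < i, n * β / 4 ≤ edgeBirth β n k ∧ edgeBirth β n k ≤ n * β / 2 := by
    intro k hk
    have h1 : k * lam ≤ i * lam := by gcongr
    have h2 : 0 ≤ k * lam := by positivity
    unfold edgeBirth
    rw [← hlam]
    constructor <;> linarith
  have hbirth0 : ∀ k < i, 0 < edgeBirth β n k := fun k hk =>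
    lt_of_lt_of_le (by positivity) (hbirth k hk).1
  have hceil₁ : (⌈b₁ * n⌉₊ : ℝ) < b₁ * n + 1 := Nat.ceil_lt_add_one (by positivity)
  have hceil₂ : (⌈b₂ * n⌉₊ : ℝ) < b₂ * n + 1 := Nat.ceil_lt_add_one (by positivity)
  have hceil₁' : b₁ * n ≤ ⌈b₁ * n⌉₊ := Nat.le_ceil _
  have hceil₂' : b₂ * n ≤ ⌈b₂ * n⌉₊ := Nat.le_ceil _
  have hd₁ : b₂ * n - b₁ * n = 2 * (n * δ) := by rw [hb₁, hb₂, hδ]; ring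
  have hd₂ : c * n - b₂ * n = 2 * (n * δ) := by rw [hb₂, hδ]; ring
  have hJi : ⌈b₂ * n⌉₊ < i := by
    have : (⌈b₂ * n⌉₊ : ℝ) < i := by linarith
    exact_mod_cast this
  refine ⟨fun k _ => birthRate_eq hn2 β k, hbirth, fun k hk => ?_, fun k hJk hk => ?_, ?_, hJi, ?_,
    ?_, ?_⟩
  · unfold edgeRatio
    refine div_le_div₀ (by positivity) ?_ (hbirth0 _ (by omega)) ?_
    · push_cast; gcongr; linarith
    · unfold edgeBirth
      push_cast
      gcongr
      linarith
  · have h1 : b₁ * n ≤ k := hceil₁'.trans (by exact_mod_cast hJk)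
    unfold edgeRatio
    rw [le_div_iff₀ (hbirth0 k (by omega))]
    calc b₁ / b * edgeBirth β n k ≤ b₁ / b * (n * β / 2) :=
          mul_le_mul_of_nonneg_left (hbirth k (by omega)).2 (by positivity)
      _ = b₁ * n * α := by rw [← hbα]; field_simp
      _ ≤ (k + 1) * α := by gcongr; linarith
  · exact Nat.ceil_mono (by linarith [mul_pos hn0 hδ0])
  · linarith
  · rw [Nat.sub_sub, Nat.cast_sub (by omega)]
    push_cast
    linarith
  · have : b₂ ≤ c := by rw [hb₂]; linarith
    nlinarith

/-- Reaching `J` costs at most `J` terms of size `R J / A`, whereas the last term of the full sum is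
already at least `ρ ^ (i - 1 - J) * R J / (2 * A)`. -/
lemma meanPassage_div_le {q r : ℕ → ℝ} {i J₀ J : ℕ} {ρ A : ℝ} (hA : 0 < A)
    (hr : ∀ k < i, A ≤ r k ∧ r k ≤ 2 * A) (hq : ∀ k, k + 1 < i → 0 ≤ q k)
    (hmono : ∀ k, k + 2 < i → q k ≤ q (k + 1)) (hρ : 1 < ρ)
    (hqρ : ∀ k, J₀ ≤ k → k + 1 < i → ρ ≤ q k) (hJ₀ : J₀ ≤ J) (hJ : J < i) :
    meanPassage q r J 0 / meanPassage q r i 0 ≤ 2 * J * (1 / ρ) ^ (i - 1 - J) := by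
  have hr0 : ∀ k < i, 0 < r k := fun k hk => hA.trans_le (hr k hk).1
  have hRJ := one_le_passageSum hq hJ
  have h1 : meanPassage q r J 0 ≤ J * (passageSum q J / A) := by
    have := Finset.sum_le_card_nsmul (Finset.Ico 0 J) (fun l => passageSum q l / r l)
      (passageSum q J / A) (fun l hl => by
        have hl := (Finset.mem_Ico.1 hl).2
        exact div_le_div₀ (by linarith) (passageSum_mono hq hmono hl.le hJ) hA (hr l (by omega)).1)
    simpa [meanPassage] using this
  have h2 : ρ ^ (i - 1 - J) * passageSum q J / (2 * A) ≤ meanPassage q r i 0 := by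
    have h3 := pow_mul_passageSum_le hq hρ hqρ hJ₀ (show J ≤ i - 1 by omega) (by omega)
    have h4 : passageSum q (i - 1) / r (i - 1) ≤ meanPassage q r i 0 :=
      Finset.single_le_sum (f := fun l => passageSum q l / r l) (fun l hl => by
        have hl := (Finset.mem_Ico.1 hl).2
        exact div_nonneg (zero_le_one.trans (one_le_passageSum hq hl)) (hr0 l hl).le)
        (Finset.mem_Ico.2 ⟨Nat.zero_le _, by omega⟩)
    refine le_trans ?_ h4
    refine div_le_div₀ ?_ h3 (hr0 _ (by omega)) (hr _ (by omega)).2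
    exact zero_le_one.trans (one_le_passageSum hq (by omega))
  have hm : 0 < meanPassage q r i 0 := meanPassage_zero_pos (by omega) hr0 hq
  rw [div_le_iff₀ hm]
  refine h1.trans ?_
  refine le_trans (le_of_eq ?_) (mul_le_mul_of_nonneg_left h2 (by positivity))
  rw [one_div, inv_pow]
  field_simp

lemma tendsto_mul_pow_zero {ρ δ C : ℝ} (hρ : 1 < ρ) (hδ : 0 < δ) (hC : 0 ≤ C) {J d : ℕ → ℕ}
    (hd : ∀ᶠ n : ℕ in atTop, δ * n ≤ d n) (hJ : ∀ᶠ n : ℕ in atTop, (J n : ℝ) ≤ C * n) :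
    Tendsto (fun n => 2 * (J n : ℝ) * (1 / ρ) ^ d n) atTop (𝓝 0) := by
  have hdtop : Tendsto d atTop atTop := by
    rw [← tendsto_natCast_atTop_iff (R := ℝ)]
    exact tendsto_atTop_mono' _ hd (tendsto_natCast_atTop_atTop.const_mul_atTop hδ)
  have h1 := (tendsto_self_mul_const_pow_of_lt_one (r := 1 / ρ) (by positivity)
    (by rw [div_lt_one] <;> linarith)).comp hdtop
  have h2 := h1.const_mul (2 * (C / δ))
  rw [mul_zero] at h2
  refine squeeze_zero' (Eventually.of_forall fun n => by positivity) ?_ h2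
  filter_upwards [hd, hJ] with n hn1 hn2
  have h3 : (J n : ℝ) ≤ C / δ * d n := by
    refine hn2.trans ?_
    rw [div_mul_eq_mul_div, le_div_iff₀ hδ, mul_assoc, mul_comm (n : ℝ)]
    gcongr
  calc 2 * (J n : ℝ) * (1 / ρ) ^ d n ≤ 2 * (C / δ * d n) * (1 / ρ) ^ d n := by gcongr
    _ = 2 * (C / δ) * (d n * (1 / ρ) ^ d n) := by ring

end Supercritical

/-! ### Exponential limit law through characteristic functions. -/

section ExponentialLimit

lemma charFun_expMeasure_one (t : ℝ) : charFun (expMeasure 1) t = (1 - t * Complex.I)⁻¹ := by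
  have hmeas : Measurable (exponentialPDF 1) :=
    (measurable_exponentialPDFReal 1).ennreal_ofReal
  rw [charFun_apply_real, expMeasure, gammaMeasure,
    show gammaPDF 1 1 = exponentialPDF 1 from rfl,
    integral_withDensity_eq_integral_toReal_smul hmeas
      (Eventually.of_forall fun x => ENNReal.ofReal_lt_top)]
  have h1 : ∀ x : ℝ, (exponentialPDF 1 x).toReal • Complex.exp (t * x * Complex.I)
      = (Set.Ici (0 : ℝ)).indicator (fun x : ℝ => Complex.exp ((-1 + t * Complex.I) * x)) x := by
    intro x
    by_cases hx : 0 ≤ x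
    · rw [Set.indicator_of_mem (Set.mem_Ici.2 hx), exponentialPDF_of_nonneg hx,
        ENNReal.toReal_ofReal (by positivity), Complex.real_smul, one_mul, one_mul,
        Complex.ofReal_exp, ← Complex.exp_add]
      congr 1
      push_cast
      ring
    · rw [Set.indicator_of_notMem (by simpa using hx), exponentialPDF_of_neg (not_le.1 hx)]
      simp
  simp only [h1]
  rw [integral_indicator measurableSet_Ici, integral_Ici_eq_integral_Ioi,
    integral_exp_mul_complex_Ioi (by simp)]
  simp only [Complex.ofReal_zero, mul_zero, Complex.exp_zero]
  rw [show (1 : ℂ) - t * Complex.I = -(-1 + t * Complex.I) by ring, inv_neg, neg_div, one_div]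

/-- Convergence in distribution of the normalized hitting times in the supercritical regime. -/
theorem supercritical_tendstoInDistribution {α β c : ℝ} (hα : 0 < α) (hβ : 0 < β)
    (hcβ : β / (2 * α) < c) (Ω : ℕ → Type u) [∀ n, MeasurableSpace (Ω n)] (P : ∀ n, Measure (Ω n))
    [∀ n, IsProbabilityMeasure (P n)] (G : ∀ n, ℝ≥0 → Ω n → SimpleGraph (Fin n))
    (hG : ∀ n, IsDynamicERGraph α β (⊥ : SimpleGraph (Fin n)) (P n) (G n)) :
    TendstoInDistribution
      (fun n ω => (hittingTime (G n) (edgeTarget c n) ω).toReal /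
        (∫⁻ ω', hittingTime (G n) (edgeTarget c n) ω' ∂(P n)).toReal)
      atTop (id : ℝ → ℝ) P (expMeasure 1) where
  forall_aemeasurable n := ((hG n).aemeasurable_hittingTime _).ennreal_toReal.div_const _
  tendsto := by
    have hc0 : 0 < c := lt_trans (by positivity) hcβ
    refine ProbabilityMeasure.tendsto_iff_tendsto_charFun.2 fun θ => ?_
    simp only [ProbabilityMeasure.coe_mk, Measure.map_id, charFun_expMeasure_one]
    obtain ⟨ρ, hρ, J₀, J, δ, hδ, hrates⟩ := eventually_supercritical_rates hα hβ hcβ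
    have herr1 := tendsto_mul_pow_zero (J := J) (d := fun n => edgeTarget c n - 1 - J n) hρ hδ
      (by positivity : 0 ≤ c + 1) (hrates.mono fun n h => h.2.2.2.2.2.2.2.1)
      (hrates.mono fun n h => h.2.2.2.2.2.2.2.2)
    have herr2 : Tendsto (fun n : ℕ => (ρ - 1)⁻¹ / (δ * n)) atTop (𝓝 0) :=
      tendsto_const_nhds.div_atTop (tendsto_natCast_atTop_atTop.const_mul_atTop hδ)
    have herr := (herr1.add herr2).const_mul (θ ^ 2)
    rw [add_zero, mul_zero] at herr
    rw [tendsto_iff_norm_sub_tendsto_zero]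
    refine squeeze_zero' (Eventually.of_forall fun _ => norm_nonneg _) ?_ herr
    filter_upwards [hrates, eventually_gt_atTop 0] with n hn hn0
    obtain ⟨hN, hbirth, hmono, hqρ, hJ₀, hJ, hd₁, hd₂, hJn⟩ := hn
    have hn0' : (0 : ℝ) < n := by exact_mod_cast hn0
    have hA : 0 < n * β / 4 := by positivity
    have hr : ∀ k < edgeTarget c n, 0 < edgeBirth β n k := fun k hk =>
      hA.trans_le (hbirth k hk).1
    have hq : ∀ k, k + 1 < edgeTarget c n → 0 ≤ edgeRatio α β n k := fun k hk => by
      have := hr k (by omega)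
      unfold edgeRatio
      positivity
    have hm := (hG n).lintegral_hittingTime_eq (q := edgeRatio α β n) hα (by omega) hr hN
      (fun _ _ => rfl)
    have hm0 : 0 < meanPassage (edgeRatio α β n) (edgeBirth β n) (edgeTarget c n) 0 :=
      meanPassage_zero_pos (by omega) hr hq
    have hchar := (hG n).norm_charFun_sub_le (q := edgeRatio α β n) hα hρ hr hN (fun _ _ => rfl)
      hmono hqρ hJ₀ hJ θ
    rw [charFun_apply_real, integral_map (((hG n).aemeasurable_hittingTime _).ennreal_toReal.div_const _)
      (by fun_prop), hm, ENNReal.toReal_ofReal hm0.le]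
    refine le_trans (le_of_eq ?_) (hchar.trans ?_)
    · congr 3
      ext ω
      congr 1
      push_cast
      ring
    · gcongr
      · exact meanPassage_div_le hA (fun k hk => ⟨(hbirth k hk).1, (hbirth k hk).2.trans_eq (by ring)⟩)
          hq hmono hρ hqρ hJ₀ hJ
      · exact hd₁.trans (sub_le_passageSum hq hρ hqρ hJ₀ hJ)

end ExponentialLimit

/-! ### Binomial weights, factorials and the rate function. -/

section BinomialWeights

lemma sum_choose_mul_pow (N : ℕ) (x : ℝ) :
    ∑ j ∈ Finset.range (N + 1), (N.choose j : ℝ) * x ^ j = (1 + x) ^ N := by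
  rw [add_comm 1 x, add_pow]
  exact Finset.sum_congr rfl fun j _ => by rw [one_pow, mul_one, mul_comm]

lemma sum_mul_choose_mul_pow (N : ℕ) (x : ℝ) :
    (∑ j ∈ Finset.range (N + 1), (j : ℝ) * ((N.choose j : ℝ) * x ^ j)) * (1 + x)
      = N * x * (1 + x) ^ N := by
  rcases N with _ | N
  · simp
  · rw [Finset.sum_range_succ']
    have h1 : ∀ j : ℕ, ((j + 1 : ℕ) : ℝ) * (((N + 1).choose (j + 1) : ℝ) * x ^ (j + 1))
        = (N + 1) * x * ((N.choose j : ℝ) * x ^ j) := by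
      intro j
      have h2 : ((N : ℝ) + 1) * N.choose j = (N + 1).choose (j + 1) * (j + 1) := by
        exact_mod_cast Nat.add_one_mul_choose_eq N j
      push_cast
      rw [pow_succ]
      linear_combination -(x ^ j * x) * h2
    simp only [h1, ← Finset.mul_sum, sum_choose_mul_pow]
    push_cast
    ring

/-- Markov's inequality for the binomial weights. -/
lemma le_sum_range_choose_mul_pow {N i : ℕ} (hi : i ≤ N + 1) {x : ℝ} (hx : 0 ≤ x) :
    (1 + x) ^ N * (i - N * x) ≤ i * ∑ j ∈ Finset.range i, (N.choose j : ℝ) * x ^ j := by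
  have h1 : (1 + x) ^ N * (i - N * x)
      ≤ ∑ j ∈ Finset.range (N + 1), ((i : ℝ) - j) * ((N.choose j : ℝ) * x ^ j) := by
    have e1 := sum_mul_choose_mul_pow N x
    have e2 : ∑ j ∈ Finset.range (N + 1), (j : ℝ) * ((N.choose j : ℝ) * x ^ j)
        ≤ N * x * (1 + x) ^ N := by
      rw [← e1]
      exact le_mul_of_one_le_right (Finset.sum_nonneg fun j _ => by positivity) (by linarith)
    simp only [sub_mul, Finset.sum_sub_distrib, ← Finset.mul_sum, sum_choose_mul_pow]
    linarith
  -- The terms with `j ≥ i` are nonpositive and may be dropped.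
  have h2 : ∑ j ∈ Finset.range (N + 1), ((i : ℝ) - j) * ((N.choose j : ℝ) * x ^ j)
      ≤ ∑ j ∈ Finset.range i, ((i : ℝ) - j) * ((N.choose j : ℝ) * x ^ j) := by
    rw [← Finset.sum_range_add_sum_Ico _ hi]
    have : ∑ j ∈ Finset.Ico i (N + 1), ((i : ℝ) - j) * ((N.choose j : ℝ) * x ^ j) ≤ 0 := by
      refine Finset.sum_nonpos fun j hj => ?_
      have : (i : ℝ) ≤ j := by exact_mod_cast (Finset.mem_Ico.1 hj).1
      exact mul_nonpos_of_nonpos_of_nonneg (by linarith) (by positivity)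
    linarith
  refine h1.trans (h2.trans ?_)
  rw [Finset.mul_sum]
  refine Finset.sum_le_sum fun j _ => ?_
  gcongr
  linarith [j.cast_nonneg (α := ℝ)]

/-- The weights `π k = N.choose k * (lam / α) ^ k` satisfy detailed balance, `q k * π (k + 1) = π
k`. Multiplied by them, the recursion for `passageSum` becomes that of the partial sums of `π`. -/
lemma passageSum_mul_weight {N i : ℕ} {lam α : ℝ} {q r : ℕ → ℝ} (hα : 0 < α)
    (hr : ∀ k < i, 0 < r k) (hN : ∀ k < i, ((N : ℝ) - k) * lam = r k)
    (hq : ∀ k, k + 1 < i → q k = (k + 1) * α / r k) {k : ℕ} (hk : k < i) :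
    passageSum q k * ((N.choose k : ℝ) * (lam / α) ^ k)
      = ∑ j ∈ Finset.range (k + 1), (N.choose j : ℝ) * (lam / α) ^ j := by
  induction k with
  | zero => simp [passageSum]
  | succ k ih =>
    rw [Finset.sum_range_succ, ← ih (by omega)]
    have hrk := hr k (by omega)
    have hNk := hN k (by omega)
    have hkN : k ≤ N := by
      -- No sign of `lam` is assumed; for `N < k`, positivity of `(N - k) * lam` makes `lam`
      -- negative, against positivity of `r 0 = N * lam`.
      by_contra h
      have h1 : N.choose k = 0 := Nat.choose_eq_zero_of_lt (by omega)
      have h2 := ih (by omega)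
      rw [h1] at h2
      simp only [Nat.cast_zero, zero_mul, mul_zero] at h2
      rw [Finset.sum_range_succ', Nat.choose_zero_right] at h2
      have hlam : ((N : ℝ) - ((0 : ℕ) : ℝ)) * lam = r 0 := hN 0 (by omega)
      have hNneg : (N : ℝ) < k := by exact_mod_cast (by omega : N < k)
      have h0 := hr 0 (by omega)
      rw [← hlam] at h0
      rw [← hNk] at hrk
      have hl : lam < 0 := by
        by_contra hl
        nlinarith
      have : (0 : ℝ) ≤ N := N.cast_nonneg
      push_cast at h0
      nlinarith
    have h1 : (N.choose (k + 1) : ℝ) * (k + 1) = N.choose k * ((N : ℝ) - k) := by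
      rw [← Nat.cast_sub hkN]
      exact_mod_cast Nat.choose_succ_right_eq N k
    have h2 : q k * ((N.choose (k + 1) : ℝ) * (lam / α) ^ (k + 1))
        = (N.choose k : ℝ) * (lam / α) ^ k := by
      rw [hq k hk, pow_succ]
      have : ((k : ℝ) + 1) * α / r k * (N.choose (k + 1) * ((lam / α) ^ k * (lam / α)))
          = (N.choose (k + 1) * (k + 1)) * lam * (lam / α) ^ k / r k := by
        field_simp
      rw [this, h1, mul_assoc _ ((N : ℝ) - k), hNk]
      field_simp
    simp only [passageSum]
    linear_combination passageSum q k * h2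

/-- `(k / e) ^ k ≤ k!`, scaled by `M`, which will be the mean `N * (lam / α)`, so that the exponent
is an entropy term. -/
lemma pow_div_factorial_ge {k : ℕ} (hk : 0 < k) {M : ℝ} (hM : 0 < M) :
    Real.exp (k * Real.log (k / M) - k) * M ^ k ≤ k.factorial := by
  have hk' : (0 : ℝ) < k := by exact_mod_cast hk
  have h1 := Real.pow_div_factorial_le_exp (k : ℝ) hk'.le k
  rw [div_le_iff₀ (by positivity)] at h1
  rw [Real.exp_sub, mul_comm (k : ℝ), Real.exp_mul, Real.exp_log (by positivity), Real.rpow_natCast,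
    div_pow, div_mul_eq_mul_div, div_mul_cancel₀ _ (by positivity), div_le_iff₀ (Real.exp_pos _)]
  linarith

/-- The Stirling sequence decreases from its value `e / √2` at `1`. The factor `√k` missing from the
opposite bound is the gap between `n ^ (-1)` and `n ^ (-1/2)` in the final estimates. -/
lemma factorial_le_mul_pow {k : ℕ} (hk : 0 < k) {M : ℝ} (hM : 0 < M) :
    (k.factorial : ℝ) ≤ Real.exp 1 * √k * Real.exp (k * Real.log (k / M) - k) * M ^ k := by
  have hk' : (0 : ℝ) < k := by exact_mod_cast hk
  obtain ⟨l, rfl⟩ := Nat.exists_eq_succ_of_ne_zero hk.ne'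
  have h1 := Stirling.stirlingSeq'_antitone (Nat.zero_le l)
  simp only [Function.comp_apply, Nat.succ_eq_add_one, zero_add, Stirling.stirlingSeq_one] at h1
  rw [Stirling.stirlingSeq, div_le_iff₀ (by positivity)] at h1
  refine h1.trans (le_of_eq ?_)
  rw [Real.exp_sub, mul_comm ((l + 1 : ℕ) : ℝ) (Real.log _), Real.exp_mul,
    Real.exp_log (by positivity), Real.rpow_natCast, Real.sqrt_mul (by norm_num), div_pow, div_pow,
    ← Real.exp_nat_mul, mul_one]
  field_simp

lemma choose_mul_pow_le {N k : ℕ} {x : ℝ} (hx : 0 ≤ x) :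
    (N.choose k : ℝ) * x ^ k ≤ (N * x) ^ k / k.factorial := by
  rw [mul_pow, mul_div_right_comm]
  exact mul_le_mul_of_nonneg_right (Nat.choose_le_pow_div k N) (by positivity)

/-- `N.choose k * k! ≥ (N - k) ^ k ≥ exp (-2 k ^ 2 / N) * N ^ k`. For `k` of order `n` and `N` of
order `n ^ 2` the loss is a constant factor. -/
lemma le_choose_mul_pow {N k : ℕ} {x C : ℝ} (hN : 0 < N) (hx : 0 ≤ x) (hk : 2 * (k : ℝ) ≤ N)
    (hC : 2 * (k : ℝ) ^ 2 ≤ C * N) :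
    Real.exp (-C) * ((N * x) ^ k / k.factorial) ≤ (N.choose k : ℝ) * x ^ k := by
  have hN' : (0 : ℝ) < N := by exact_mod_cast hN
  have hkN : k ≤ N := by
    have : (k : ℝ) ≤ N := by linarith [k.cast_nonneg (α := ℝ)]
    exact_mod_cast this
  have h1 : ((N : ℝ) - k) ^ k ≤ N.choose k * k.factorial := by
    have e1 : (N - k) ^ k ≤ N.descFactorial k :=
      (Nat.pow_le_pow_left (by omega) k).trans (Nat.pow_sub_le_descFactorial N k)
    rw [Nat.descFactorial_eq_factorial_mul_choose, mul_comm] at e1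
    rw [← Nat.cast_sub hkN]
    exact_mod_cast e1
  have h2 : Real.exp (-C) * N ^ k ≤ ((N : ℝ) - k) ^ k := by
    have e1 : Real.exp (-(2 * k / N)) * N ≤ (N : ℝ) - k := by
      have e2 : 0 < 1 - (k : ℝ) / N := by
        rw [sub_pos, div_lt_one hN']; linarith
      have e3 := Real.one_sub_inv_le_log_of_pos e2
      have e4 : -(2 * k / N : ℝ) ≤ 1 - (1 - (k : ℝ) / N)⁻¹ := by
        have e : 1 - (1 - (k : ℝ) / N)⁻¹ + 2 * k / N = k * (N - 2 * k) / ((N - k) * N) := by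
          have : (N : ℝ) - k ≠ 0 := by linarith [k.cast_nonneg (α := ℝ)]
          field_simp
          ring
        have : 0 ≤ k * ((N : ℝ) - 2 * k) / ((N - k) * N) :=
          div_nonneg (mul_nonneg k.cast_nonneg (by linarith))
            (mul_nonneg (by linarith [k.cast_nonneg (α := ℝ)]) hN'.le)
        linarith
      have e5 : Real.exp (-(2 * k / N : ℝ)) ≤ 1 - (k : ℝ) / N := by
        rw [← Real.le_log_iff_exp_le e2]; linarith
      calc _ ≤ (1 - (k : ℝ) / N) * N := mul_le_mul_of_nonneg_right e5 hN'.le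
        _ = _ := by field_simp
    have e6 := pow_le_pow_left₀ (by positivity) e1 k
    rw [mul_pow, ← Real.exp_nat_mul] at e6
    refine le_trans ?_ e6
    gcongr
    rw [mul_neg, neg_le_neg_iff, mul_div_assoc', div_le_iff₀ hN']
    linarith
  rw [← mul_div_assoc, div_le_iff₀ (by positivity), mul_pow]
  calc _ = Real.exp (-C) * N ^ k * x ^ k := by ring
    _ ≤ (N.choose k * k.factorial) * x ^ k := mul_le_mul_of_nonneg_right (h2.trans h1) (by positivity)
    _ = _ := by ring

/-- In the application `N * x` is of order `n` and `x` of order `1 / n`, so the correction `N * x *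
x` stays bounded. -/
lemma one_add_pow_ge {N : ℕ} {x : ℝ} (hx : 0 ≤ x) :
    Real.exp (N * x - N * x * x) ≤ (1 + x) ^ N := by
  have h1 : Real.exp (x - x * x) ≤ 1 + x := by
    have h2 := Real.one_sub_inv_le_log_of_pos (show 0 < 1 + x by linarith)
    rw [← Real.le_log_iff_exp_le (by linarith)]
    refine le_trans ?_ h2
    rw [← sub_nonneg]
    have : 1 - (1 + x)⁻¹ - (x - x * x) = x ^ 3 / (1 + x) := by field_simp; ring
    rw [this]
    positivity
  have := pow_le_pow_left₀ (Real.exp_pos _).le h1 N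
  rw [← Real.exp_nat_mul] at this
  refine le_trans (le_of_eq ?_) this
  congr 1
  ring

lemma one_add_pow_le {N : ℕ} {x : ℝ} (hx : 0 ≤ x) : (1 + x) ^ N ≤ Real.exp (N * x) := by
  rw [Real.exp_nat_mul]
  exact pow_le_pow_left₀ (by linarith) (by linarith [Real.add_one_le_exp x]) N

/-- Comparison of the exponent at a level close to `c n` with the exponent at `c n`. -/
lemma rate_bounds {b c n k : ℝ} (hb : 0 < b) (hbc : b < c) (hn : 0 < n) (hcn : 1 ≤ c * n)
    (hk0 : 0 < k) (hk : |k - c * n| ≤ 3 / 2) :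
    n * (c * Real.log (c / b) - c + b) - 3 / 2 * Real.log (c / b)
        ≤ n * b + (k * Real.log (k / (n * b)) - k) ∧
      n * b + (k * Real.log (k / (n * b)) - k)
        ≤ n * (c * Real.log (c / b) - c + b) + (9 / 4 + 3 / 2 * Real.log (c / b)) := by
  have hc : 0 < c := hb.trans hbc
  have hL : 0 ≤ Real.log (c / b) := Real.log_nonneg (by rw [le_div_iff₀ hb]; linarith)
  have hy : 0 < c * n := by positivity
  have h1 : Real.log (k / (n * b)) = Real.log (k / (c * n)) + Real.log (c / b) := by
    rw [← Real.log_mul (by positivity) (by positivity)]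
    congr 1
    field_simp
  have h2 : Real.log (k / (c * n)) ≤ k / (c * n) - 1 := Real.log_le_sub_one_of_pos (by positivity)
  have h3 : 1 - (k / (c * n))⁻¹ ≤ Real.log (k / (c * n)) :=
    Real.one_sub_inv_le_log_of_pos (by positivity)
  -- This entropy vanishes to second order at `k = c n`: it lies between `0` and `(k - c n) ^ 2 / (c
  -- n)`. What remains is linear in `k - c n`, with slope `log (c / b)`.
  have h4 : 0 ≤ k * Real.log (k / (c * n)) - k + c * n := by
    have := mul_le_mul_of_nonneg_left h3 hk0.le
    have e : k * (1 - (k / (c * n))⁻¹) = k - c * n := by field_simp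
    linarith
  have hksq : (k - c * n) ^ 2 ≤ 9 / 4 := by
    rw [← sq_abs]
    calc |k - c * n| ^ 2 ≤ (3 / 2) ^ 2 := pow_le_pow_left₀ (abs_nonneg _) hk 2
      _ = 9 / 4 := by norm_num
  have h5 : k * Real.log (k / (c * n)) - k + c * n ≤ 9 / 4 := by
    have := mul_le_mul_of_nonneg_left h2 hk0.le
    have e : k * (k / (c * n) - 1) - k + c * n = (k - c * n) ^ 2 / (c * n) := by field_simp; ring
    have e' : (k - c * n) ^ 2 / (c * n) ≤ 9 / 4 :=
      (div_le_self (sq_nonneg _) hcn).trans hksq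
    linarith
  obtain ⟨hk1, hk2⟩ := abs_le.1 hk
  have h6 := mul_le_mul_of_nonneg_right hk2 hL
  have h7 := mul_le_mul_of_nonneg_right hk1 hL
  rw [h1]
  constructor <;> linarith

end BinomialWeights

/-! ### Two-sided bounds of the mean passage time above equilibrium. -/

section MeanBounds

variable {α lam ρ : ℝ} {N i k : ℕ} {q r : ℕ → ℝ}

/-- By Markov's inequality the weights below `i` carry at least the fraction `κ` of `(1 + x) ^ N`,
`x = lam / α`; divide by the upper bound `(N x) ^ k / k!` of the weight at `k = i - 1`. -/
lemma le_passageSum {κ : ℝ} (hα : 0 < α) (hlam : 0 < lam)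
    (hr : ∀ k < i, 0 < r k) (hN : ∀ k < i, ((N : ℝ) - k) * lam = r k)
    (hq : ∀ k, k + 1 < i → q k = (k + 1) * α / r k) (hki : k + 1 = i) (hk0 : 0 < k)
    (hκ : N * (lam / α) ≤ (1 - κ) * i) :
    κ * Real.exp (N * (lam / α) - N * (lam / α) * (lam / α)
      + (k * Real.log (k / (N * (lam / α))) - k)) ≤ passageSum q k := by
  have hk : k < i := by omega
  have hx : 0 < lam / α := by positivity
  have hkN : k < N := by
    have h := hr k hk
    rw [← hN k hk] at h
    have h := pos_of_mul_pos_left h hlam.le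
    rw [sub_pos] at h
    exact_mod_cast h
  set x := lam / α
  have hμ : 0 < N * x := mul_pos (by exact_mod_cast (by omega : 0 < N)) hx
  have hi0 : (0 : ℝ) < i := by exact_mod_cast (by omega : 0 < i)
  have hR := passageSum_mul_weight hα hr hN hq hk
  have hR1 := one_le_passageSum (q := q) (fun j hj => by
    rw [hq j hj]; have := hr j (by omega); positivity) hk
  have h1 : κ * (1 + x) ^ N ≤ ∑ j ∈ Finset.range i, (N.choose j : ℝ) * x ^ j := by
    refine le_of_mul_le_mul_left ?_ hi0
    refine le_trans ?_ (le_sum_range_choose_mul_pow (by omega) hx.le)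
    calc _ = (1 + x) ^ N * (κ * i) := by ring
      _ ≤ _ := by gcongr; linarith
  rw [hki] at hR
  have h2 := mul_le_mul_of_nonneg_left (choose_mul_pow_le (N := N) (k := k) hx.le)
    (zero_le_one.trans hR1)
  rw [← mul_div_assoc, le_div_iff₀ (by positivity)] at h2
  rcases le_or_gt κ 0 with hκ0 | hκ0
  · exact (mul_nonpos_of_nonpos_of_nonneg hκ0 (Real.exp_pos _).le).trans (by linarith)
  refine le_of_mul_le_mul_right ?_ (pow_pos hμ k)
  refine le_trans ?_ h2
  rw [hR, Real.exp_add]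
  calc _ = κ * Real.exp (N * x - N * x * x)
        * (Real.exp (k * Real.log (k / (N * x)) - k) * (N * x) ^ k) := by ring
    _ ≤ κ * (1 + x) ^ N * k.factorial := by
      gcongr
      · exact one_add_pow_ge hx.le
      · exact pow_div_factorial_ge hk0 hμ
    _ ≤ _ := by gcongr

/-- The partial sum is at most the full sum `(1 + x) ^ N ≤ exp (N x)`, `x = lam / α`; divide by the
lower bound of the weight at `k` and bound `k!` by Stirling. -/
lemma passageSum_le_exp {C : ℝ} (hα : 0 < α) (hlam : 0 < lam)
    (hr : ∀ k < i, 0 < r k) (hN : ∀ k < i, ((N : ℝ) - k) * lam = r k)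
    (hq : ∀ k, k + 1 < i → q k = (k + 1) * α / r k) (hk : k < i) (hk0 : 0 < k)
    (hkN : 2 * (k : ℝ) ≤ N) (hC : 2 * (k : ℝ) ^ 2 ≤ C * N) :
    passageSum q k ≤ Real.exp (C + 1) * √k *
      Real.exp (N * (lam / α) + (k * Real.log (k / (N * (lam / α))) - k)) := by
  have hx : 0 < lam / α := by positivity
  have hN0 : 0 < N := by
    have : (0 : ℝ) < k := by exact_mod_cast hk0
    have : (0 : ℝ) < N := by linarith
    exact_mod_cast this
  set x := lam / α
  have hμ : 0 < N * x := mul_pos (by exact_mod_cast hN0) hx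
  have hR := passageSum_mul_weight hα hr hN hq hk
  have hR1 := one_le_passageSum (q := q) (fun j hj => by
    rw [hq j hj]; have := hr j (by omega); positivity) hk
  have h1 : ∑ j ∈ Finset.range (k + 1), (N.choose j : ℝ) * x ^ j ≤ Real.exp (N * x) := by
    refine le_trans ?_ (one_add_pow_le hx.le)
    rw [← sum_choose_mul_pow]
    refine Finset.sum_le_sum_of_subset_of_nonneg ?_ fun j _ _ => by positivity
    have : (k : ℝ) ≤ N := by linarith [k.cast_nonneg (α := ℝ)]
    have : k ≤ N := by exact_mod_cast this
    exact Finset.range_subset_range.2 (by omega)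
  have h2 := mul_le_mul_of_nonneg_left (le_choose_mul_pow hN0 hx.le hkN hC) (zero_le_one.trans hR1)
  rw [← mul_div_assoc, ← mul_div_assoc, div_le_iff₀ (by positivity)] at h2
  have h3 := h2.trans (mul_le_mul_of_nonneg_right (hR.le.trans h1)
    (Nat.cast_nonneg k.factorial))
  have h4 := h3.trans (mul_le_mul_of_nonneg_left (factorial_le_mul_pow hk0 hμ)
    (Real.exp_pos (N * x)).le)
  refine le_of_mul_le_mul_right ?_ (mul_pos (Real.exp_pos (-C)) (pow_pos hμ k))
  calc _ = passageSum q k * (Real.exp (-C) * (N * x) ^ k) := by ring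
    _ ≤ _ := h4
    _ = Real.exp (C + 1) * Real.exp (-C) * √k * (Real.exp (N * x) *
        Real.exp (k * Real.log (k / (N * x)) - k)) * (N * x) ^ k := by
      rw [← Real.exp_add, show C + 1 + -C = 1 by ring]; ring
    _ = _ := by rw [Real.exp_add (N * x)]; ring

/-- Geometric growth at rate `ρ` makes the last term dominate the sum. -/
lemma sum_passageSum_le {J₀ J : ℕ} (hq : ∀ k, k + 1 < i → 0 ≤ q k) (hρ : 1 < ρ)
    (hqρ : ∀ k, J₀ ≤ k → k + 1 < i → ρ ≤ q k) (hJ₀ : J₀ ≤ J) (hJk : J ≤ k) (hk : k < i) :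
    ∑ l ∈ Finset.Ico J (k + 1), passageSum q l ≤ ρ / (ρ - 1) * passageSum q k := by
  have hρ1 : 0 < ρ - 1 := by linarith
  induction k, hJk using Nat.le_induction with
  | base =>
    rw [Finset.sum_Ico_succ_top le_rfl, Finset.Ico_self, Finset.sum_empty, zero_add]
    refine le_mul_of_one_le_left (zero_le_one.trans (one_le_passageSum hq hk)) ?_
    rw [le_div_iff₀ hρ1]
    linarith
  | succ k hJk ih =>
    have h1 := pow_mul_passageSum_le hq hρ hqρ (hJ₀.trans hJk) k.le_succ hk
    rw [Nat.sub_eq_of_eq_add' (rfl : k + 1 = k + 1), pow_one] at h1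
    rw [Finset.sum_Ico_succ_top (by omega)]
    calc _ ≤ ρ / (ρ - 1) * passageSum q k + passageSum q (k + 1) := by linarith [ih (by omega)]
      _ = (ρ * passageSum q k) / (ρ - 1) + passageSum q (k + 1) := by ring
      _ ≤ passageSum q (k + 1) / (ρ - 1) + passageSum q (k + 1) := by gcongr
      _ = _ := by field_simp; ring

lemma meanPassage_le {J₀ J : ℕ} {A : ℝ} (hA : 0 < A) (hr : ∀ k < i, A ≤ r k)
    (hq : ∀ k, k + 1 < i → 0 ≤ q k) (hρ : 1 < ρ)
    (hqρ : ∀ k, J₀ ≤ k → k + 1 < i → ρ ≤ q k) (hJ₀ : J₀ ≤ J) (hJk : J ≤ k) (hki : k + 1 = i) :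
    meanPassage q r i J ≤ ρ / (ρ - 1) * passageSum q k / A := by
  refine le_trans ?_ (div_le_div_of_nonneg_right
    (sum_passageSum_le hq hρ hqρ hJ₀ hJk (by omega)) hA.le)
  rw [hki, meanPassage, Finset.sum_div]
  refine Finset.sum_le_sum fun l hl => ?_
  have hl := (Finset.mem_Ico.1 hl).2
  exact div_le_div_of_nonneg_left (zero_le_one.trans (one_le_passageSum hq hl)) hA (hr l hl)

lemma passageSum_div_le_meanPassage (hr : ∀ k < i, 0 < r k) (hq : ∀ k, k + 1 < i → 0 ≤ q k)
    (hk : k < i) : passageSum q k / r k ≤ meanPassage q r i 0 :=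
  Finset.single_le_sum (f := fun l => passageSum q l / r l) (fun l hl => by
    have hl := (Finset.mem_Ico.1 hl).2
    exact div_nonneg (zero_le_one.trans (one_le_passageSum hq hl)) (hr l hl).le)
    (Finset.mem_Ico.2 ⟨Nat.zero_le _, hk⟩)

lemma supercritical_rate_pos {b c : ℝ} (hb : 0 < b) (hbc : b < c) :
    0 < c * Real.log (c / b) - c + b := by
  have hc : 0 < c := hb.trans hbc
  have h := Real.log_lt_sub_one_of_pos (show 0 < b / c by positivity)
    (by rw [Ne, div_eq_one_iff_eq hc.ne']; exact hbc.ne)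
  rw [← inv_div c b, Real.log_inv] at h
  have h2 := mul_lt_mul_of_pos_left h hc
  have h3 : c * ((c / b)⁻¹ - 1) = b - c := by field_simp
  linarith

end MeanBounds

/-! ### Explicit constants for the mean above equilibrium. -/

section MeanHittingTime

/-- The normalizing constants of the mean passage time above the mean number of edges. -/
lemma supercritical_meanPassage_bounds {α β c : ℝ} (hα : 0 < α) (hβ : 0 < β)
    (hcβ : β / (2 * α) < c) :
    ∃ C₁ C₂ : ℝ, 0 < C₁ ∧ 0 < C₂ ∧ ∀ᶠ n : ℕ in atTop,
      C₁ * (n : ℝ) ^ (-1 : ℝ) *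
          Real.exp (n * (c * Real.log (2 * α / β * c) - c + β / (2 * α))) ≤
        meanPassage (edgeRatio α β n) (edgeBirth β n) (edgeTarget c n) 0 ∧
      meanPassage (edgeRatio α β n) (edgeBirth β n) (edgeTarget c n) 0 ≤
        C₂ * (n : ℝ) ^ (-(1 / 2) : ℝ) *
          Real.exp (n * (c * Real.log (2 * α / β * c) - c + β / (2 * α))) := by
  rw [show 2 * α / β * c = c / (β / (2 * α)) by field_simp]
  set b := β / (2 * α) with hb
  have hb0 : 0 < b := by positivity
  have hc0 : 0 < c := hb0.trans hcβ
  obtain ⟨ρ, hρ, J₀, J, δ, hδ, hrates⟩ := eventually_supercritical_rates hα hβ hcβ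
  have herr := tendsto_mul_pow_zero (J := J) (d := fun n => edgeTarget c n - 1 - J n) hρ hδ
    (by positivity : 0 ≤ c + 1) (hrates.mono fun n h => h.2.2.2.2.2.2.2.1)
    (hrates.mono fun n h => h.2.2.2.2.2.2.2.2)
  have hρ1 : 0 < ρ - 1 := by linarith
  set L := Real.log (c / b) with hL
  -- Half of the limiting fraction `1 - b / c` in Markov's inequality; the other half absorbs
  -- rounding.
  set κ := (c - b) / (2 * c) with hκ
  have hκ0 : 0 < κ := div_pos (by linarith) (by positivity)
  -- The loss from evaluating the rate at `k` instead of `c n`, plus a bound of `N * x * x` using `n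
  -- / (n - 1) ≤ 2`.
  set D := 3 / 2 * L + 2 * b * β / α with hD
  -- From `2 k ^ 2 ≤ 2 (c + 1) ^ 2 n ^ 2` and `N ≥ n ^ 2 / 4`.
  set C := 8 * (c + 1) ^ 2 with hC
  refine ⟨κ * Real.exp (-D) * (2 / β),
    8 / β * (ρ / (ρ - 1)) * (Real.exp (C + 1) * √(c + 1)) * Real.exp (9 / 4 + 3 / 2 * L),
    by positivity, by positivity, ?_⟩
  filter_upwards [hrates, herr.eventually_le_const (show (0 : ℝ) < 1 / 2 by norm_num),
    eventually_ge_atTop 2, eventually_ge_atTop ⌈8 * c⌉₊, eventually_ge_atTop ⌈2 / c⌉₊,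
    eventually_ge_atTop ⌈1 / (c - b)⌉₊] with n hn hhalf hn2 hn8c hnc hnb
  obtain ⟨hN, hbirth, hmono, hqρ, hJ₀, hJ, -⟩ := hn
  have hn8c : 8 * c ≤ n := Nat.ceil_le.1 hn8c
  have hnc : 2 ≤ c * n := by
    have := Nat.ceil_le.1 hnc
    rwa [div_le_iff₀' hc0] at this
  have hnb : 1 ≤ (c - b) * n := by
    have := Nat.ceil_le.1 hnb
    rwa [div_le_iff₀' (by linarith)] at this
  have hn2' : (2 : ℝ) ≤ n := by exact_mod_cast hn2
  have hn0 : (0 : ℝ) < n := by linarith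
  have hn1 : 0 < (n : ℝ) - 1 := by linarith
  have hA : 0 < n * β / 4 := by positivity
  obtain ⟨hi1, hi2⟩ := edgeTarget_bounds hc0.le n
  have hr : ∀ k < edgeTarget c n, 0 < edgeBirth β n k := fun k hk => hA.trans_le (hbirth k hk).1
  have hq : ∀ k, k + 1 < edgeTarget c n → 0 ≤ edgeRatio α β n k := fun k hk => by
    have := hr k (by omega)
    unfold edgeRatio
    positivity
  obtain ⟨k, hki⟩ := Nat.exists_eq_add_one_of_ne_zero (show edgeTarget c n ≠ 0 by omega)
  have hjump := meanPassage_div_le hA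
    (fun k hk => ⟨(hbirth k hk).1, (hbirth k hk).2.trans_eq (by ring)⟩) hq hmono hρ hqρ hJ₀ hJ
  have hm0 := meanPassage_zero_pos (by omega) hr hq
  have hkr := hbirth k (by omega)
  have hik : (edgeTarget c n : ℝ) = k + 1 := by rw [hki]; push_cast; ring
  have hk0 : 0 < k := by
    have : (0 : ℝ) < k := by linarith
    exact_mod_cast this
  have hNcast : ((n.choose 2 : ℕ) : ℝ) = n * (n - 1) / 2 := Nat.cast_choose_two ℝ n
  have hNx : ((n.choose 2 : ℕ) : ℝ) * (β / ((n : ℝ) - 1) / α) = n * b := by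
    rw [hNcast, hb]; field_simp
  have hlam : 0 < β / ((n : ℝ) - 1) := by positivity
  obtain ⟨hrate1, hrate2⟩ := rate_bounds hb0 hcβ hn0 (by linarith) (by exact_mod_cast hk0)
    (abs_le.2 ⟨by linarith, by linarith⟩ : |(k : ℝ) - c * n| ≤ 3 / 2)
  rw [← hL] at hrate1 hrate2
  set f := n * b + (k * Real.log (k / (n * b)) - k) with hf
  set K := c * L - c + b with hK
  constructor
  · have h1 : n * b ≤ (1 - κ) * (edgeTarget c n : ℝ) := by
      have e1 : (1 - κ) * (c * n - 1 / 2) = (b + c) / 2 * n - (b + c) / (4 * c) := by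
        rw [hκ]; field_simp; ring
      have e2 : (b + c) / (4 * c) ≤ 1 / 2 := by
        rw [div_le_iff₀ (by positivity)]; linarith
      have e3 : 0 ≤ 1 - κ := by
        have : κ ≤ 1 := by rw [hκ, div_le_one (by positivity)]; linarith
        linarith
      have e4 := mul_le_mul_of_nonneg_left hi1 e3
      linarith
    have h2 := le_passageSum (q := edgeRatio α β n) (κ := κ) hα hlam hr hN (fun _ _ => rfl)
      hki.symm hk0 (by rw [hNx]; exact h1)
    rw [hNx] at h2
    have h3 : n * b * (β / ((n : ℝ) - 1) / α) ≤ 2 * b * β / α := by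
      have : n / ((n : ℝ) - 1) ≤ 2 := by rw [div_le_iff₀ hn1]; linarith
      calc _ = n / ((n : ℝ) - 1) * (b * β / α) := by ring
        _ ≤ 2 * (b * β / α) := by gcongr
        _ = _ := by ring
    have h4 : κ * (Real.exp (-D) * Real.exp (n * K)) ≤ passageSum (edgeRatio α β n) k := by
      refine le_trans ?_ h2
      rw [← Real.exp_add]
      exact mul_le_mul_of_nonneg_left (Real.exp_le_exp.2 (by linarith)) hκ0.le
    refine le_trans ?_ (passageSum_div_le_meanPassage hr hq (by omega : k < edgeTarget c n))
    rw [le_div_iff₀ (hr k (by omega))]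
    refine le_trans ?_ h4
    calc _ ≤ κ * Real.exp (-D) * (2 / β) * (n : ℝ) ^ (-1 : ℝ) * Real.exp (n * K) * (n * β / 2) := by
          gcongr
          exact hkr.2
      _ = _ := by rw [Real.rpow_neg_one]; field_simp
  · have hnn : (n : ℝ) ^ 2 / 4 ≤ (n.choose 2 : ℕ) := by
      have := mul_le_mul_of_nonneg_left hn2' hn0.le
      rw [hNcast]
      linarith
    have h1 : 2 * (k : ℝ) ^ 2 ≤ C * (n.choose 2 : ℕ) := by
      have e1 : (k : ℝ) ^ 2 ≤ ((c + 1) * n) ^ 2 := by gcongr; linarith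
      calc _ ≤ 2 * ((c + 1) * n) ^ 2 := by linarith
        _ = C * ((n : ℝ) ^ 2 / 4) := by rw [hC]; ring
        _ ≤ _ := by gcongr
    have h2 : 2 * (k : ℝ) ≤ (n.choose 2 : ℕ) := by
      have := mul_le_mul_of_nonneg_right hn8c hn0.le
      refine le_trans ?_ hnn
      linarith
    have h3 := passageSum_le_exp (q := edgeRatio α β n) hα hlam hr hN (fun _ _ => rfl)
      (by omega : k < edgeTarget c n) hk0 h2 h1
    rw [hNx] at h3
    have h4 := meanPassage_le hA (fun k hk => (hbirth k hk).1) hq hρ hqρ hJ₀ (by omega : J n ≤ k)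
      hki.symm
    have h5 := meanPassage_zero_eq_add (q := edgeRatio α β n) (r := edgeBirth β n) hJ.le
    have h6 := hjump.trans hhalf
    rw [div_le_iff₀ hm0] at h6
    have h7 : √(k : ℝ) ≤ √(c + 1) * √n := by
      rw [← Real.sqrt_mul (by positivity)]
      exact Real.sqrt_le_sqrt (by linarith)
    have h8 : (n : ℝ) ^ (-(1 / 2) : ℝ) = √n / n := by
      rw [Real.rpow_neg hn0.le, ← Real.sqrt_eq_rpow, eq_div_iff hn0.ne']
      nth_rewrite 2 [← Real.mul_self_sqrt hn0.le]
      field_simp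
    -- By `h6` the passages below `J` make up at most half of the mean, whence the factor `2` before
    -- the part above `J`.
    calc _ ≤ 2 * (ρ / (ρ - 1) * passageSum (edgeRatio α β n) k / (n * β / 4)) := by linarith
      _ ≤ 2 * (ρ / (ρ - 1) * (Real.exp (C + 1) * (√(c + 1) * √n) *
          Real.exp (n * K + (9 / 4 + 3 / 2 * L))) / (n * β / 4)) := by
        gcongr
        refine h3.trans ?_
        gcongr
      _ = _ := by
        rw [h8, Real.exp_add (n * K)]
        field_simp
        ring

end MeanHittingTime

theorem theorem2 (α β c : ℝ) (hα : 0 < α) (hβ : 0 < β) (hc : 0 < c) :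
    -- subcritical number of edges
    (c < β / (2 * α) →
      ∀ (Ω : ℕ → Type u) [∀ n, MeasurableSpace (Ω n)] (P : ∀ n, Measure (Ω n))
        [∀ n, IsProbabilityMeasure (P n)] (G : ∀ n, ℝ≥0 → Ω n → SimpleGraph (Fin n)),
        (∀ n, IsDynamicERGraph α β (⊥ : SimpleGraph (Fin n)) (P n) (G n)) →
        (∀ ε : ℝ, 0 < ε →
          Tendsto (fun n => P n {ω | hittingTime (G n) (edgeTarget c n) ω = ∞ ∨
            ε ≤ |(hittingTime (G n) (edgeTarget c n) ω).toReal -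
              -Real.log (1 - 2 * α / β * c) / α|}) atTop (𝓝 0)) ∧
        Tendsto (fun n => ∫⁻ ω, hittingTime (G n) (edgeTarget c n) ω ∂(P n)) atTop
          (𝓝 (ENNReal.ofReal (-Real.log (1 - 2 * α / β * c) / α)))) ∧
    -- critical number of edges
    (c = β / (2 * α) →
      ∃ M : ℝ, ∀ᶠ n : ℕ in atTop, ∀ (j : ℕ) (G₀ : SimpleGraph (Fin n)), numEdges G₀ = j →
        ∀ (Ω : Type u) [MeasurableSpace Ω] (P : Measure Ω) [IsProbabilityMeasure P]
          (G : ℝ≥0 → Ω → SimpleGraph (Fin n)), IsDynamicERGraph α β G₀ P G →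
          ∫⁻ ω, hittingTime G (edgeTarget c n) ω ∂P ≤ ENNReal.ofReal (M * Real.log n)) ∧
    -- supercritical number of edges
    (β / (2 * α) < c →
      0 < c * Real.log (2 * α / β * c) - c + β / (2 * α) ∧
      (∃ C₁ C₂ : ℝ, 0 < C₁ ∧ 0 < C₂ ∧ ∀ᶠ n : ℕ in atTop,
        ∀ (Ω : Type u) [MeasurableSpace Ω] (P : Measure Ω) [IsProbabilityMeasure P]
          (G : ℝ≥0 → Ω → SimpleGraph (Fin n)),
          IsDynamicERGraph α β (⊥ : SimpleGraph (Fin n)) P G →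
          ENNReal.ofReal (C₁ * (n : ℝ) ^ (-1 : ℝ) *
              Real.exp (n * (c * Real.log (2 * α / β * c) - c + β / (2 * α)))) ≤
            ∫⁻ ω, hittingTime G (edgeTarget c n) ω ∂P ∧
          ∫⁻ ω, hittingTime G (edgeTarget c n) ω ∂P ≤
            ENNReal.ofReal (C₂ * (n : ℝ) ^ (-(1 / 2) : ℝ) *
              Real.exp (n * (c * Real.log (2 * α / β * c) - c + β / (2 * α))))) ∧
      ∀ (Ω : ℕ → Type u) [∀ n, MeasurableSpace (Ω n)] (P : ∀ n, Measure (Ω n))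
        [∀ n, IsProbabilityMeasure (P n)] (G : ∀ n, ℝ≥0 → Ω n → SimpleGraph (Fin n)),
        (∀ n, IsDynamicERGraph α β (⊥ : SimpleGraph (Fin n)) (P n) (G n)) →
        TendstoInDistribution
          (fun n ω => (hittingTime (G n) (edgeTarget c n) ω).toReal /
            (∫⁻ ω', hittingTime (G n) (edgeTarget c n) ω' ∂(P n)).toReal)
          atTop (id : ℝ → ℝ) P (expMeasure 1)) := by
  refine ⟨fun hcβ Ω _ P _ G hG => subcritical_tendsto hα hβ hc hcβ Ω P G hG,
    fun h => critical_lintegral_hittingTime_le hα hβ h,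
    fun hcβ => ⟨?_, ?_, fun Ω _ P _ G hG =>
      supercritical_tendstoInDistribution hα hβ hcβ Ω P G hG⟩⟩
  · rw [show 2 * α / β * c = c / (β / (2 * α)) by field_simp]
    exact supercritical_rate_pos (by positivity) hcβ
  · obtain ⟨C₁, C₂, hC₁, hC₂, hbounds⟩ := supercritical_meanPassage_bounds hα hβ hcβ
    obtain ⟨ρ, hρ, J₀, J, δ, hδ, hrates⟩ := eventually_supercritical_rates hα hβ hcβ
    refine ⟨C₁, C₂, hC₁, hC₂, ?_⟩
    filter_upwards [hbounds, hrates, eventually_gt_atTop 0] with n hn hrn hn0 Ω _ P _ G hG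
    obtain ⟨hN, hbirth, -, -, -, hJ, -⟩ := hrn
    have hn0' : (0 : ℝ) < n := by exact_mod_cast hn0
    rw [hG.lintegral_hittingTime_eq (q := edgeRatio α β n) hα (by omega)
      (fun k hk => lt_of_lt_of_le (by positivity) (hbirth k hk).1) hN (fun _ _ => rfl)]
    exact ⟨ENNReal.ofReal_le_ofReal hn.1, ENNReal.ofReal_le_ofReal hn.2⟩
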